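/- Let $n\ge 1$, let $\mathcal X\subset\mathbb R^{d_x}$ and $\mathcal Y\subset\mathbb R^{d_y}$ be closed and convex, let $\mathcal X$ be bounded with diameter $D_x$, and let $(x_0,y_0)\in\mathcal X\times\mathcal Y$. Let $f=\frac1n\sum_{i=1}^n f_i$, where the differentiable functions $f_i:\mathcal X\times\mathcal Y\to\mathbb R$ are $L$-average smooth, i.e. $\frac1n\sum_i\|\nabla f_i(z)-\nabla f_i(z')\|^2\le L^2\|z-z'\|^2$ for all $z,z'\in\mathcal X\times\mathcal Y$, and suppose that $f$ is convex in $x$ and $\mu_y$-strongly concave in $y$, with $L,\mu_y>0$. Put $\kappa_y=L/\mu_y$, let $0<\varepsilon\le 4LD_x^2$, and let $f_{\varepsilon,x_0}(x,y)=f(x,y)+\frac{\varepsilon}{4D_x^2}\|x-x_0\|^2$. For a function $h$ on $\mathcal X\times\mathcal Y$ write $\mathrm{gap}_h(x,y)=\max_{y'\in\mathcal Y}h(x,y')-\min_{x'\in\mathcal X}h(x',y)$; a point $(x,y)\in\mathcal X\times\mathcal Y$ is an $\varepsilon$-saddle point of $h$ if $\mathrm{gap}_h(x,y)\le\varepsilon$.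 Let $\Delta\ge \mathrm{gap}_f(x_0,y_0)$ be a nonnegative real number. L-SVRE on components $h_i$ (with $h=\frac1n\sum_i h_i$), started at $z_0=w_0$ with stepsize $\tau$ and probability $p$, repeats $T$ times, with $\mathbf g=(\nabla_xh,-\nabla_yh)$, $\mathbf g_i=(\nabla_xh_i,-\nabla_yh_i)$, $\mathcal Z=\mathcal X\times\mathcal Y$, $\bar z_k=(1-p)z_k+pw_k$ and $i$ uniformly random in $\{1,\dots,n\}$: $$z_{k+1/2}=\mathcal P_{\mathcal Z}(\bar z_k-\tau\mathbf g(w_k)),\qquad z_{k+1}=\mathcal P_{\mathcal Z}\big(\bar z_k-\tau[\mathbf g(w_k)+\mathbf g_i(z_{k+1/2})-\mathbf g_i(w_k)]\big),$$ and $w_{k+1}=z_{k+1}$ with probability $p$, $w_{k+1}=w_k$ otherwise; the output is $z_T$. AL-SVRE on components $h_i$ starts with $u_0=x_0$ and, for $k=1,\dots,K$, applies $T$ iterations of L-SVRE from $(x_{k-1},y_{k-1})$ to the components $h_i+\frac\beta2\|x-u_{k-1}\|^2$, whose average is $F_k$, obtains $(\tilde x_k,\tilde y_k)$, and puts $$x_k=\mathcal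 P_{\mathcal X}(\tilde x_k-\tau\nabla_xF_k(\tilde x_k,\tilde y_k)),\quad y_k=\mathcal P_{\mathcal Y}(\tilde y_k+\tau\nabla_yF_k(\tilde x_k,\tilde y_k)),\quad u_k=x_k+\tfrac{1-\sqrt q}{1+\sqrt q}(x_k-x_{k-1});$$ the output is $(x_K,y_K)$. Run it on the components $f_i+\frac{\varepsilon}{4D_x^2}\|x-x_0\|^2$ of $f_{\varepsilon,x_0}$, with $L'=3L$, $\mu_x=\frac{\varepsilon}{4D_x^2}$, $p=\frac1{2n}$, $q=\frac{\mu_x}{\mu_x+\beta}$, $\tau=\frac{1}{4\sqrt n(L'+\beta)}$, and $\beta=\mu_y-\mu_x$ if $L'/\mu_y\ge\sqrt n$, $\beta=L'/\sqrt n-\mu_x$ if $L'/\mu_x>\sqrt n>L'/\mu_y$, and $\beta=0$ otherwise. If $\mu_x>\mu_y$, the roles of the two players (and of $\mu_x,\mu_y$) are exchanged first. An SFO call is one evaluation of some $(\nabla_x f_i,\nabla_y f_i)$ at one point. Then there are an absolute constant $C>0$ and numbers $K,T$ that depend only on $n,L,\mu_y,D_x,\varepsilon,\Delta$ such that the output $(\hat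 x,\hat y)$ of AL-SVRE always lies in $\mathcal X\times\mathcal Y$ and satisfies $$\mathbb E\big[\mathrm{gap}_{f_{\varepsilon,x_0}}(\hat x,\hat y)\big]\le\frac\varepsilon2,\qquad \mathbb E\big[\mathrm{gap}_{f}(\hat x,\hat y)\big]\le\varepsilon ,$$ and such that the expected number of SFO calls is at most $$C\Big(n+D_x\sqrt{\tfrac{nL\kappa_y}{\varepsilon}}+n^{3/4}\sqrt{\kappa_y}+n^{3/4}D_x\sqrt{\tfrac L\varepsilon}\Big)\,\log\Big(1+n+\tfrac{LD_x^2}{\varepsilon}+\kappa_y\Big)\,\log\Big(1+n+\tfrac{LD_x^2}{\varepsilon}+\kappa_y+\tfrac{\Delta}{\varepsilon}\Big),$$ that is, $\tilde{\mathcal O}\big((n+D_x\sqrt{nL\kappa_y/\varepsilon}+n^{3/4}\sqrt{\kappa_y}+n^{3/4}D_x\sqrt{L/\varepsilon})\log(1/\varepsilon)\big)$, where $\tilde{\mathcal O}$ hides logarithmic factors of $n$, of $\kappa_y$ and of the condition number of order $LD_x^2/\varepsilon$ of $f_{\varepsilon,x_0}$ in $x$. Moreover, every $\varepsilon/2$-saddle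 point of $f_{\varepsilon,x_0}$ is an $\varepsilon$-saddle point of $f$. -/

import Mathlib

open scoped ENNReal

namespace Minimax

/-! ### Functions of two blocks of variables -/

/-- The space of pairs `(x, y)` with the Euclidean norm `‖(x, y)‖² = ‖x‖² + ‖y‖²`. -/
abbrev Pt (E F : Type) : Type := WithLp 2 (E × F)

/-- The pair `(x, y)` as a point of `Pt E F`. -/
abbrev pt {E F : Type} (x : E) (y : F) : Pt E F := WithLp.toLp 2 (x, y)

/-- The feasible set `X × Y`. -/
def feasible {E F : Type} (X : Set E) (Y : Set F) : Set (Pt E F) :=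
  {z | z.fst ∈ X ∧ z.snd ∈ Y}

section Functions

variable {E F : Type} [NormedAddCommGroup E] [InnerProductSpace ℝ E]
  [NormedAddCommGroup F] [InnerProductSpace ℝ F]

/-- The objective `f = (1/n) ∑ᵢ fᵢ`. -/
noncomputable def average {n : ℕ} (f : Fin n → Pt E F → ℝ) (z : Pt E F) : ℝ :=
  (1 / (n : ℝ)) * ∑ i, f i z

/-- `L`-average smoothness on `Z` of a family whose gradients on `Z` are `g i`. -/
def AverageSmooth {n : ℕ} (g : Fin n → Pt E F → Pt E F) (Z : Set (Pt E F)) (L : ℝ) : Prop :=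
  ∀ z ∈ Z, ∀ z' ∈ Z,
    (1 / (n : ℝ)) * ∑ i, ‖g i z - g i z'‖ ^ 2 ≤ L ^ 2 * ‖z - z'‖ ^ 2

/-- `h` is `(μx, μy)`-convex-concave on `X × Y`; the moduli may be zero. -/
def ConvexConcave (h : Pt E F → ℝ) (X : Set E) (Y : Set F) (μx μy : ℝ) : Prop :=
  (∀ y ∈ Y, StrongConvexOn X μx fun x => h (pt x y)) ∧
    ∀ x ∈ X, StrongConcaveOn Y μy fun y => h (pt x y)

/-- The duality gap `max_{v ∈ Y} h(x, v) - min_{u ∈ X} h(u, y)`, computed with extended real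
suprema and infima, so that an unbounded supremum or infimum makes it infinite.
It is nonnegative for `(x, y) ∈ X × Y`. -/
noncomputable def dualityGap (h : Pt E F → ℝ) (X : Set E) (Y : Set F) (x : E) (y : F) : ℝ≥0∞ :=
  ((⨆ v ∈ Y, (h (pt x v) : EReal)) - ⨅ u ∈ X, (h (pt u y) : EReal)).toENNReal

/-- `(x, y)` is an `ε`-saddle point of `h` on `X × Y`. -/
def IsApproxSaddle (h : Pt E F → ℝ) (X : Set E) (Y : Set F) (ε : ℝ) (x : E) (y : F) : Prop :=
  x ∈ X ∧ y ∈ Y ∧ dualityGap h X Y x y ≤ ENNReal.ofReal ε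

/-- The regularized function `h(x, y) + (ε / (4 D²)) ‖x - x₀‖²`. -/
noncomputable def regularize (h : Pt E F → ℝ) (ε D : ℝ) (x₀ : E) (z : Pt E F) : ℝ :=
  h z + ε / (4 * D ^ 2) * ‖z.fst - x₀‖ ^ 2

end Functions

/-- The Euclidean projection onto `C`: the point of `C` nearest to `z`
(it exists and is unique when `C` is nonempty, closed and convex). -/
noncomputable def proj {E : Type} [NormedAddCommGroup E] (C : Set E) (z : E) : E :=
  Classical.epsilon fun u => u ∈ C ∧ ∀ v ∈ C, ‖u - z‖ ≤ ‖v - z‖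

/-! ### Randomized programs that count their calls of the stochastic first-order oracle -/

/-- Randomized programs with a counter of oracle calls:
a program sends the current count to the joint law of its output and of the new count. -/
abbrev Prog : Type → Type := StateT ℕ PMF

/-- A random draw; it costs no oracle call. -/
noncomputable def draw {α : Type} (p : PMF α) : Prog α := fun c => p.bind fun a => PMF.pure (a, c)

/-- A coin that shows `true` with probability `p`. -/
noncomputable def coin (p : unitInterval) : PMF Bool :=
  PMF.ofFintype (fun b => cond b (ENNReal.ofReal p) (ENNReal.ofReal (1 - p))) (by
    have h0 : (0 : ℝ) ≤ p := p.2.1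
    have h1 : (0 : ℝ) ≤ 1 - p := sub_nonneg.2 p.2.2
    simp [← ENNReal.ofReal_add h0 h1])

/-- The expectation of a function of the output and of the total number of oracle calls. -/
noncomputable def expect {α : Type} (m : Prog α) (φ : α → ℕ → ℝ≥0∞) : ℝ≥0∞ :=
  ∑' r : α × ℕ, (m.run 0) r * φ r.1 r.2

/-- `a` is an output that the program returns with positive probability. -/
def IsOutput {α : Type} (m : Prog α) (a : α) : Prop :=
  ∃ c : ℕ, (a, c) ∈ (m.run 0).support

section Algorithms

variable {E F : Type} [NormedAddCommGroup E] [InnerProductSpace ℝ E]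
  [NormedAddCommGroup F] [InnerProductSpace ℝ F] {n : ℕ}

/-- An oracle returns, for an index `i` and a point `z`, the gradient
`(∇ₓ fᵢ(z), ∇_y fᵢ(z))` of the `i`-th component. -/
abbrev Oracle (n : ℕ) (E F : Type) : Type := Fin n → Pt E F → Prog (Pt E F)

/-- The stochastic first-order oracle of components with gradients `g i`: each call counts once. -/
noncomputable def sfo (g : Fin n → Pt E F → Pt E F) : Oracle n E F :=
  fun i z => do
    modify (· + 1)
    pure (g i z)

/-- The oracle of the components `fᵢ(x, y) + (b / 2) ‖x - u‖²`;
one call of it makes one call of the oracle of the `fᵢ`. -/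
noncomputable def Oracle.addProx (O : Oracle n E F) (b : ℝ) (u : E) : Oracle n E F :=
  fun i z => do
    let v ← O i z
    pure (v + pt (b • (z.fst - u)) 0)

/-- The oracle of the components `(y, x) ↦ -fᵢ(x, y)`, that is, of the same saddle point problem
with the roles of the two players exchanged. -/
noncomputable def Oracle.swap (O : Oracle n E F) : Oracle n F E :=
  fun i z => do
    let v ← O i (pt z.snd z.fst)
    pure (pt (-v.snd) (-v.fst))

/-- The gradient of the average, computed by `n` oracle calls. -/
noncomputable def fullGrad (O : Oracle n E F) (z : Pt E F) : Prog (Pt E F) := do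
  let s ← (List.finRange n).foldlM (fun s i => do
    let v ← O i z
    pure (s + v)) (0 : Pt E F)
  pure ((1 / (n : ℝ)) • s)

/-- From a gradient `(a, b)` to the gradient operator `(a, -b)`. -/
def signOp (v : Pt E F) : Pt E F := pt v.fst (-v.snd)

/-- L-SVRE on `X × Y`, started at `z₀`, after a given number of iterations. The state is
`(z_k, w_k, 𝐠(w_k))`; the full gradient operator is recomputed, by `n` oracle calls, exactly
when the reference point `w` is refreshed. -/
noncomputable def lsvreState [NeZero n] (O : Oracle n E F) (X : Set E) (Y : Set F)
    (z₀ : Pt E F) (τ : ℝ) (p : unitInterval) : ℕ → Prog (Pt E F × Pt E F × Pt E F)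
  | 0 => do
    let G ← fullGrad O z₀
    pure (z₀, z₀, signOp G)
  | k + 1 => do
    let (z, w, gw) ← lsvreState O X Y z₀ τ p k
    let zbar := (1 - (p : ℝ)) • z + (p : ℝ) • w
    let zhalf := proj (feasible X Y) (zbar - τ • gw)
    let i ← draw (PMF.uniformOfFintype (Fin n))
    let a ← O i zhalf
    let b ← O i w
    let znew := proj (feasible X Y) (zbar - τ • (gw + signOp a - signOp b))
    let refresh ← draw (coin p)
    if refresh then do
      let G ← fullGrad O znew
      pure (znew, znew, signOp G)
    else
      pure (znew, w, gw)

/-- The output of L-SVRE after `T` iterations. -/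
noncomputable def lsvre [NeZero n] (O : Oracle n E F) (X : Set E) (Y : Set F)
    (z₀ : Pt E F) (τ : ℝ) (p : unitInterval) (T : ℕ) : Prog (Pt E F) := do
  let s ← lsvreState O X Y z₀ τ p T
  pure s.1

/-- AL-SVRE after a given number of outer iterations; the state is `(x_k, y_k, u_k)`. -/
noncomputable def alsvreState [NeZero n] (O : Oracle n E F) (X : Set E) (Y : Set F)
    (x₀ : E) (y₀ : F) (β q : ℝ) (p : unitInterval) (τ : ℕ → ℝ) (T : ℕ → ℕ) :
    ℕ → Prog (E × F × E)
  | 0 => pure (x₀, y₀, x₀)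
  | k + 1 => do
    let (x, y, u) ← alsvreState O X Y x₀ y₀ β q p τ T k
    let Ok := O.addProx β u
    let zt ← lsvre Ok X Y (pt x y) (τ (k + 1)) p (T (k + 1))
    let G ← fullGrad Ok zt
    let xnew := proj X (zt.fst - τ (k + 1) • G.fst)
    let ynew := proj Y (zt.snd + τ (k + 1) • G.snd)
    let γ := (1 - √q) / (1 + √q)
    pure (xnew, ynew, xnew + γ • (xnew - x))

/-- The output of AL-SVRE after `K` outer iterations. -/
noncomputable def alsvre [NeZero n] (O : Oracle n E F) (X : Set E) (Y : Set F)
    (x₀ : E) (y₀ : F) (β q : ℝ) (K : ℕ) (p : unitInterval) (τ : ℕ → ℝ) (T : ℕ → ℕ) :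
    Prog (E × F) := do
  let s ← alsvreState O X Y x₀ y₀ β q p τ T K
  pure (s.1, s.2.1)

/-- The refreshing probability `1 / (2n)`. -/
noncomputable def refreshProb (n : ℕ) : unitInterval :=
  ⟨1 / (2 * (n : ℝ)), by positivity, by
    rcases Nat.eq_zero_or_pos n with h | h
    · simp [h]
    · have : (1 : ℝ) ≤ n := by exact_mod_cast h
      rw [div_le_one (by positivity)]
      linarith⟩

/-- The proximal parameter `β` of AL-SVRE on an `L`-average smooth, `(μx, μy)`-convex-concave
problem with `μx ≤ μy`. -/
noncomputable def proxParam (n : ℕ) (L μx μy : ℝ) : ℝ :=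
  if √(n : ℝ) ≤ L / μy then μy - μx
  else if √(n : ℝ) < L / μx then L / √(n : ℝ) - μx
  else 0

/-- AL-SVRE with the parameter setting for `L`-average smooth, `(μx, μy)`-convex-concave problems
with `μx ≤ μy`: `β` as above, `q = μx / (μx + β)`, `p = 1 / (2n)`, stepsizes
`1 / (4 √n (L + β))`, `K` outer iterations, and `T` iterations of L-SVRE for each subproblem. -/
noncomputable def alsvreTuned [NeZero n] (O : Oracle n E F) (X : Set E) (Y : Set F)
    (x₀ : E) (y₀ : F) (L μx μy : ℝ) (K T : ℕ) : Prog (E × F) :=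
  let β := proxParam n L μx μy
  alsvre O X Y x₀ y₀ β (μx / (μx + β)) K (refreshProb n)
    (fun _ => 1 / (4 * √(n : ℝ) * (L + β))) (fun _ => T)

/-- AL-SVRE without the normalization `μx ≤ μy`: if `μy < μx`, the algorithm is run on the same
problem with the roles of `x` and `y` exchanged. -/
noncomputable def alsvreMain [NeZero n] (O : Oracle n E F) (X : Set E) (Y : Set F)
    (x₀ : E) (y₀ : F) (L μx μy : ℝ) (K T : ℕ) : Prog (E × F) :=
  open Classical in
  if μx ≤ μy then alsvreTuned O X Y x₀ y₀ L μx μy K T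
  else do
    let s ← alsvreTuned O.swap Y X y₀ x₀ L μy μx K T
    pure (s.2, s.1)

/-- AL-SVRE run on the regularized components `fᵢ(x, y) + (ε / (4 D²)) ‖x - x₀‖²`, where the `fᵢ`
have gradients `g i` and are `L`-average smooth. These components are `3L`-average smooth if
`ε ≤ 4 L D²`, and their average is `(ε / (4 D²), μy)`-convex-concave. -/
noncomputable def alsvreRegularized [NeZero n] (g : Fin n → Pt E F → Pt E F)
    (X : Set E) (Y : Set F) (x₀ : E) (y₀ : F) (L μy D ε : ℝ) (K T : ℕ) : Prog (E × F) :=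
  alsvreMain ((sfo g).addProx (ε / (2 * D ^ 2)) x₀) X Y x₀ y₀
    (3 * L) (ε / (4 * D ^ 2)) μy K T

end Algorithms

/-- The rate `n + D √(n L κ / ε) + n^{3/4} √κ + n^{3/4} D √(L / ε)` with `κ = L / μy`. -/
noncomputable def rate (n : ℕ) (L μy D ε : ℝ) : ℝ :=
  n + D * √(n * L * (L / μy) / ε) + (n : ℝ) ^ (3 / 4 : ℝ) * √(L / μy)
    + (n : ℝ) ^ (3 / 4 : ℝ) * D * √(L / ε)

end Minimax

open Minimax

/-! Every quantity is controlled in expectation, by a potential for each of the two nested loops.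
Expectations live in `ℝ≥0∞`, and each potential equals `∞` on states that violate the invariants
(feasibility, correct stored gradient). A finite expected potential therefore also proves that every
possible output is feasible, without a separate argument on supports.

Inner loop. A subproblem is a strongly monotone variational inequality with solution `zs`. Averaged
over the random index, an extragradient step decreases `(1 - p) ‖z - zs‖² + ‖w - zs‖²`: the two
projection inequalities (`extragradient_ineq`) leave negative squares that absorb the variance,
which average smoothness bounds by `‖zh - w‖²`. The result is linear convergence at a rate `ρ` of
order `min (1 / n) (τ m)`, where `m` is the strong monotonicity modulus (`wp_lsvre_feasDist_le`).

Outer loop. This is Nesterov's accelerated proximal point method for the primal function `max_y h(x,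
y)`. The approximate solution of a subproblem undergoes one projected gradient step, so that its
error becomes a residual `r` of the variational inequality (`exists_residual`), and a residual
enters the accelerated potential only through `‖r‖² / μ` (`SaddleIneq.accPot_le`). A small multiple
of the squared dual distance is added to the potential so that it also controls the starting point
of the next subproblem. A fixed number `T` of inner steps, logarithmic in `n` and the condition
number, then gives the required accuracy relative to the current potential, and each outer step
contracts the potential by `1 - Q / 4`, with `Q = √q`. One final step turns the potential into the
full duality gap, at the price of a factor `(l / μ)³` that only enters a logarithm.

Complexity. The product of `1 / Q` outer steps and a cost of order `n + √n l / m` each is balanced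
by `β` (`proxParam_spec`). The regularizer vanishes at `x₀` and is at most `ε / 4` on `X`; hence it
does not increase the initial gap and changes the final one by at most `ε / 4`. -/

namespace Minimax

/-! ### Expectations of randomized programs -/

/-- The expectation of a function of the output and of the counter, when the program is started
with the counter at `c`. -/
noncomputable def wp {α : Type} (m : Prog α) (c : ℕ) (φ : α → ℕ → ℝ≥0∞) : ℝ≥0∞ :=
  ∑' r : α × ℕ, (m.run c) r * φ r.1 r.2

theorem wp_pure {α : Type} (a : α) (c : ℕ) (φ : α → ℕ → ℝ≥0∞) :
    wp (pure a : Prog α) c φ = φ a c := by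
  unfold wp
  rw [tsum_eq_single (a, c)]
  · simp [StateT.run, pure, StateT.pure, PMF.pure_apply]
  · rintro b hb
    simp [StateT.run, pure, StateT.pure, PMF.pure_apply, hb]

/-- Tonelli for nonnegative double sums; no summability condition arises because expectations take
values in `ℝ≥0∞`. -/
theorem wp_bind {α γ : Type} (m : Prog α) (k : α → Prog γ) (c : ℕ) (φ : γ → ℕ → ℝ≥0∞) :
    wp (m >>= k) c φ = wp m c fun a c' => wp (k a) c' φ := by
  have h : (m >>= k).run c = (m.run c).bind fun r => (k r.1).run r.2 := rfl
  unfold wp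
  rw [h]
  simp only [PMF.bind_apply, ← ENNReal.tsum_mul_right, ← ENNReal.tsum_mul_left]
  rw [ENNReal.tsum_comm]
  simp only [mul_assoc]

theorem wp_draw {α : Type} (p : PMF α) (c : ℕ) (φ : α → ℕ → ℝ≥0∞) :
    wp (draw p) c φ = ∑' a, p a * φ a c := by
  have h : (draw p).run c = p.bind fun a => PMF.pure (a, c) := rfl
  unfold wp
  rw [h]
  simp only [PMF.bind_apply, ← ENNReal.tsum_mul_right]
  rw [ENNReal.tsum_comm]
  refine tsum_congr fun a => ?_
  rw [tsum_eq_single (a, c)]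
  · simp [PMF.pure_apply]
  · rintro b hb
    simp [PMF.pure_apply, hb]

theorem wp_draw_uniform {n : ℕ} [NeZero n] (c : ℕ) (φ : Fin n → ℕ → ℝ≥0∞) :
    wp (draw (PMF.uniformOfFintype (Fin n))) c φ = ∑ i, (n : ℝ≥0∞)⁻¹ * φ i c := by
  rw [wp_draw, tsum_fintype]
  simp

theorem wp_draw_coin (p : unitInterval) (c : ℕ) (φ : Bool → ℕ → ℝ≥0∞) :
    wp (draw (coin p)) c φ
      = ENNReal.ofReal p * φ true c + ENNReal.ofReal (1 - p) * φ false c := by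
  rw [wp_draw, tsum_fintype]
  simp [coin]

theorem wp_mono {α : Type} (m : Prog α) (c : ℕ) {φ ψ : α → ℕ → ℝ≥0∞}
    (h : ∀ a c', φ a c' ≤ ψ a c') : wp m c φ ≤ wp m c ψ :=
  ENNReal.tsum_le_tsum fun _ => mul_le_mul_right (h _ _) _

theorem wp_const {α : Type} (m : Prog α) (c : ℕ) (a : ℝ≥0∞) : wp m c (fun _ _ => a) = a := by
  unfold wp
  rw [ENNReal.tsum_mul_right, PMF.tsum_coe, one_mul]

theorem wp_add {α : Type} (m : Prog α) (c : ℕ) (φ ψ : α → ℕ → ℝ≥0∞) :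
    wp m c (fun a c' => φ a c' + ψ a c') = wp m c φ + wp m c ψ := by
  unfold wp
  rw [← ENNReal.tsum_add]
  simp only [mul_add]

theorem wp_const_mul {α : Type} (m : Prog α) (c : ℕ) (a : ℝ≥0∞) (φ : α → ℕ → ℝ≥0∞) :
    wp m c (fun s c' => a * φ s c') = a * wp m c φ := by
  unfold wp
  rw [← ENNReal.tsum_mul_left]
  refine tsum_congr fun r => ?_
  ring

/-- A function with finite expectation is finite on all outputs. -/
theorem ne_top_of_isOutput {α : Type} {m : Prog α} {φ : α → ℕ → ℝ≥0∞} (h : wp m 0 φ ≠ ∞)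
    {a : α} (ha : IsOutput m a) : ∃ c, φ a c ≠ ∞ := by
  obtain ⟨c, hc⟩ := ha
  refine ⟨c, fun h' => h ?_⟩
  refine ENNReal.tsum_eq_top_of_eq_top ⟨(a, c), ?_⟩
  simp only [h']
  exact ENNReal.mul_top ((PMF.mem_support_iff _ _).1 hc)

/-- The program makes at most `B` oracle calls in expectation. -/
def CostLE {α : Type} (m : Prog α) (B : ℝ≥0∞) : Prop :=
  ∀ c : ℕ, wp m c (fun _ c' => (c' : ℝ≥0∞)) ≤ c + B

theorem costLE_pure {α : Type} (a : α) : CostLE (pure a) 0 := fun c => by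
  rw [wp_pure, add_zero]

theorem CostLE.bind {α γ : Type} {m : Prog α} {k : α → Prog γ} {A B : ℝ≥0∞} (hm : CostLE m A)
    (hk : ∀ a, CostLE (k a) B) : CostLE (m >>= k) (A + B) := fun c => by
  rw [wp_bind]
  calc _ ≤ wp m c (fun _ c' => (c' : ℝ≥0∞) + B) := wp_mono m c fun a c' => hk a c'
    _ = wp m c (fun _ c' => (c' : ℝ≥0∞)) + B := by rw [wp_add, wp_const]
    _ ≤ c + (A + B) := by rw [← add_assoc]; gcongr; exact hm c

theorem CostLE.mono {α : Type} {m : Prog α} {A B : ℝ≥0∞} (hm : CostLE m A) (h : A ≤ B) :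
    CostLE m B := fun c => (hm c).trans (by gcongr)

/-! ### Exact evaluation of oracle calls, and oracles of modified components. -/

section Oracles

set_option linter.unusedSectionVars false

variable {E F : Type} [NormedAddCommGroup E] [InnerProductSpace ℝ E]
  [NormedAddCommGroup F] [InnerProductSpace ℝ F] {n : ℕ}

theorem wp_sfo (g : Fin n → Pt E F → Pt E F) (i : Fin n) (z : Pt E F) (c : ℕ)
    (φ : Pt E F → ℕ → ℝ≥0∞) : wp (sfo g i z) c φ = φ (g i z) (c + 1) := by
  have h : (sfo g i z).run c = PMF.pure (g i z, c + 1) := by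
    change (PMF.pure (PUnit.unit, c + 1)).bind (fun r => PMF.pure (g i z, r.2)) = _
    rw [PMF.pure_bind]
  unfold wp
  rw [h, tsum_eq_single (g i z, c + 1)]
  · simp [PMF.pure_apply]
  · rintro b hb
    simp [PMF.pure_apply, hb]

/-- The gradient of the average. -/
noncomputable def meanGrad (g : Fin n → Pt E F → Pt E F) (z : Pt E F) : Pt E F :=
  (1 / (n : ℝ)) • ∑ i, g i z

theorem wp_fullGrad (g : Fin n → Pt E F → Pt E F) (z : Pt E F) (c : ℕ)
    (φ : Pt E F → ℕ → ℝ≥0∞) : wp (fullGrad (sfo g) z) c φ = φ (meanGrad g z) (c + n) := by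
  have key : ∀ (l : List (Fin n)) (s : Pt E F) (c : ℕ) (φ : Pt E F → ℕ → ℝ≥0∞),
      wp (l.foldlM (fun s i => do
        let v ← sfo g i z
        pure (s + v)) s) c φ = φ (s + (l.map fun i => g i z).sum) (c + l.length) := by
    intro l
    induction l with
    | nil => intro s c φ; simp [wp_pure]
    | cons i l ih =>
      intro s c φ
      rw [List.foldlM_cons, wp_bind, wp_bind, wp_sfo, wp_pure, ih]
      rw [List.map_cons, List.sum_cons, List.length_cons, add_assoc, add_assoc, add_comm 1]
  unfold fullGrad
  rw [wp_bind, key, wp_pure, zero_add, List.length_finRange, meanGrad]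
  rw [Fin.sum_univ_def]

/-- The gradients of the components `fᵢ(x, y) + (b / 2) ‖x - u‖²`. -/
def proxGrad (g : Fin n → Pt E F → Pt E F) (b : ℝ) (u : E) : Fin n → Pt E F → Pt E F :=
  fun i z => g i z + pt (b • (z.fst - u)) 0

/-- The gradients of the components `(y, x) ↦ -fᵢ(x, y)`. -/
def swapGrad (g : Fin n → Pt E F → Pt E F) : Fin n → Pt F E → Pt F E :=
  fun i z => pt (-(g i (pt z.snd z.fst)).snd) (-(g i (pt z.snd z.fst)).fst)

theorem sfo_bind_pure {E' F' : Type} (g : Fin n → Pt E F → Pt E F)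
    (h : Pt E F → Pt E' F') (i : Fin n) (z : Pt E F) :
    (sfo g i z >>= fun v => pure (h v) : Prog (Pt E' F'))
      = (do modify (· + 1); pure (h (g i z))) := by
  unfold sfo
  rw [bind_assoc]
  simp

/-- A modified oracle is again the plain oracle of a modified family of gradients, so the analysis
is needed only for `sfo g` with arbitrary `g`. -/
theorem addProx_sfo (g : Fin n → Pt E F → Pt E F) (b : ℝ) (u : E) :
    (sfo g).addProx b u = sfo (proxGrad g b u) := by
  funext i z
  exact sfo_bind_pure g (fun v => v + pt (b • (z.fst - u)) 0) i z

theorem swap_sfo (g : Fin n → Pt E F → Pt E F) : (sfo g).swap = sfo (swapGrad g) := by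
  funext i z
  exact sfo_bind_pure g (fun v => pt (-v.snd) (-v.fst)) i (pt z.snd z.fst)

theorem costLE_fullGrad (g : Fin n → Pt E F → Pt E F) (z : Pt E F) :
    CostLE (fullGrad (sfo g) z) n := fun c => by
  rw [wp_fullGrad]; simp

end Oracles

/-! ### Projections and variational inequalities -/

section Projection

variable {H : Type} [NormedAddCommGroup H] [InnerProductSpace ℝ H]

theorem proj_spec [CompleteSpace H] {C : Set H} (hC : Convex ℝ C) (hcl : IsClosed C)
    (hne : C.Nonempty) (z : H) :
    proj C z ∈ C ∧ ∀ w ∈ C, inner ℝ (z - proj C z) (w - proj C z) ≤ 0 := by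
  have hex : ∃ u, u ∈ C ∧ ∀ v ∈ C, ‖u - z‖ ≤ ‖v - z‖ := by
    obtain ⟨u, hu, hu'⟩ := exists_norm_eq_iInf_of_complete_convex hne hcl.isComplete hC z
    refine ⟨u, hu, fun v hv => ?_⟩
    rw [norm_sub_rev u, norm_sub_rev v, hu']
    exact ciInf_le ⟨0, by rintro _ ⟨w, rfl⟩; positivity⟩ (⟨v, hv⟩ : C)
  have h : proj C z ∈ C ∧ ∀ v ∈ C, ‖proj C z - z‖ ≤ ‖v - z‖ := Classical.epsilon_spec hex
  refine ⟨h.1, (norm_eq_iInf_iff_real_inner_le_zero hC h.1).1 ?_⟩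
  have : Nonempty C := ⟨⟨_, h.1⟩⟩
  refine le_antisymm (le_ciInf fun w => ?_) (ciInf_le ⟨0, ?_⟩ (⟨_, h.1⟩ : C))
  · rw [norm_sub_rev z, norm_sub_rev z]
    exact h.2 w w.2
  · rintro _ ⟨w, rfl⟩; positivity

theorem norm_proj_sub_proj_le [CompleteSpace H] {C : Set H} (hC : Convex ℝ C) (hcl : IsClosed C)
    (hne : C.Nonempty) (z z' : H) : ‖proj C z - proj C z'‖ ≤ ‖z - z'‖ := by
  obtain ⟨h1, h2⟩ := proj_spec hC hcl hne z
  obtain ⟨h1', h2'⟩ := proj_spec hC hcl hne z'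
  have a := h2 _ h1'
  have b := h2' _ h1
  have e : inner ℝ (z - z') (proj C z - proj C z') = ‖proj C z - proj C z'‖ ^ 2
      - inner ℝ (z - proj C z) (proj C z' - proj C z)
      - inner ℝ (z' - proj C z') (proj C z - proj C z') := by
    rw [← real_inner_self_eq_norm_sq]
    simp only [inner_sub_left, inner_sub_right]
    ring
  have c := real_inner_le_norm (z - z') (proj C z - proj C z')
  nlinarith [norm_nonneg (proj C z - proj C z'), norm_nonneg (z - z')]

/-- `z` solves the variational inequality of the operator `G` on `C`. -/
def IsVISol (G : H → H) (C : Set H) (z : H) : Prop :=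
  z ∈ C ∧ ∀ w ∈ C, 0 ≤ inner ℝ (G z) (w - z)

/-- For a small step `t` the map `z ↦ proj C (z - t G z)` is a contraction of `C`, and its fixed
point solves the inequality. -/
theorem exists_isVISol [CompleteSpace H] {C : Set H} (hC : Convex ℝ C) (hcl : IsClosed C)
    (hne : C.Nonempty) {G : H → H} {L m : ℝ} (hm : 0 < m)
    (hL : ∀ z ∈ C, ∀ z' ∈ C, ‖G z - G z'‖ ≤ L * ‖z - z'‖)
    (hG : ∀ z ∈ C, ∀ z' ∈ C, m * ‖z - z'‖ ^ 2 ≤ inner ℝ (G z - G z') (z - z')) :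
    ∃ z, IsVISol G C z := by
  -- The squared contraction factor `1 - 2 t m + t² L²` is then at most `1 - t m`; the summand `m²`
  -- keeps `t m ≤ 1` and the denominator positive, whatever `L` is.
  set t : ℝ := m / (L ^ 2 + m ^ 2) with ht
  have hden : 0 < L ^ 2 + m ^ 2 := by positivity
  have ht0 : 0 < t := by positivity
  have htm : t * (L ^ 2 + m ^ 2) = m := by rw [ht]; field_simp
  have htm1 : t * m ≤ 1 := by
    rw [ht, div_mul_eq_mul_div, div_le_one hden]; nlinarith [sq_nonneg L]
  have : CompleteSpace C := hcl.isComplete.completeSpace_coe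
  have : Nonempty C := hne.to_subtype
  let S : C → C := fun z => ⟨proj C (z - t • G z), (proj_spec hC hcl hne _).1⟩
  have hk0 : 0 ≤ 1 - t * m := by linarith
  have hS : LipschitzWith (Real.toNNReal (√(1 - t * m))) S := by
    refine LipschitzWith.of_dist_le_mul fun z z' => ?_
    rw [Subtype.dist_eq, Subtype.dist_eq, dist_eq_norm, dist_eq_norm,
      Real.coe_toNNReal _ (Real.sqrt_nonneg _)]
    refine (norm_proj_sub_proj_le hC hcl hne _ _).trans ?_
    refine le_of_sq_le_sq ?_ (by positivity)
    rw [mul_pow, Real.sq_sqrt hk0]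
    have e : ((z : H) - t • G z) - (z' - t • G z') = ((z : H) - z') - t • (G z - G z') := by
      rw [smul_sub]; abel
    rw [e, norm_sub_sq_real, norm_smul, real_inner_smul_right, Real.norm_eq_abs,
      abs_of_pos ht0, real_inner_comm]
    have h1 := hG z z.2 z' z'.2
    have h2 : ‖G z - G z'‖ ^ 2 ≤ (L * ‖(z : H) - z'‖) ^ 2 :=
      pow_le_pow_left₀ (norm_nonneg _) (hL z z.2 z' z'.2) 2
    have h3 : t ^ 2 * ‖G z - G z'‖ ^ 2 ≤ t ^ 2 * (L * ‖(z : H) - z'‖) ^ 2 := by gcongr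
    have h4 : t ^ 2 * L ^ 2 ≤ t * m := by nlinarith [sq_nonneg (t * m)]
    have h5 : t ^ 2 * L ^ 2 * ‖(z : H) - z'‖ ^ 2 ≤ t * m * ‖(z : H) - z'‖ ^ 2 := by gcongr
    nlinarith
  have hS' : ContractingWith (Real.toNNReal (√(1 - t * m))) S := by
    refine ⟨?_, hS⟩
    rw [Real.toNNReal_lt_one, Real.sqrt_lt' one_pos]
    nlinarith [mul_pos ht0 hm]
  obtain ⟨z, hz⟩ : ∃ z : C, S z = z := ⟨_, hS'.fixedPoint_isFixedPt⟩
  have hfix : proj C ((z : H) - t • G z) = z := congrArg Subtype.val hz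
  refine ⟨z, z.2, fun w hw => ?_⟩
  have h := (proj_spec hC hcl hne ((z : H) - t • G z)).2 w hw
  rw [hfix, sub_sub_cancel_left, inner_neg_left, real_inner_smul_left] at h
  nlinarith

end Projection

/-! ### Convex-concave problems -/

section Saddle

set_option linter.unusedSectionVars false

variable {E F : Type} [NormedAddCommGroup E] [InnerProductSpace ℝ E]
  [NormedAddCommGroup F] [InnerProductSpace ℝ F] {n : ℕ}

theorem pt_ext {z w : Pt E F} (h1 : z.fst = w.fst) (h2 : z.snd = w.snd) : z = w := by
  have h : (pt z.fst z.snd : Pt E F) = pt w.fst w.snd := by rw [h1, h2]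
  exact h

theorem feasible_convex {X : Set E} {Y : Set F} (hX : Convex ℝ X) (hY : Convex ℝ Y) :
    Convex ℝ (feasible X Y) := by
  intro z hz w hw a b ha hb hab
  exact ⟨hX hz.1 hw.1 ha hb hab, hY hz.2 hw.2 ha hb hab⟩

theorem feasible_isClosed {X : Set E} {Y : Set F} (hX : IsClosed X) (hY : IsClosed Y) :
    IsClosed (feasible X Y) :=
  (hX.preimage (f := fun z : Pt E F => z.fst) (by fun_prop)).inter
    (hY.preimage (f := fun z : Pt E F => z.snd) (by fun_prop))

theorem norm_pt_sq (z : Pt E F) : ‖z‖ ^ 2 = ‖z.fst‖ ^ 2 + ‖z.snd‖ ^ 2 :=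
  WithLp.prod_norm_sq_eq_of_L2 z

theorem inner_pt (z w : Pt E F) :
    inner ℝ z w = inner ℝ z.fst w.fst + inner ℝ z.snd w.snd :=
  WithLp.prod_inner_apply z w

theorem norm_fst_sq_le (z : Pt E F) : ‖z.fst‖ ^ 2 ≤ ‖z‖ ^ 2 := by
  rw [norm_pt_sq]; nlinarith [sq_nonneg ‖z.snd‖]

theorem norm_snd_sq_le (z : Pt E F) : ‖z.snd‖ ^ 2 ≤ ‖z‖ ^ 2 := by
  rw [norm_pt_sq]; nlinarith [sq_nonneg ‖z.fst‖]

theorem fst_sum (v : Fin n → Pt E F) : (∑ i, v i).fst = ∑ i, (v i).fst :=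
  map_sum (⟨⟨fun z : Pt E F => z.fst, rfl⟩, fun _ _ => rfl⟩ : Pt E F →+ E) _ _

theorem snd_sum (v : Fin n → Pt E F) : (∑ i, v i).snd = ∑ i, (v i).snd :=
  map_sum (⟨⟨fun z : Pt E F => z.snd, rfl⟩, fun _ _ => rfl⟩ : Pt E F →+ F) _ _

theorem signOp_sub (v w : Pt E F) : signOp (v - w) = signOp v - signOp w := by
  apply pt_ext <;> simp [signOp]
  abel

theorem signOp_add (v w : Pt E F) : signOp (v + w) = signOp v + signOp w := by
  apply pt_ext <;> simp [signOp]
  abel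

theorem signOp_average (v : Fin n → Pt E F) :
    signOp ((1 / (n : ℝ)) • ∑ i, v i) = (1 / (n : ℝ)) • ∑ i, signOp (v i) := by
  apply pt_ext <;> simp [signOp, fst_sum, snd_sum]

theorem norm_signOp (v : Pt E F) : ‖signOp v‖ = ‖v‖ := by
  rw [← sq_eq_sq₀ (norm_nonneg _) (norm_nonneg _), norm_pt_sq, norm_pt_sq]
  simp [signOp]

/-- The gradient operator `(∇ₓ, -∇_y)` of the average. -/
noncomputable def gradOp (g : Fin n → Pt E F → Pt E F) (z : Pt E F) : Pt E F :=
  signOp (meanGrad g z)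

theorem meanGrad_sub (g : Fin n → Pt E F → Pt E F) (z z' : Pt E F) :
    meanGrad g z - meanGrad g z' = (1 / (n : ℝ)) • ∑ i, (g i z - g i z') := by
  rw [meanGrad, meanGrad, ← smul_sub, Finset.sum_sub_distrib]

theorem norm_average_sq_le [NeZero n] (v : Fin n → Pt E F) :
    ‖(1 / (n : ℝ)) • ∑ i, v i‖ ^ 2 ≤ (1 / (n : ℝ)) * ∑ i, ‖v i‖ ^ 2 := by
  have hn : (0 : ℝ) < n := by exact_mod_cast Nat.pos_of_ne_zero (NeZero.ne n)
  have h1 : ‖∑ i, v i‖ ^ 2 ≤ (∑ i, ‖v i‖) ^ 2 := by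
    gcongr
    exact norm_sum_le _ _
  have h2 : (∑ i, ‖v i‖) ^ 2 ≤ n * ∑ i, ‖v i‖ ^ 2 := by
    simpa using sq_sum_le_card_mul_sum_sq (s := Finset.univ) (f := fun i => ‖v i‖)
  rw [norm_smul, mul_pow, Real.norm_of_nonneg (by positivity)]
  calc _ ≤ (1 / (n : ℝ)) ^ 2 * (n * ∑ i, ‖v i‖ ^ 2) := by gcongr; exact h1.trans h2
    _ = _ := by field_simp

theorem AverageSmooth.norm_meanGrad_sub_le [NeZero n] {g : Fin n → Pt E F → Pt E F}
    {Z : Set (Pt E F)} {L : ℝ} (hg : AverageSmooth g Z L) (hL : 0 ≤ L) {z z' : Pt E F}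
    (hz : z ∈ Z) (hz' : z' ∈ Z) : ‖meanGrad g z - meanGrad g z'‖ ≤ L * ‖z - z'‖ := by
  refine le_of_sq_le_sq ?_ (by positivity)
  rw [meanGrad_sub, mul_pow]
  exact (norm_average_sq_le _).trans (hg z hz z' hz')

theorem AverageSmooth.norm_gradOp_sub_le [NeZero n] {g : Fin n → Pt E F → Pt E F}
    {Z : Set (Pt E F)} {L : ℝ} (hg : AverageSmooth g Z L) (hL : 0 ≤ L) {z z' : Pt E F}
    (hz : z ∈ Z) (hz' : z' ∈ Z) : ‖gradOp g z - gradOp g z'‖ ≤ L * ‖z - z'‖ := by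
  rw [gradOp, gradOp, ← signOp_sub, norm_signOp]
  exact hg.norm_meanGrad_sub_le hL hz hz'

/-- The added gradient difference `d` is the same for all components, so the cross term involves
only the averaged gradient, which is `L`-Lipschitz. Hence the bound is `(L + b)²`. -/
theorem AverageSmooth.prox [NeZero n] {g : Fin n → Pt E F → Pt E F} {Z : Set (Pt E F)}
    {L b : ℝ} (hg : AverageSmooth g Z L) (hL : 0 ≤ L) (hb : 0 ≤ b) (u : E) :
    AverageSmooth (proxGrad g b u) Z (L + b) := by
  intro z hz z' hz'
  have hn : (0 : ℝ) < n := by exact_mod_cast Nat.pos_of_ne_zero (NeZero.ne n)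
  set d : Pt E F := pt (b • (z.fst - z'.fst)) 0 with hd
  have e : ∀ i, proxGrad g b u i z - proxGrad g b u i z' = (g i z - g i z') + d := by
    intro i
    apply pt_ext
    · simp [proxGrad, hd, smul_sub]; abel
    · simp [proxGrad, hd]
  have hdn : ‖d‖ ≤ b * ‖z - z'‖ := by
    refine le_of_sq_le_sq ?_ (by positivity)
    rw [norm_pt_sq, mul_pow]
    have := norm_fst_sq_le (z - z')
    simp only [hd, WithLp.toLp_fst, WithLp.toLp_snd, norm_smul, mul_pow, norm_zero,
      Real.norm_eq_abs, sq_abs]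
    simp only [WithLp.sub_fst] at this
    nlinarith [mul_le_mul_of_nonneg_left this (sq_nonneg b)]
  have h1 := hg z hz z' hz'
  have h2 := hg.norm_meanGrad_sub_le hL hz hz'
  have h3 : inner ℝ (meanGrad g z - meanGrad g z') d ≤ (L * ‖z - z'‖) * (b * ‖z - z'‖) :=
    (real_inner_le_norm _ _).trans (by gcongr)
  have h4 : ‖d‖ ^ 2 ≤ (b * ‖z - z'‖) ^ 2 := by gcongr
  have e2 : (1 / (n : ℝ)) * ∑ i, ‖proxGrad g b u i z - proxGrad g b u i z'‖ ^ 2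
      = (1 / (n : ℝ)) * ∑ i, ‖g i z - g i z'‖ ^ 2
        + 2 * inner ℝ (meanGrad g z - meanGrad g z') d + ‖d‖ ^ 2 := by
    simp only [e, norm_add_sq_real, Finset.sum_add_distrib]
    rw [meanGrad_sub, real_inner_smul_left, sum_inner, ← Finset.mul_sum]
    simp only [Finset.sum_const, Finset.card_univ, Fintype.card_fin, nsmul_eq_mul]
    field_simp
  rw [e2]
  nlinarith

theorem AverageSmooth.swap {g : Fin n → Pt E F → Pt E F} {X : Set E} {Y : Set F}
    {L : ℝ} (hg : AverageSmooth g (feasible X Y) L) :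
    AverageSmooth (swapGrad g) (feasible Y X) L := by
  intro z hz z' hz'
  have h := hg (pt z.snd z.fst) ⟨hz.2, hz.1⟩ (pt z'.snd z'.fst) ⟨hz'.2, hz'.1⟩
  have e1 : ∀ i, ‖swapGrad g i z - swapGrad g i z'‖
      = ‖g i (pt z.snd z.fst) - g i (pt z'.snd z'.fst)‖ := by
    intro i
    rw [← sq_eq_sq₀ (norm_nonneg _) (norm_nonneg _), norm_pt_sq, norm_pt_sq]
    simp only [swapGrad, WithLp.sub_fst, WithLp.sub_snd, WithLp.toLp_fst, WithLp.toLp_snd,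
      neg_sub_neg]
    rw [norm_sub_rev, norm_sub_rev (g i (pt z'.snd z'.fst)).fst, add_comm]
  have e2 : ‖z - z'‖ ^ 2 = ‖(pt z.snd z.fst - pt z'.snd z'.fst : Pt E F)‖ ^ 2 := by
    rw [norm_pt_sq, norm_pt_sq]
    simp [add_comm]
  simpa only [e1, e2] using h

/-- The joint first-order inequality of an `(a, b)`-convex-concave function `h` with gradient
operator `G`. -/
def SaddleIneq (h : Pt E F → ℝ) (G : Pt E F → Pt E F) (X : Set E) (Y : Set F) (a b : ℝ) : Prop :=
  ∀ z ∈ feasible X Y, ∀ z' ∈ feasible X Y,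
    inner ℝ (G z) (z' - z) + a / 2 * ‖z'.fst - z.fst‖ ^ 2 + b / 2 * ‖z'.snd - z.snd‖ ^ 2
      ≤ h (pt z'.fst z.snd) - h (pt z.fst z'.snd)

theorem SaddleIneq.mono {h : Pt E F → ℝ} {G : Pt E F → Pt E F} {X : Set E} {Y : Set F}
    {a b a' b' : ℝ} (hs : SaddleIneq h G X Y a b) (ha : a' ≤ a) (hb : b' ≤ b) :
    SaddleIneq h G X Y a' b' := by
  intro z hz z' hz'
  have := hs z hz z' hz'
  have h1 : a' / 2 * ‖z'.fst - z.fst‖ ^ 2 ≤ a / 2 * ‖z'.fst - z.fst‖ ^ 2 := by gcongr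
  have h2 : b' / 2 * ‖z'.snd - z.snd‖ ^ 2 ≤ b / 2 * ‖z'.snd - z.snd‖ ^ 2 := by gcongr
  linarith

theorem SaddleIneq.monotone {h : Pt E F → ℝ} {G : Pt E F → Pt E F} {X : Set E} {Y : Set F}
    {a b : ℝ} (hs : SaddleIneq h G X Y a b) {z z' : Pt E F} (hz : z ∈ feasible X Y)
    (hz' : z' ∈ feasible X Y) :
    a * ‖z.fst - z'.fst‖ ^ 2 + b * ‖z.snd - z'.snd‖ ^ 2 ≤ inner ℝ (G z - G z') (z - z') := by
  have h1 := hs z hz z' hz'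
  have h2 := hs z' hz' z hz
  rw [norm_sub_rev z'.fst, norm_sub_rev z'.snd] at h1
  have e : inner ℝ (G z) (z' - z) = - inner ℝ (G z) (z - z') := by
    rw [← inner_neg_right, neg_sub]
  rw [inner_sub_left]
  linarith

theorem SaddleIneq.strongly_monotone {h : Pt E F → ℝ} {G : Pt E F → Pt E F} {X : Set E}
    {Y : Set F} {a b m : ℝ} (hs : SaddleIneq h G X Y a b) (ha : m ≤ a) (hb : m ≤ b)
    {z z' : Pt E F} (hz : z ∈ feasible X Y) (hz' : z' ∈ feasible X Y) :
    m * ‖z - z'‖ ^ 2 ≤ inner ℝ (G z - G z') (z - z') := by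
  refine le_trans ?_ ((hs.mono ha hb).monotone hz hz')
  rw [norm_pt_sq, mul_add]
  rfl

theorem meanGrad_proxGrad [NeZero n] (g : Fin n → Pt E F → Pt E F) (b : ℝ) (u : E)
    (z : Pt E F) : meanGrad (proxGrad g b u) z = meanGrad g z + pt (b • (z.fst - u)) 0 := by
  have hn : (n : ℝ) ≠ 0 := by exact_mod_cast NeZero.ne n
  simp only [meanGrad, proxGrad, Finset.sum_add_distrib, smul_add, Finset.sum_const,
    Finset.card_univ, Fintype.card_fin]
  rw [← Nat.cast_smul_eq_nsmul ℝ, smul_smul, one_div_mul_cancel hn, one_smul]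

theorem gradOp_proxGrad [NeZero n] (g : Fin n → Pt E F → Pt E F) (b : ℝ) (u : E)
    (z : Pt E F) : gradOp (proxGrad g b u) z = gradOp g z + pt (b • (z.fst - u)) 0 := by
  rw [gradOp, meanGrad_proxGrad, signOp_add, gradOp]
  congr 1
  simp [signOp]

theorem SaddleIneq.prox [NeZero n] {h : Pt E F → ℝ} {g : Fin n → Pt E F → Pt E F} {X : Set E}
    {Y : Set F} {a b : ℝ} (hs : SaddleIneq h (gradOp g) X Y a b) (β : ℝ) (u : E) :
    SaddleIneq (fun z => h z + β / 2 * ‖z.fst - u‖ ^ 2) (gradOp (proxGrad g β u)) X Y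
      (a + β) b := by
  intro z hz z' hz'
  have h1 := hs z hz z' hz'
  have e : ‖z'.fst - u‖ ^ 2 = ‖z'.fst - z.fst‖ ^ 2 + 2 * inner ℝ (z.fst - u) (z'.fst - z.fst)
      + ‖z.fst - u‖ ^ 2 := by
    rw [real_inner_comm, ← norm_add_sq_real, sub_add_sub_cancel]
  rw [gradOp_proxGrad, inner_add_left, inner_pt (pt (β • (z.fst - u)) 0)]
  simp only [WithLp.toLp_fst, WithLp.toLp_snd, inner_zero_left, real_inner_smul_left,
    WithLp.sub_fst, e]
  linarith

theorem SaddleIneq.swap {h : Pt E F → ℝ} {g : Fin n → Pt E F → Pt E F} {X : Set E}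
    {Y : Set F} {a b : ℝ} (hs : SaddleIneq h (gradOp g) X Y a b) :
    SaddleIneq (fun z => -h (pt z.snd z.fst)) (gradOp (swapGrad g)) Y X b a := by
  intro z hz z' hz'
  have h1 := hs (pt z.snd z.fst) ⟨hz.2, hz.1⟩ (pt z'.snd z'.fst) ⟨hz'.2, hz'.1⟩
  have e : gradOp (swapGrad g) z
      = pt (gradOp g (pt z.snd z.fst)).snd (gradOp g (pt z.snd z.fst)).fst := by
    apply pt_ext
    · simp [gradOp, signOp, meanGrad, swapGrad, fst_sum, snd_sum]
    · simp [gradOp, signOp, meanGrad, swapGrad, fst_sum, snd_sum]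
  rw [e, inner_pt]
  rw [inner_pt] at h1
  simp only [WithLp.toLp_fst, WithLp.toLp_snd, WithLp.sub_fst, WithLp.sub_snd] at h1 ⊢
  linarith

end Saddle

/-! ### Linear convergence of L-SVRE -/

/-- The first projection inequality is tested at the new iterate, the second at the solution.
Because the anchor is a convex combination of `z` and `w`, the squares appear with weights `1 - p`
and `p`. -/
theorem extragradient_ineq {H : Type} [NormedAddCommGroup H] [InnerProductSpace ℝ H]
    {z w zh zn zs G a : H} {p τ : ℝ}
    (h1 : inner ℝ (((1 - p) • z + p • w - τ • G) - zh) (zn - zh) ≤ 0)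
    (h2 : inner ℝ (((1 - p) • z + p • w - τ • (G + a)) - zn) (zs - zn) ≤ 0) :
    ‖zn - zs‖ ^ 2 ≤ (1 - p) * ‖z - zs‖ ^ 2 + p * ‖w - zs‖ ^ 2 - (1 - p) * ‖zh - z‖ ^ 2
      - p * ‖zh - w‖ ^ 2 - 2 * τ * inner ℝ (G + a) (zh - zs) + τ ^ 2 * ‖a‖ ^ 2 := by
  -- Young's inequality for the correction `a`: the cross term with `zh - zn` is paid for by the
  -- square `‖zh - zn‖²`, which cancels.
  have h3 := sq_nonneg ‖τ • a - (zh - zn)‖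
  simp only [← real_inner_self_eq_norm_sq, inner_sub_left, inner_sub_right, inner_add_left,
    inner_add_right, real_inner_smul_right, real_inner_comm] at *
  linarith

section

set_option linter.unusedSectionVars false

variable {E F : Type} [NormedAddCommGroup E] [InnerProductSpace ℝ E]
  [NormedAddCommGroup F] [InnerProductSpace ℝ F] {n : ℕ} [NeZero n]

/-- One iteration of L-SVRE. -/
noncomputable def lsvreStep (O : Oracle n E F) (X : Set E) (Y : Set F)
    (τ : ℝ) (p : unitInterval) (s : Pt E F × Pt E F × Pt E F) :
    Prog (Pt E F × Pt E F × Pt E F) := do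
  let zbar := (1 - (p : ℝ)) • s.1 + (p : ℝ) • s.2.1
  let zhalf := proj (feasible X Y) (zbar - τ • s.2.2)
  let i ← draw (PMF.uniformOfFintype (Fin n))
  let a ← O i zhalf
  let b ← O i s.2.1
  let znew := proj (feasible X Y) (zbar - τ • (s.2.2 + signOp a - signOp b))
  let refresh ← draw (coin p)
  if refresh then do
    let G ← fullGrad O znew
    pure (znew, znew, signOp G)
  else
    pure (znew, s.2.1, s.2.2)

theorem lsvreState_succ (O : Oracle n E F) (X : Set E) (Y : Set F) (z₀ : Pt E F)
    (τ : ℝ) (p : unitInterval) (k : ℕ) :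
    lsvreState O X Y z₀ τ p (k + 1) = lsvreState O X Y z₀ τ p k >>= lsvreStep O X Y τ p := rfl

/-- The extrapolated point of an iteration of L-SVRE. -/
noncomputable def lsvreHalf (X : Set E) (Y : Set F) (τ : ℝ) (p : unitInterval)
    (s : Pt E F × Pt E F × Pt E F) : Pt E F :=
  proj (feasible X Y) ((1 - (p : ℝ)) • s.1 + (p : ℝ) • s.2.1 - τ • s.2.2)

/-- The iterate that L-SVRE reaches if the index `i` is drawn. -/
noncomputable def lsvreNext (g : Fin n → Pt E F → Pt E F) (X : Set E) (Y : Set F)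
    (τ : ℝ) (p : unitInterval) (s : Pt E F × Pt E F × Pt E F) (i : Fin n) : Pt E F :=
  proj (feasible X Y) ((1 - (p : ℝ)) • s.1 + (p : ℝ) • s.2.1
    - τ • (s.2.2 + signOp (g i (lsvreHalf X Y τ p s)) - signOp (g i s.2.1)))

theorem wp_lsvreStep (g : Fin n → Pt E F → Pt E F) (X : Set E) (Y : Set F)
    (τ : ℝ) (p : unitInterval) (s : Pt E F × Pt E F × Pt E F) (c : ℕ)
    (φ : Pt E F × Pt E F × Pt E F → ℕ → ℝ≥0∞) :
    wp (lsvreStep (sfo g) X Y τ p s) c φ = ∑ i, (n : ℝ≥0∞)⁻¹ *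
      (ENNReal.ofReal p * φ (lsvreNext g X Y τ p s i, lsvreNext g X Y τ p s i,
          gradOp g (lsvreNext g X Y τ p s i)) (c + 1 + 1 + n)
        + ENNReal.ofReal (1 - p) * φ (lsvreNext g X Y τ p s i, s.2.1, s.2.2) (c + 1 + 1)) := by
  unfold lsvreStep
  simp only [wp_bind, wp_draw_uniform, wp_sfo, wp_draw_coin]
  simp only [if_true, Bool.false_eq_true, if_false, wp_bind, wp_fullGrad, wp_pure]
  rfl

theorem sum_inv_mul_const (a : ℝ≥0∞) : ∑ _i : Fin n, (n : ℝ≥0∞)⁻¹ * a = a := by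
  rw [Finset.sum_const, Finset.card_univ, Fintype.card_fin, nsmul_eq_mul, ← mul_assoc,
    ENNReal.mul_inv_cancel (by exact_mod_cast NeZero.ne n) (ENNReal.natCast_ne_top n), one_mul]

theorem ofReal_add_ofReal_one_sub (p : unitInterval) :
    ENNReal.ofReal p + ENNReal.ofReal (1 - p) = 1 := by
  rw [← ENNReal.ofReal_add p.2.1 (sub_nonneg.2 p.2.2)]
  simp

theorem costLE_lsvreStep (g : Fin n → Pt E F → Pt E F) (X : Set E) (Y : Set F)
    (τ : ℝ) (p : unitInterval) (s : Pt E F × Pt E F × Pt E F) :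
    CostLE (lsvreStep (sfo g) X Y τ p s) (2 + ENNReal.ofReal p * n) := fun c => by
  rw [wp_lsvreStep, sum_inv_mul_const]
  push_cast
  apply le_of_eq
  calc _ = (ENNReal.ofReal p + ENNReal.ofReal (1 - p)) * (c + 1 + 1)
        + ENNReal.ofReal p * n := by ring
    _ = _ := by rw [ofReal_add_ofReal_one_sub]; ring

theorem costLE_lsvreState (g : Fin n → Pt E F → Pt E F) (X : Set E) (Y : Set F)
    (z₀ : Pt E F) (τ : ℝ) (p : unitInterval) (T : ℕ) :
    CostLE (lsvreState (sfo g) X Y z₀ τ p T) (n + T * (2 + ENNReal.ofReal p * n)) := by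
  induction T with
  | zero =>
    unfold lsvreState
    exact ((costLE_fullGrad g z₀).bind fun a => costLE_pure _).mono (by simp)
  | succ k ih =>
    rw [lsvreState_succ]
    refine (ih.bind fun s => costLE_lsvreStep g X Y τ p s).mono (le_of_eq ?_)
    push_cast
    ring

theorem costLE_lsvre (g : Fin n → Pt E F → Pt E F) (X : Set E) (Y : Set F)
    (z₀ : Pt E F) (τ : ℝ) (p : unitInterval) (T : ℕ) :
    CostLE (lsvre (sfo g) X Y z₀ τ p T) (n + T * (2 + ENNReal.ofReal p * n)) :=
  ((costLE_lsvreState g X Y z₀ τ p T).bind fun _ => costLE_pure _).mono (by simp)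

/-- The squared distance to `zs` on the feasible set, infinite elsewhere. -/
noncomputable def feasDist (X : Set E) (Y : Set F) (zs z : Pt E F) : ℝ≥0∞ :=
  open Classical in if z ∈ feasible X Y then ENNReal.ofReal (‖z - zs‖ ^ 2) else ∞

/-- The Lyapunov function of L-SVRE, infinite on the states that violate its invariant. -/
noncomputable def lsvrePot (g : Fin n → Pt E F → Pt E F) (X : Set E) (Y : Set F)
    (p : unitInterval) (zs : Pt E F) (s : Pt E F × Pt E F × Pt E F) : ℝ≥0∞ :=
  open Classical in
  if s.1 ∈ feasible X Y ∧ s.2.1 ∈ feasible X Y ∧ s.2.2 = gradOp g s.2.1 then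
    ENNReal.ofReal ((1 - p) * ‖s.1 - zs‖ ^ 2 + ‖s.2.1 - zs‖ ^ 2) else ∞

variable [CompleteSpace E] [CompleteSpace F]

/-- The corrections average to `gradOp g zh - gradOp g w`, so the operator is evaluated at `zh` in
the mean, where strong monotonicity and the inequality at `zs` apply. Their second moment is at most
`L² ‖zh - w‖²`. -/
theorem mean_norm_lsvreNext_sub_sq_le {g : Fin n → Pt E F → Pt E F} {X : Set E} {Y : Set F}
    (hX : Convex ℝ X) (hY : Convex ℝ Y) (hXc : IsClosed X) (hYc : IsClosed Y) {L m : ℝ}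
    (hg : AverageSmooth g (feasible X Y) L)
    (hmono : ∀ z ∈ feasible X Y, ∀ z' ∈ feasible X Y,
      m * ‖z - z'‖ ^ 2 ≤ inner ℝ (gradOp g z - gradOp g z') (z - z'))
    {zs : Pt E F} (hzs : IsVISol (gradOp g) (feasible X Y) zs) {τ : ℝ} (hτ : 0 ≤ τ)
    {p : unitInterval} {z w : Pt E F} (hw : w ∈ feasible X Y) {zh : Pt E F}
    (hzh : zh = lsvreHalf X Y τ p (z, w, gradOp g w)) :
    (1 / (n : ℝ)) * ∑ i, ‖lsvreNext g X Y τ p (z, w, gradOp g w) i - zs‖ ^ 2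
      ≤ (1 - p) * ‖z - zs‖ ^ 2 + p * ‖w - zs‖ ^ 2 - (1 - p) * ‖zh - z‖ ^ 2
        - (p - τ ^ 2 * L ^ 2) * ‖zh - w‖ ^ 2 - 2 * τ * m * ‖zh - zs‖ ^ 2 := by
  have hn : (0 : ℝ) < n := by exact_mod_cast Nat.pos_of_ne_zero (NeZero.ne n)
  have hZ := feasible_convex hX hY
  have hZc := feasible_isClosed hXc hYc
  have hne : (feasible X Y).Nonempty := ⟨w, hw⟩
  have hhalf := proj_spec hZ hZc hne ((1 - (p : ℝ)) • z + (p : ℝ) • w - τ • gradOp g w)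
  have hzh' : proj (feasible X Y) ((1 - (p : ℝ)) • z + (p : ℝ) • w - τ • gradOp g w) = zh := by
    rw [hzh]; rfl
  rw [hzh'] at hhalf
  set a : Fin n → Pt E F := fun i => signOp (g i zh - g i w) with ha
  have key : ∀ i, ‖lsvreNext g X Y τ p (z, w, gradOp g w) i - zs‖ ^ 2
      ≤ ((1 - p) * ‖z - zs‖ ^ 2 + p * ‖w - zs‖ ^ 2 - (1 - p) * ‖zh - z‖ ^ 2
        - p * ‖zh - w‖ ^ 2 - 2 * τ * inner ℝ (gradOp g w) (zh - zs))
        + (- 2 * τ * inner ℝ (a i) (zh - zs) + τ ^ 2 * ‖g i zh - g i w‖ ^ 2) := by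
    intro i
    have hnext := proj_spec hZ hZc hne ((1 - (p : ℝ)) • z + (p : ℝ) • w
      - τ • (gradOp g w + a i))
    have e : lsvreNext g X Y τ p (z, w, gradOp g w) i = proj (feasible X Y)
        ((1 - (p : ℝ)) • z + (p : ℝ) • w - τ • (gradOp g w + a i)) := by
      simp only [lsvreNext, ← hzh, ha, signOp_sub, add_sub_assoc]
    rw [← e] at hnext
    have := extragradient_ineq (hhalf.2 _ hnext.1) (hnext.2 zs hzs.1)
    rw [inner_add_left, ha, norm_signOp] at this
    linarith
  have hsum := mul_le_mul_of_nonneg_left (Finset.sum_le_sum fun i (_ : i ∈ Finset.univ) => key i)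
    (by positivity : 0 ≤ 1 / (n : ℝ))
  refine hsum.trans ?_
  have e1 : (1 / (n : ℝ)) * ∑ i, inner ℝ (a i) (zh - zs)
      = inner ℝ (gradOp g zh - gradOp g w) (zh - zs) := by
    rw [← sum_inner, ← real_inner_smul_left, ha, ← signOp_average, ← meanGrad_sub, signOp_sub]
    rfl
  have e2 := hg zh hhalf.1 w hw
  have e3 := hmono zh hhalf.1 zs hzs.1
  have e4 := hzs.2 zh hhalf.1
  rw [Finset.sum_add_distrib, Finset.sum_add_distrib, ← Finset.mul_sum, ← Finset.mul_sum,
    Finset.sum_const, Finset.card_univ, Fintype.card_fin, nsmul_eq_mul]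
  rw [inner_sub_left] at e1 e3
  have e5 : τ ^ 2 * ((1 / (n : ℝ)) * ∑ i, ‖g i zh - g i w‖ ^ 2)
      ≤ τ ^ 2 * (L ^ 2 * ‖zh - w‖ ^ 2) := by gcongr
  have e6 : τ * (m * ‖zh - zs‖ ^ 2) ≤ τ * inner ℝ (gradOp g zh) (zh - zs) := by
    gcongr; linarith
  calc _ = ((1 - p) * ‖z - zs‖ ^ 2 + p * ‖w - zs‖ ^ 2 - (1 - p) * ‖zh - z‖ ^ 2
        - p * ‖zh - w‖ ^ 2 - 2 * τ * inner ℝ (gradOp g w) (zh - zs))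
        - 2 * τ * ((1 / (n : ℝ)) * ∑ i, inner ℝ (a i) (zh - zs))
        + τ ^ 2 * ((1 / (n : ℝ)) * ∑ i, ‖g i zh - g i w‖ ^ 2) := by
        field_simp
        ring
    _ ≤ _ := by rw [e1]; linarith

/-- After the coin is averaged out, the new potential is the mean of `‖zn - zs‖² + (1 - p) ‖w -
zs‖²`. The weights `1 - p` and `1` are chosen so that this, with the mean estimate, returns the old
potential minus squares that dominate its `ρ`-multiple. -/
theorem wp_lsvreStep_pot_le {g : Fin n → Pt E F → Pt E F} {X : Set E} {Y : Set F}
    (hX : Convex ℝ X) (hY : Convex ℝ Y) (hXc : IsClosed X) (hYc : IsClosed Y) {L m : ℝ}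
    (hg : AverageSmooth g (feasible X Y) L)
    (hmono : ∀ z ∈ feasible X Y, ∀ z' ∈ feasible X Y,
      m * ‖z - z'‖ ^ 2 ≤ inner ℝ (gradOp g z - gradOp g z') (z - z'))
    {zs : Pt E F} (hzs : IsVISol (gradOp g) (feasible X Y) zs) {τ ρ : ℝ} (hτ : 0 ≤ τ)
    {p : unitInterval} (hp : (p : ℝ) ≤ 1 / 2) (hτL : τ ^ 2 * L ^ 2 ≤ p / 8) (hρ0 : 0 ≤ ρ)
    (hρp : ρ ≤ p / 4) (hρm : ρ ≤ τ * m / 4) (s : Pt E F × Pt E F × Pt E F) (c : ℕ) :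
    wp (lsvreStep (sfo g) X Y τ p s) c (fun s' _ => lsvrePot g X Y p zs s')
      ≤ ENNReal.ofReal (1 - ρ) * lsvrePot g X Y p zs s := by
  have hn : (0 : ℝ) < n := by exact_mod_cast Nat.pos_of_ne_zero (NeZero.ne n)
  have hp0 : (0 : ℝ) ≤ p := p.2.1
  -- Where the invariant fails the right-hand side is `∞`, since `1 - ρ > 0`.
  by_cases hs : s.1 ∈ feasible X Y ∧ s.2.1 ∈ feasible X Y ∧ s.2.2 = gradOp g s.2.1
  swap
  · rw [lsvrePot, if_neg hs, ENNReal.mul_top]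
    · exact le_top
    · simp only [ne_eq, ENNReal.ofReal_eq_zero, not_le]
      linarith
  obtain ⟨z, w, gw⟩ := s
  obtain ⟨hz, hw, hgw⟩ := hs
  simp only at hz hw hgw
  subst hgw
  set zn := lsvreNext g X Y τ p (z, w, gradOp g w) with hzn
  have hznm : ∀ i, zn i ∈ feasible X Y := fun i =>
    (proj_spec (feasible_convex hX hY) (feasible_isClosed hXc hYc) ⟨w, hw⟩ _).1
  have hmean := mean_norm_lsvreNext_sub_sq_le hX hY hXc hYc hg hmono hzs hτ (p := p) (z := z) hw
    rfl
  set zh := lsvreHalf X Y τ p (z, w, gradOp g w) with hzh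
  rw [wp_lsvreStep, ← hzn]
  have e1 : ∀ i, lsvrePot g X Y p zs (zn i, zn i, gradOp g (zn i))
      = ENNReal.ofReal ((1 - p) * ‖zn i - zs‖ ^ 2 + ‖zn i - zs‖ ^ 2) := fun i =>
    if_pos ⟨hznm i, hznm i, rfl⟩
  have e2 : ∀ i, lsvrePot g X Y p zs (zn i, w, gradOp g w)
      = ENNReal.ofReal ((1 - p) * ‖zn i - zs‖ ^ 2 + ‖w - zs‖ ^ 2) := fun i =>
    if_pos ⟨hznm i, hw, rfl⟩
  have e3 : lsvrePot g X Y p zs (z, w, gradOp g w)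
      = ENNReal.ofReal ((1 - p) * ‖z - zs‖ ^ 2 + ‖w - zs‖ ^ 2) := if_pos ⟨hz, hw, rfl⟩
  have h1p : 0 ≤ 1 - (p : ℝ) := by linarith
  have e4 : ∀ i, (n : ℝ≥0∞)⁻¹ * (ENNReal.ofReal p *
      ENNReal.ofReal ((1 - p) * ‖zn i - zs‖ ^ 2 + ‖zn i - zs‖ ^ 2)
      + ENNReal.ofReal (1 - p) * ENNReal.ofReal ((1 - p) * ‖zn i - zs‖ ^ 2 + ‖w - zs‖ ^ 2))
      = ENNReal.ofReal ((1 / (n : ℝ)) * (‖zn i - zs‖ ^ 2 + (1 - p) * ‖w - zs‖ ^ 2)) := by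
    intro i
    rw [← ENNReal.ofReal_mul hp0, ← ENNReal.ofReal_mul h1p,
      ← ENNReal.ofReal_add (by positivity) (by positivity), one_div,
      ENNReal.ofReal_mul (by positivity), ENNReal.ofReal_inv_of_pos hn, ENNReal.ofReal_natCast]
    congr 2
    ring
  simp only [e1, e2, e4]
  rw [e3, ← ENNReal.ofReal_sum_of_nonneg (fun i _ => by positivity),
    ← ENNReal.ofReal_mul (by linarith)]
  apply ENNReal.ofReal_le_ofReal
  rw [← Finset.mul_sum, Finset.sum_add_distrib, mul_add, Finset.sum_const, Finset.card_univ,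
    Fintype.card_fin, nsmul_eq_mul]
  have e5 : 1 / (n : ℝ) * (n * ((1 - p) * ‖w - zs‖ ^ 2)) = (1 - p) * ‖w - zs‖ ^ 2 := by
    field_simp
  -- The distances of `z` and `w` to the solution are routed through `zh`, because the negative
  -- terms are distances from `zh`.
  have t1 : ‖z - zs‖ ^ 2 ≤ 2 * ‖zh - z‖ ^ 2 + 2 * ‖zh - zs‖ ^ 2 := by
    have := parallelogram_law_with_norm ℝ (zh - zs) (zh - z)
    rw [sub_sub_sub_cancel_left] at this
    nlinarith [norm_nonneg (zh - zs + (zh - z))]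
  have t2 : ‖w - zs‖ ^ 2 ≤ 2 * ‖zh - w‖ ^ 2 + 2 * ‖zh - zs‖ ^ 2 := by
    have := parallelogram_law_with_norm ℝ (zh - zs) (zh - w)
    rw [sub_sub_sub_cancel_left] at this
    nlinarith [norm_nonneg (zh - zs + (zh - w))]
  rw [e5]
  have t3 : ρ * ((1 - p) * ‖z - zs‖ ^ 2) ≤ ρ * ((1 - p) * (2 * ‖zh - z‖ ^ 2 + 2 * ‖zh - zs‖ ^ 2)) := by
    gcongr
  have t4 : ρ * ‖w - zs‖ ^ 2 ≤ ρ * (2 * ‖zh - w‖ ^ 2 + 2 * ‖zh - zs‖ ^ 2) := by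
    gcongr
  have t5 : τ ^ 2 * L ^ 2 * ‖zh - w‖ ^ 2 ≤ p / 8 * ‖zh - w‖ ^ 2 := by gcongr
  have t6 : ρ * ‖zh - w‖ ^ 2 ≤ p / 4 * ‖zh - w‖ ^ 2 := by gcongr
  have t7 : ρ * ‖zh - zs‖ ^ 2 ≤ τ * m / 4 * ‖zh - zs‖ ^ 2 := by gcongr
  have t8 : 0 ≤ (1 - p) * ‖zh - z‖ ^ 2 := by positivity
  have t9 : ρ * ((1 - p) * ‖zh - z‖ ^ 2) ≤ 1 / 2 * ((1 - p) * ‖zh - z‖ ^ 2) := by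
    gcongr; linarith
  have t10 : 0 ≤ ρ * (p * ‖zh - zs‖ ^ 2) := by positivity
  have t11 : 0 ≤ p * ‖zh - w‖ ^ 2 := by positivity
  have t12 : 0 ≤ ρ * ‖zh - zs‖ ^ 2 := by positivity
  linarith

/-- The factor `4` is `2 · 2`: the initial potential is at most twice the squared distance, and `1 -
p ≥ 1 / 2` bounds the final squared distance by twice the potential. -/
theorem wp_lsvre_feasDist_le {g : Fin n → Pt E F → Pt E F} {X : Set E} {Y : Set F}
    (hX : Convex ℝ X) (hY : Convex ℝ Y) (hXc : IsClosed X) (hYc : IsClosed Y) {L m : ℝ}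
    (hg : AverageSmooth g (feasible X Y) L)
    (hmono : ∀ z ∈ feasible X Y, ∀ z' ∈ feasible X Y,
      m * ‖z - z'‖ ^ 2 ≤ inner ℝ (gradOp g z - gradOp g z') (z - z'))
    {zs : Pt E F} (hzs : IsVISol (gradOp g) (feasible X Y) zs) {τ ρ : ℝ} (hτ : 0 ≤ τ)
    {p : unitInterval} (hp : (p : ℝ) ≤ 1 / 2) (hτL : τ ^ 2 * L ^ 2 ≤ p / 8) (hρ0 : 0 ≤ ρ)
    (hρp : ρ ≤ p / 4) (hρm : ρ ≤ τ * m / 4) {z₀ : Pt E F} (hz₀ : z₀ ∈ feasible X Y)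
    (T c : ℕ) :
    wp (lsvre (sfo g) X Y z₀ τ p T) c (fun z _ => feasDist X Y zs z)
      ≤ ENNReal.ofReal (4 * (1 - ρ) ^ T * ‖z₀ - zs‖ ^ 2) := by
  have hp0 : (0 : ℝ) ≤ p := p.2.1
  have hρ1 : 0 ≤ 1 - ρ := by linarith
  have h1p : 0 ≤ 1 - (p : ℝ) := by linarith
  have hstate : ∀ T, wp (lsvreState (sfo g) X Y z₀ τ p T) c (fun s _ => lsvrePot g X Y p zs s)
      ≤ ENNReal.ofReal (2 * (1 - ρ) ^ T * ‖z₀ - zs‖ ^ 2) := by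
    intro T
    induction T with
    | zero =>
      unfold lsvreState
      rw [wp_bind, wp_fullGrad, wp_pure, lsvrePot, if_pos ⟨hz₀, hz₀, rfl⟩]
      apply ENNReal.ofReal_le_ofReal
      nlinarith [mul_nonneg hp0 (sq_nonneg ‖z₀ - zs‖)]
    | succ k ih =>
      rw [lsvreState_succ, wp_bind]
      calc _ ≤ wp (lsvreState (sfo g) X Y z₀ τ p k) c
            (fun s _ => ENNReal.ofReal (1 - ρ) * lsvrePot g X Y p zs s) :=
            wp_mono _ _ fun s c' => wp_lsvreStep_pot_le hX hY hXc hYc hg hmono hzs hτ hp hτL hρ0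
              hρp hρm s c'
        _ ≤ ENNReal.ofReal (1 - ρ) * ENNReal.ofReal (2 * (1 - ρ) ^ k * ‖z₀ - zs‖ ^ 2) := by
            rw [wp_const_mul]; gcongr
        _ = _ := by
            rw [← ENNReal.ofReal_mul hρ1]
            congr 1
            ring
  unfold lsvre
  rw [wp_bind]
  simp only [wp_pure]
  calc _ ≤ wp (lsvreState (sfo g) X Y z₀ τ p T) c
        (fun s _ => ENNReal.ofReal 2 * lsvrePot g X Y p zs s) := by
        refine wp_mono _ _ fun s c' => ?_
        rw [lsvrePot]
        split_ifs with hs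
        · rw [feasDist, if_pos hs.1, ← ENNReal.ofReal_mul (by norm_num)]
          apply ENNReal.ofReal_le_ofReal
          nlinarith [sq_nonneg ‖s.1 - zs‖, sq_nonneg ‖s.2.1 - zs‖]
        · rw [ENNReal.mul_top (by simp)]
          exact le_top
    _ ≤ ENNReal.ofReal 2 * ENNReal.ofReal (2 * (1 - ρ) ^ T * ‖z₀ - zs‖ ^ 2) := by
        rw [wp_const_mul]; gcongr; exact hstate T
    _ = _ := by
        rw [← ENNReal.ofReal_mul (by norm_num)]
        congr 1
        ring

end

/-! ### One outer iteration of AL-SVRE -/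

section

set_option linter.unusedSectionVars false

variable {E F : Type} [NormedAddCommGroup E] [InnerProductSpace ℝ E]
  [NormedAddCommGroup F] [InnerProductSpace ℝ F]

/-- The primal function `max_{y ∈ Y} h(x, y)`. -/
noncomputable def primal (h : Pt E F → ℝ) (Y : Set F) (x : E) : ℝ :=
  sSup ((fun y => h (pt x y)) '' Y)

theorem neg_sq_div_le_inner {H : Type} [NormedAddCommGroup H] [InnerProductSpace ℝ H] {s : ℝ}
    (hs : 0 < s) (r v : H) : -(‖r‖ ^ 2 / (2 * s)) ≤ inner ℝ r v + s / 2 * ‖v‖ ^ 2 := by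
  have h := sq_nonneg ‖r + s • v‖
  rw [norm_add_sq_real, real_inner_smul_right, norm_smul, mul_pow, Real.norm_eq_abs, sq_abs] at h
  rw [neg_le_iff_add_nonneg]
  have e : inner ℝ r v + s / 2 * ‖v‖ ^ 2 + ‖r‖ ^ 2 / (2 * s)
      = (‖r‖ ^ 2 + 2 * (s * inner ℝ r v) + s ^ 2 * ‖v‖ ^ 2) / (2 * s) := by
    field_simp
    ring
  rw [e]
  positivity

variable {h : Pt E F → ℝ} {G : Pt E F → Pt E F} {X : Set E} {Y : Set F} {μ ν : ℝ}

/-- A residual of the variational inequality at `z` bounds the duality gap at `z`. -/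
theorem SaddleIneq.gap_le (hs : SaddleIneq h G X Y μ μ) (hμ : 0 < μ) {z r : Pt E F}
    (hz : z ∈ feasible X Y) (hr : ∀ z' ∈ feasible X Y, inner ℝ r (z' - z) ≤ inner ℝ (G z) (z' - z))
    {z' : Pt E F} (hz' : z' ∈ feasible X Y) :
    h (pt z.fst z'.snd) - h (pt z'.fst z.snd) ≤ ‖r‖ ^ 2 / (2 * μ) := by
  have h1 := hs z hz z' hz'
  have h2 := hr z' hz'
  have h3 := neg_sq_div_le_inner hμ r (z' - z)
  rw [norm_pt_sq (z' - z)] at h3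
  simp only [WithLp.sub_fst, WithLp.sub_snd] at h3
  linarith

/-- `Y` may be unbounded; strong concavity puts a downward quadratic above `h(x, ·)`. Thus the
`sSup` in `primal` is not a default value. -/
theorem SaddleIneq.bddAbove (hs : SaddleIneq h G X Y μ ν) (hν : 0 < ν) {x : E} (hx : x ∈ X) :
    BddAbove ((fun y => h (pt x y)) '' Y) := by
  rcases Y.eq_empty_or_nonempty with rfl | ⟨y₀, hy₀⟩
  · simp
  refine ⟨h (pt x y₀) + ‖(G (pt x y₀)).snd‖ ^ 2 / (2 * ν), ?_⟩
  rintro _ ⟨y, hy, rfl⟩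
  have h1 := hs (pt x y₀) ⟨hx, hy₀⟩ (pt x y) ⟨hx, hy⟩
  have h2 := neg_sq_div_le_inner hν (G (pt x y₀)).snd (y - y₀)
  rw [inner_pt] at h1
  simp only [WithLp.toLp_fst, WithLp.toLp_snd, WithLp.sub_fst, WithLp.sub_snd, sub_self,
    inner_zero_right, norm_zero] at h1 ⊢
  linarith

theorem SaddleIneq.le_primal (hs : SaddleIneq h G X Y μ ν) (hν : 0 < ν) {x : E} (hx : x ∈ X)
    {y : F} (hy : y ∈ Y) : h (pt x y) ≤ primal h Y x :=
  le_csSup (hs.bddAbove hν hx) ⟨y, hy, rfl⟩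

theorem primal_le (hY : Y.Nonempty) {x : E} {B : ℝ} (hB : ∀ y ∈ Y, h (pt x y) ≤ B) :
    primal h Y x ≤ B := by
  refine csSup_le (hY.image _) ?_
  rintro _ ⟨y, hy, rfl⟩
  exact hB y hy

variable {zs : Pt E F}

theorem SaddleIneq.saddle (hs : SaddleIneq h G X Y μ ν) (hzs : IsVISol G (feasible X Y) zs)
    {x : E} {y : F} (hx : x ∈ X) (hy : y ∈ Y) :
    μ / 2 * ‖x - zs.fst‖ ^ 2 + ν / 2 * ‖y - zs.snd‖ ^ 2
      ≤ h (pt x zs.snd) - h (pt zs.fst y) := by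
  have h1 := hs zs hzs.1 (pt x y) ⟨hx, hy⟩
  have h2 := hzs.2 (pt x y) ⟨hx, hy⟩
  simp only [WithLp.toLp_fst, WithLp.toLp_snd] at h1
  linarith

theorem SaddleIneq.primal_sub_ge (hs : SaddleIneq h G X Y μ ν) (hν : 0 < ν)
    (hzs : IsVISol G (feasible X Y) zs) {x : E} (hx : x ∈ X) :
    μ / 2 * ‖x - zs.fst‖ ^ 2 ≤ primal h Y x - h zs := by
  have h1 := hs.saddle hzs hx hzs.1.2
  have h2 := hs.le_primal hν hx hzs.1.2
  rw [sub_self, norm_zero] at h1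
  have e : h (pt zs.fst zs.snd) = h zs := rfl
  linarith

theorem SaddleIneq.saddle_max (hs : SaddleIneq h G X Y μ ν) (hν : 0 < ν)
    (hzs : IsVISol G (feasible X Y) zs) {y : F} (hy : y ∈ Y) : h (pt zs.fst y) ≤ h zs := by
  have h1 := hs.saddle hzs hzs.1.1 hy
  rw [sub_self, norm_zero] at h1
  have e : h (pt zs.fst zs.snd) = h zs := rfl
  nlinarith [sq_nonneg ‖y - zs.snd‖]

/-- The first-order inequalities at the intermediate point, towards both ends, are combined with
weights `1 - t` and `t`; the gradient terms cancel. -/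
theorem SaddleIneq.strongly_convex_left (hs : SaddleIneq h G X Y μ ν) (hX : Convex ℝ X)
    {x x' : E} {y : F} (hx : x ∈ X) (hx' : x' ∈ X) (hy : y ∈ Y) {t : ℝ} (ht0 : 0 ≤ t)
    (ht1 : t ≤ 1) :
    h (pt ((1 - t) • x + t • x') y) ≤ (1 - t) * h (pt x y) + t * h (pt x' y)
      - μ / 2 * (t * (1 - t)) * ‖x - x'‖ ^ 2 := by
  set xc := (1 - t) • x + t • x' with hxc
  have hxcm : xc ∈ X := hX hx hx' (sub_nonneg.2 ht1) ht0 (by ring)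
  have h1 := hs (pt xc y) ⟨hxcm, hy⟩ (pt x y) ⟨hx, hy⟩
  have h2 := hs (pt xc y) ⟨hxcm, hy⟩ (pt x' y) ⟨hx', hy⟩
  rw [inner_pt] at h1 h2
  have e1 : x - xc = t • (x - x') := by rw [hxc]; module
  have e2 : x' - xc = (-(1 - t)) • (x - x') := by rw [hxc]; module
  simp only [WithLp.toLp_fst, WithLp.toLp_snd, WithLp.sub_fst, WithLp.sub_snd, sub_self,
    inner_zero_right, norm_zero, e1, e2, real_inner_smul_right, norm_smul, mul_pow,
    Real.norm_eq_abs, sq_abs] at h1 h2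
  have h3 := mul_le_mul_of_nonneg_left h1 (sub_nonneg.2 ht1)
  have h4 := mul_le_mul_of_nonneg_left h2 ht0
  linarith

/-- The sequence of estimates that belongs to the extrapolation with parameter `Q`. -/
noncomputable def accPoint (Q : ℝ) (x u : E) : E := Q⁻¹ • ((1 + Q) • u - x)

theorem smul_accPoint {Q : ℝ} (hQ : 0 < Q) (x u : E) :
    Q • accPoint Q x u = (1 + Q) • u - x := by
  rw [accPoint, smul_inv_smul₀ hQ.ne']

/-- Equivalently `x' = (1 - Q) x + Q v'` for the new estimate `v'`: the momentum coefficient is made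
for this relation. -/
theorem smul_accPoint_extrapolate {Q : ℝ} (hQ : 0 < Q) (x x' : E) :
    Q • accPoint Q x' (x' + ((1 - Q) / (1 + Q)) • (x' - x)) = x' - (1 - Q) • x := by
  have h1 : (1 + Q) * ((1 - Q) / (1 + Q)) = 1 - Q := by field_simp
  rw [smul_accPoint hQ, smul_add, smul_smul, h1]
  module

theorem accPoint_self {Q : ℝ} (hQ : 0 < Q) (x : E) : accPoint Q x x = x := by
  have : Q • accPoint Q x x = Q • x := by rw [smul_accPoint hQ]; module
  exact smul_right_injective _ hQ.ne' this

/-- `u` is the convex combination `(x + Q v) / (1 + Q)` of the iterate and the estimate `v`. -/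
theorem extrapolated_dist_le {Q : ℝ} (hQ : 0 < Q) (x u s : E) :
    ‖u - s‖ ^ 2 ≤ ‖x - s‖ ^ 2 + ‖accPoint Q x u - s‖ ^ 2 := by
  set b := accPoint Q x u - s with hb
  have e : (1 + Q) • (u - s) = (x - s) + Q • b := by
    rw [hb, smul_sub Q, smul_accPoint hQ]; module
  have e2 : (1 + Q) ^ 2 * ‖u - s‖ ^ 2 = ‖(x - s) + Q • b‖ ^ 2 := by
    rw [← e, norm_smul, mul_pow, Real.norm_eq_abs, sq_abs]
  have h3 := sq_nonneg ‖(x - s) - b‖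
  rw [norm_add_sq_real, real_inner_smul_right, norm_smul, mul_pow, Real.norm_eq_abs, sq_abs] at e2
  rw [norm_sub_sq_real] at h3
  have h4 : (1 + Q) ^ 2 * ‖u - s‖ ^ 2 ≤ (1 + Q) ^ 2 * (‖x - s‖ ^ 2 + ‖b‖ ^ 2) := by
    nlinarith [sq_nonneg ‖x - s‖, sq_nonneg ‖b‖, mul_nonneg hQ.le h3,
      mul_nonneg hQ.le (sq_nonneg ‖x - s‖), mul_nonneg hQ.le (sq_nonneg ‖b‖),
      mul_nonneg (sq_nonneg Q) (sq_nonneg ‖x - s‖)]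
  exact le_of_mul_le_mul_left h4 (by positivity)

/-- With `v` the estimate, `(1 + Q) d = -Q (Q (x - s) + (v - s))`. Jensen's inequality with weights
`Q` and `1`, and `β Q² = μ (1 - Q²)`, produce a multiple of `‖x - s‖²` that is exactly the gain from
strong convexity. -/
theorem extrapolation_identity_le {Q β : ℝ} (hQ : 0 < Q) (hQ1 : Q ≤ 1) (hμ : 0 < μ)
    (hβ : Q ^ 2 * (μ + β) = μ) (x u s : E) :
    β / 2 * ‖((1 - Q) • x + Q • s) - u‖ ^ 2 - μ / 2 * (Q * (1 - Q)) * ‖x - s‖ ^ 2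
      ≤ (1 - Q) * (μ / 2 * ‖accPoint Q x u - s‖ ^ 2) := by
  set b := accPoint Q x u - s with hb
  set d := ((1 - Q) • x + Q • s) - u with hd
  have e : (1 + Q) • d = (-Q) • (Q • (x - s) + b) := by
    rw [neg_smul, smul_add Q, hb, smul_sub Q (accPoint Q x u), smul_accPoint hQ, hd]
    module
  have e2 : (1 + Q) ^ 2 * ‖d‖ ^ 2 = Q ^ 2 * ‖Q • (x - s) + b‖ ^ 2 := by
    have := congrArg (fun v => ‖v‖ ^ 2) e
    simpa only [norm_smul, mul_pow, Real.norm_eq_abs, sq_abs, neg_sq] using this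
  have h3 := sq_nonneg ‖(x - s) - b‖
  rw [norm_sub_sq_real] at h3
  have h4 : ‖Q • (x - s) + b‖ ^ 2 ≤ (1 + Q) * (Q * ‖x - s‖ ^ 2 + ‖b‖ ^ 2) := by
    rw [norm_add_sq_real, real_inner_smul_left, norm_smul, mul_pow, Real.norm_eq_abs, sq_abs]
    nlinarith [mul_nonneg hQ.le h3]
  have hβ' : β * Q ^ 2 = μ * (1 - Q) * (1 + Q) := by linarith
  have h5 : (1 + Q) ^ 2 * (β * ‖d‖ ^ 2)
      ≤ (1 + Q) ^ 2 * (μ * (1 - Q) * (Q * ‖x - s‖ ^ 2 + ‖b‖ ^ 2)) := by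
    calc _ = β * Q ^ 2 * ‖Q • (x - s) + b‖ ^ 2 := by rw [mul_left_comm, e2]; ring
      _ = μ * (1 - Q) * (1 + Q) * ‖Q • (x - s) + b‖ ^ 2 := by rw [hβ']
      _ ≤ μ * (1 - Q) * (1 + Q) * ((1 + Q) * (Q * ‖x - s‖ ^ 2 + ‖b‖ ^ 2)) := by
          have : 0 ≤ 1 - Q := by linarith
          gcongr
      _ = _ := by ring
  have h6 := le_of_mul_le_mul_left h5 (by positivity)
  linarith

/-- The potential of the accelerated proximal point method. -/
noncomputable def accPot (h : Pt E F → ℝ) (Y : Set F) (μ Q : ℝ) (zs : Pt E F) (x u : E) : ℝ :=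
  primal h Y x - h zs + μ / 2 * ‖accPoint Q x u - zs.fst‖ ^ 2

/-- Decrease of the potential in an inexact accelerated proximal point step, where the inexactness
is measured by a residual `r` of the variational inequality. -/
theorem SaddleIneq.accPot_le (hs : SaddleIneq h G X Y μ ν) (hX : Convex ℝ X) (hμ : 0 < μ)
    (hμν : μ ≤ ν) (hzs : IsVISol G (feasible X Y) zs) {Q β : ℝ} (hQ : 0 < Q) (hQ1 : Q ≤ 1)
    (hβ : Q ^ 2 * (μ + β) = μ) {x u : E} (hx : x ∈ X) {z' r : Pt E F} (hz' : z' ∈ feasible X Y)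
    (hr : ∀ z ∈ feasible X Y,
      inner ℝ r (z - z') ≤ inner ℝ (G z' + pt (β • (z'.fst - u)) 0) (z - z')) :
    accPot h Y μ Q zs z'.fst (z'.fst + ((1 - Q) / (1 + Q)) • (z'.fst - x))
      ≤ (1 - Q / 2) * accPot h Y μ Q zs x u + 2 * ‖r‖ ^ 2 / μ := by
  have hν : 0 < ν := hμ.trans_le hμν
  set s := zs.fst with hsdef
  -- Nesterov's comparison point: its difference from the new iterate is `Q` times the error of the
  -- new estimate.
  set xc := (1 - Q) • x + Q • s with hxc
  have hxcm : xc ∈ X := hX hx hzs.1.1 (sub_nonneg.2 hQ1) hQ.le (by ring)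
  set v' := accPoint Q z'.fst (z'.fst + ((1 - Q) / (1 + Q)) • (z'.fst - x)) with hv'
  have hdist : ‖xc - z'.fst‖ ^ 2 = Q ^ 2 * ‖v' - s‖ ^ 2 := by
    have : xc - z'.fst = (-Q) • (v' - s) := by
      rw [smul_sub, neg_smul Q v', hv', smul_accPoint_extrapolate hQ, hxc]
      module
    rw [this, norm_smul, mul_pow, Real.norm_eq_abs, sq_abs, neg_sq]
  have hη : 0 < μ / Q ^ 2 := by positivity
  have hβη : β = μ / Q ^ 2 - μ := by
    field_simp
    linarith
  -- The modulus in `x` of the subproblem is `μ + β = μ / Q²`. A fraction `Q / 2` of it absorbs the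
  -- residual; as `2 σ = μ / Q ≥ μ`, this costs no more than `‖r‖² / μ`.
  set σ := Q * (μ / Q ^ 2) / 2 with hσ
  have hσ0 : 0 < σ := by positivity
  have hσμ : μ ≤ 2 * σ := by
    have : 2 * σ = μ / Q := by rw [hσ]; field_simp
    rw [this, le_div_iff₀ hQ]
    nlinarith
  -- The residual inequality is tested at `(xc, y)` with `y` arbitrary, so that one inequality gives
  -- the maximum over `y` at the new iterate.
  have hprimal : primal h Y z'.fst ≤ h (pt xc z'.snd) + β / 2 * ‖xc - u‖ ^ 2
      + ‖r‖ ^ 2 / μ - (μ / Q ^ 2 - σ) / 2 * ‖xc - z'.fst‖ ^ 2 := by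
    refine primal_le ⟨_, hz'.2⟩ fun y hy => ?_
    have h1 := hs z' hz' (pt xc y) ⟨hxcm, hy⟩
    have h2 := hr (pt xc y) ⟨hxcm, hy⟩
    have h3 := neg_sq_div_le_inner hσ0 r.fst (xc - z'.fst)
    have h4 := neg_sq_div_le_inner hν r.snd (y - z'.snd)
    have e : ‖xc - u‖ ^ 2 = ‖xc - z'.fst‖ ^ 2 + 2 * inner ℝ (z'.fst - u) (xc - z'.fst)
        + ‖z'.fst - u‖ ^ 2 := by
      rw [real_inner_comm, ← norm_add_sq_real, sub_add_sub_cancel]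
    rw [inner_add_left, inner_pt (pt (β • (z'.fst - u)) 0), inner_pt r] at h2
    simp only [WithLp.toLp_fst, WithLp.toLp_snd, WithLp.sub_fst, WithLp.sub_snd,
      inner_zero_left, real_inner_smul_left] at h1 h2
    have h5 : ‖r.fst‖ ^ 2 / (2 * σ) ≤ ‖r.fst‖ ^ 2 / μ := by gcongr
    have h6 : ‖r.snd‖ ^ 2 / (2 * ν) ≤ ‖r.snd‖ ^ 2 / μ := by
      gcongr
      linarith
    have h7 : ‖r‖ ^ 2 / μ = ‖r.fst‖ ^ 2 / μ + ‖r.snd‖ ^ 2 / μ := by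
      rw [norm_pt_sq, add_div]
    have h8 : 0 ≤ β := by
      rw [hβη, sub_nonneg, le_div_iff₀ (by positivity)]
      exact mul_le_of_le_one_right hμ.le (pow_le_one₀ hQ.le hQ1)
    have h9 : 0 ≤ β / 2 * ‖z'.fst - u‖ ^ 2 := by positivity
    rw [h7, e]
    rw [hβη] at h2 h9 ⊢
    linarith
  have hconv := hs.strongly_convex_left hX hx hzs.1.1 hz'.2 hQ.le hQ1
  have h1 := hs.le_primal hν hx hz'.2
  have h2 := hs.saddle_max hν hzs hz'.2
  have h3 := extrapolation_identity_le hQ hQ1 hμ hβ x u s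
  have h4 : (μ / Q ^ 2 - σ) / 2 * ‖xc - z'.fst‖ ^ 2 = (1 - Q / 2) * (μ / 2 * ‖v' - s‖ ^ 2) := by
    rw [hdist, hσ]
    field_simp
  have h5 : 0 ≤ primal h Y z'.fst - h zs :=
    le_trans (by positivity) (hs.primal_sub_ge hν hzs hz'.1)
  have h5' : 0 ≤ primal h Y x - h zs :=
    le_trans (by positivity) (hs.primal_sub_ge hν hzs hx)
  have h6 : (1 - Q) * h (pt x z'.snd) ≤ (1 - Q) * primal h Y x :=
    mul_le_mul_of_nonneg_left h1 (by linarith)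
  have h7 : Q * h (pt s z'.snd) ≤ Q * h zs := mul_le_mul_of_nonneg_left h2 hQ.le
  have h8 : (1 - Q / 2) * accPot h Y μ Q zs z'.fst
      (z'.fst + ((1 - Q) / (1 + Q)) • (z'.fst - x))
      ≤ (1 - Q) * accPot h Y μ Q zs x u + ‖r‖ ^ 2 / μ := by
    unfold accPot
    rw [← hv', ← hsdef]
    have : 0 ≤ Q / 2 * (primal h Y z'.fst - h zs) := by positivity
    linarith
  have hA : 0 ≤ accPot h Y μ Q zs x u := by
    unfold accPot; positivity
  have hr0 : 0 ≤ ‖r‖ ^ 2 / μ := by positivity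
  -- The factor `1 - Q / 2` is divided out, by `1 - Q ≤ (1 - Q / 2)²` and `1 ≤ 2 (1 - Q / 2)`; hence
  -- the `2` before the residual.
  have h9 : (1 - Q / 2) * accPot h Y μ Q zs z'.fst
      (z'.fst + ((1 - Q) / (1 + Q)) • (z'.fst - x))
      ≤ (1 - Q / 2) * ((1 - Q / 2) * accPot h Y μ Q zs x u + 2 * ‖r‖ ^ 2 / μ) := by
    refine h8.trans ?_
    rw [mul_div_assoc]
    nlinarith [mul_nonneg (sq_nonneg Q) hA, mul_nonneg (sub_nonneg.2 hQ1) hr0]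
  exact le_of_mul_le_mul_left h9 (by linarith)

/-- A projected gradient step turns a point that is close to the solution into a point at which
the variational inequality has a small residual. -/
theorem exists_residual [CompleteSpace E] [CompleteSpace F] (hX : Convex ℝ X) (hY : Convex ℝ Y)
    (hXc : IsClosed X) (hYc : IsClosed Y)
    {l τ : ℝ} (hl : 0 ≤ l) (hτ : 0 < τ) (hτl : τ * l ≤ 1 / 4)
    (hG : ∀ z ∈ feasible X Y, ∀ z' ∈ feasible X Y, ‖G z - G z'‖ ≤ l * ‖z - z'‖)
    (hzs : IsVISol G (feasible X Y) zs) {zt z' : Pt E F} (hzt : zt ∈ feasible X Y)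
    (hx' : z'.fst = proj X (zt.fst - τ • (G zt).fst))
    (hy' : z'.snd = proj Y (zt.snd - τ • (G zt).snd)) :
    z' ∈ feasible X Y ∧ ‖z' - zs‖ ≤ 5 / 4 * ‖zt - zs‖ ∧
      ∃ r, ‖r‖ ≤ (1 / τ + l) * (9 / 4 * ‖zt - zs‖) ∧
        ∀ z ∈ feasible X Y, inner ℝ r (z - z') ≤ inner ℝ (G z') (z - z') := by
  have p1 := proj_spec hX hXc ⟨_, hzt.1⟩ (zt.fst - τ • (G zt).fst)
  have p2 := proj_spec hY hYc ⟨_, hzt.2⟩ (zt.snd - τ • (G zt).snd)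
  rw [← hx'] at p1
  rw [← hy'] at p2
  have hz' : z' ∈ feasible X Y := ⟨p1.1, p2.1⟩
  have hvi : ∀ z ∈ feasible X Y, inner ℝ (zt - τ • G zt - z') (z - z') ≤ 0 := by
    intro z hz
    have q1 := p1.2 z.fst hz.1
    have q2 := p2.2 z.snd hz.2
    rw [inner_pt]
    exact (add_le_add q1 q2).trans (by simp)
  -- The projected gradient step fixes `zs` and expands distances to it by at most `1 + τ l ≤ 5 /
  -- 4`.
  have hd : ‖z' - zs‖ ≤ 5 / 4 * ‖zt - zs‖ := by
    have a1 := hvi zs hzs.1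
    have a2 := hzs.2 z' hz'
    have a3 := hG zt hzt zs hzs.1
    have e : inner ℝ (zt - zs - τ • (G zt - G zs)) (z' - zs) = ‖z' - zs‖ ^ 2
        - inner ℝ (zt - τ • G zt - z') (zs - z') + τ * inner ℝ (G zs) (z' - zs) := by
      rw [← real_inner_self_eq_norm_sq]
      simp only [inner_sub_left, inner_sub_right, real_inner_smul_left]
      ring
    have a4 := real_inner_le_norm (zt - zs - τ • (G zt - G zs)) (z' - zs)
    have a5 : ‖zt - zs - τ • (G zt - G zs)‖ ≤ 5 / 4 * ‖zt - zs‖ := by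
      refine (norm_sub_le _ _).trans ?_
      rw [norm_smul, Real.norm_of_nonneg hτ.le]
      nlinarith [norm_nonneg (zt - zs), mul_le_mul_of_nonneg_left a3 hτ.le]
    have a6 : 0 ≤ τ * inner ℝ (G zs) (z' - zs) := by positivity
    have a7 : ‖z' - zs‖ ^ 2 ≤ 5 / 4 * ‖zt - zs‖ * ‖z' - zs‖ := by
      have := mul_le_mul_of_nonneg_right a5 (norm_nonneg (z' - zs))
      linarith
    by_contra! hlt
    nlinarith [norm_nonneg (zt - zs)]
  -- The projection inequality divided by `τ`, with `G zt` replaced by `G z'`. The bound uses `‖zt -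
  -- z'‖ ≤ (1 + 5 / 4) ‖zt - zs‖`.
  refine ⟨hz', hd, G z' - G zt + (1 / τ) • (zt - z'), ?_, fun z hz => ?_⟩
  · have b1 : ‖zt - z'‖ ≤ 9 / 4 * ‖zt - zs‖ := by
      have := norm_sub_le (zt - zs) (z' - zs)
      rw [sub_sub_sub_cancel_right] at this
      linarith
    have b2 := hG z' hz' zt hzt
    rw [norm_sub_rev z' zt] at b2
    refine (norm_add_le _ _).trans ?_
    rw [norm_smul, Real.norm_of_nonneg (by positivity), add_mul, add_comm]
    gcongr
    exact b2.trans (by gcongr)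
  · have c1 := hvi z hz
    have e : inner ℝ (G z') (z - z') = inner ℝ (G z' - G zt + (1 / τ) • (zt - z')) (z - z')
        - (1 / τ) * inner ℝ (zt - τ • G zt - z') (z - z') := by
      simp only [inner_sub_left, inner_add_left, real_inner_smul_left]
      field_simp
      ring
    rw [e]
    have : (1 / τ) * inner ℝ (zt - τ • G zt - z') (z - z') ≤ 0 :=
      mul_nonpos_of_nonneg_of_nonpos (by positivity) c1
    linarith

/-- The saddle point of the proximal subproblem with centre `u` is close to that of the
original problem if `u` is. -/
theorem SaddleIneq.prox_solution_dist_le (hs : SaddleIneq h G X Y μ ν)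
    (hzs : IsVISol G (feasible X Y) zs) {β : ℝ} (hβ : 0 ≤ β) {u : E} {G' : Pt E F → Pt E F}
    (hG' : ∀ z, G' z = G z + pt (β • (z.fst - u)) 0) {zk : Pt E F}
    (hzk : IsVISol G' (feasible X Y) zk) :
    μ * ‖zk.fst - zs.fst‖ ^ 2 + ν * ‖zk.snd - zs.snd‖ ^ 2 ≤ β / 4 * ‖u - zs.fst‖ ^ 2 := by
  have h1 := hs.monotone hzk.1 hzs.1
  have h2 := hzk.2 zs hzs.1
  have h3 := hzs.2 zk hzk.1
  rw [hG', inner_add_left, inner_pt (pt (β • (zk.fst - u)) 0)] at h2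
  simp only [WithLp.toLp_fst, WithLp.toLp_snd, WithLp.sub_fst, inner_zero_left,
    real_inner_smul_left] at h2
  have e : inner ℝ (G zk) (zs - zk) = - inner ℝ (G zk) (zk - zs) := by
    rw [← inner_neg_right, neg_sub]
  rw [inner_sub_left] at h1
  -- Completing the square: `⟨a, b⟩ - ‖b‖² ≤ ‖a‖² / 4` with `a = u - zs.fst` and `b = zk.fst -
  -- zs.fst`.
  have h4 : inner ℝ (zk.fst - u) (zs.fst - zk.fst) ≤ 1 / 4 * ‖u - zs.fst‖ ^ 2 := by
    have h5 := sq_nonneg ‖(u - zs.fst) - (2 : ℝ) • (zk.fst - zs.fst)‖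
    simp only [← real_inner_self_eq_norm_sq, inner_sub_left, inner_sub_right,
      real_inner_smul_left, real_inner_smul_right] at h5 ⊢
    have c1 := real_inner_comm u zk.fst
    have c2 := real_inner_comm u zs.fst
    have c3 := real_inner_comm zs.fst zk.fst
    linarith
  have h6 := mul_le_mul_of_nonneg_left h4 hβ
  linarith

end

/-! ### The potential of AL-SVRE and its decrease in one outer iteration. -/

section

set_option linter.unusedSectionVars false

variable {E F : Type} [NormedAddCommGroup E] [InnerProductSpace ℝ E]
  [NormedAddCommGroup F] [InnerProductSpace ℝ F] {n : ℕ} [NeZero n]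

theorem norm_sub_sq_le_two {H : Type} [NormedAddCommGroup H] (a b c : H) :
    ‖a - c‖ ^ 2 ≤ 2 * ‖a - b‖ ^ 2 + 2 * ‖b - c‖ ^ 2 := by
  have h := norm_add_le (a - b) (b - c)
  rw [sub_add_sub_cancel] at h
  nlinarith [sq_nonneg (‖a - b‖ - ‖b - c‖), norm_nonneg (a - c)]

/-- The setting of one run of AL-SVRE: `l`-average smooth components with gradients `g`, whose
average `h` is `(μ, ν)`-convex-concave with `μ ≤ ν`, a proximal parameter `β` and
`Q = √(μ / (μ + β))`. -/
structure AccSetting (g : Fin n → Pt E F → Pt E F) (h : Pt E F → ℝ) (X : Set E) (Y : Set F)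
    (l μ ν β Q : ℝ) : Prop where
  convX : Convex ℝ X
  convY : Convex ℝ Y
  closedX : IsClosed X
  closedY : IsClosed Y
  smooth : AverageSmooth g (feasible X Y) l
  saddle : SaddleIneq h (gradOp g) X Y μ ν
  μ_pos : 0 < μ
  μ_le : μ ≤ ν
  β_nonneg : 0 ≤ β
  add_le : μ + β ≤ l
  Q_pos : 0 < Q
  Q_sq : Q ^ 2 * (μ + β) = μ

/-- The weight of the dual distance in the potential of AL-SVRE. -/
noncomputable def dualWeight (l μ Q : ℝ) : ℝ := Q * μ ^ 2 / (8 * l)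

/-- The potential of AL-SVRE. -/
noncomputable def outerPot (h : Pt E F → ℝ) (Y : Set F) (l μ Q : ℝ) (zs : Pt E F)
    (s : E × F × E) : ℝ :=
  accPot h Y μ Q zs s.1 s.2.2 + dualWeight l μ Q * ‖s.2.1 - zs.snd‖ ^ 2

/-- The state of AL-SVRE after the projected gradient step at `zt`, for component gradients `gk`
of the subproblem. -/
noncomputable def outerNext (gk : Fin n → Pt E F → Pt E F) (X : Set E) (Y : Set F)
    (τ Q : ℝ) (x : E) (zt : Pt E F) : E × F × E :=
  let x' := proj X (zt.fst - τ • (meanGrad gk zt).fst)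
  (x', proj Y (zt.snd + τ • (meanGrad gk zt).snd), x' + ((1 - Q) / (1 + Q)) • (x' - x))

namespace AccSetting

variable {g : Fin n → Pt E F → Pt E F} {h : Pt E F → ℝ} {X : Set E} {Y : Set F}
  {l μ ν β Q : ℝ}

theorem ν_pos (S : AccSetting g h X Y l μ ν β Q) : 0 < ν := S.μ_pos.trans_le S.μ_le

theorem l_pos (S : AccSetting g h X Y l μ ν β Q) : 0 < l := by
  linarith [S.μ_pos, S.β_nonneg, S.add_le]

theorem Q_le_one (S : AccSetting g h X Y l μ ν β Q) : Q ≤ 1 := by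
  have h1 := S.Q_sq
  have h2 := S.μ_pos
  have h3 := S.β_nonneg
  by_contra! hlt
  have h4 : 1 < Q ^ 2 := one_lt_pow₀ hlt two_ne_zero
  nlinarith [mul_pos (sub_pos.2 h4) h2, mul_nonneg (sub_pos.2 h4).le h3]

theorem μ_le_l (S : AccSetting g h X Y l μ ν β Q) : μ ≤ l := by
  linarith [S.β_nonneg, S.add_le]

theorem β_le_l (S : AccSetting g h X Y l μ ν β Q) : β ≤ l := by
  linarith [S.μ_pos, S.add_le]

/-- `μ = Q² (μ + β) ≤ Q² l ≤ Q l`. It trades the unknown `Q` for the condition number, both in the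
dual weight and in the inner accuracy. -/
theorem μ_le_Q_mul (S : AccSetting g h X Y l μ ν β Q) : μ ≤ Q * l := by
  have h1 := S.Q_sq
  nlinarith [mul_le_mul_of_nonneg_left S.add_le (sq_nonneg Q),
    mul_le_mul_of_nonneg_right S.Q_le_one (mul_nonneg S.Q_pos.le S.l_pos.le)]

theorem dualWeight_pos (S : AccSetting g h X Y l μ ν β Q) : 0 < dualWeight l μ Q := by
  have := S.l_pos
  have := S.Q_pos
  have := S.μ_pos
  unfold dualWeight
  positivity

theorem dualWeight_le (S : AccSetting g h X Y l μ ν β Q) : dualWeight l μ Q ≤ μ / 8 := by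
  have hl := S.l_pos
  have hμ := S.μ_pos
  unfold dualWeight
  rw [div_le_div_iff₀ (by positivity) (by norm_num)]
  nlinarith [mul_le_mul_of_nonneg_right S.Q_le_one (sq_nonneg μ),
    mul_le_mul_of_nonneg_left S.μ_le_l hμ.le]

variable {zs : Pt E F}

theorem primal_ge (S : AccSetting g h X Y l μ ν β Q)
    (hzs : IsVISol (gradOp g) (feasible X Y) zs) {x : E} (hx : x ∈ X) :
    μ / 2 * ‖x - zs.fst‖ ^ 2 ≤ primal h Y x - h zs :=
  S.saddle.primal_sub_ge S.ν_pos hzs hx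

theorem accPot_nonneg (S : AccSetting g h X Y l μ ν β Q)
    (hzs : IsVISol (gradOp g) (feasible X Y) zs) {x : E} (hx : x ∈ X) (u : E) :
    0 ≤ accPot h Y μ Q zs x u := by
  have h1 := S.primal_ge hzs hx
  have h2 := S.μ_pos
  have h3 : 0 ≤ μ / 2 * ‖x - zs.fst‖ ^ 2 := by positivity
  have h4 : 0 ≤ μ / 2 * ‖accPoint Q x u - zs.fst‖ ^ 2 := by positivity
  unfold accPot
  linarith

theorem dist_le_accPot (S : AccSetting g h X Y l μ ν β Q)
    (hzs : IsVISol (gradOp g) (feasible X Y) zs) {x : E} (hx : x ∈ X) (u : E) :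
    μ * ‖x - zs.fst‖ ^ 2 ≤ 2 * accPot h Y μ Q zs x u ∧
      μ * ‖u - zs.fst‖ ^ 2 ≤ 2 * accPot h Y μ Q zs x u := by
  have h1 := S.primal_ge hzs hx
  have h2 := S.μ_pos
  have h3 : 0 ≤ μ / 2 * ‖accPoint Q x u - zs.fst‖ ^ 2 := by positivity
  have h4 := mul_le_mul_of_nonneg_left (extrapolated_dist_le S.Q_pos x u zs.fst) h2.le
  unfold accPot
  constructor <;> linarith

theorem outerPot_nonneg (S : AccSetting g h X Y l μ ν β Q)
    (hzs : IsVISol (gradOp g) (feasible X Y) zs) {s : E × F × E} (hx : s.1 ∈ X) :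
    0 ≤ outerPot h Y l μ Q zs s := by
  have := S.accPot_nonneg hzs hx s.2.2
  have := S.dualWeight_pos
  unfold outerPot
  positivity

theorem accPot_le_outerPot (S : AccSetting g h X Y l μ ν β Q) (s : E × F × E) :
    accPot h Y μ Q zs s.1 s.2.2 ≤ outerPot h Y l μ Q zs s := by
  have := S.dualWeight_pos
  unfold outerPot
  have : 0 ≤ dualWeight l μ Q * ‖s.2.1 - zs.snd‖ ^ 2 := by positivity
  linarith

variable {s : E × F × E} {zk : Pt E F}

theorem prox_dist_le (S : AccSetting g h X Y l μ ν β Q)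
    (hzs : IsVISol (gradOp g) (feasible X Y) zs)
    (hzk : IsVISol (gradOp (proxGrad g β s.2.2)) (feasible X Y) zk) (hx : s.1 ∈ X) :
    μ ^ 2 * ‖zk - zs‖ ^ 2 ≤ β / 2 * accPot h Y μ Q zs s.1 s.2.2 := by
  have h1 := (S.saddle.mono le_rfl S.μ_le).prox_solution_dist_le hzs S.β_nonneg
    (gradOp_proxGrad g β s.2.2) hzk
  have h2 := (S.dist_le_accPot hzs hx s.2.2).2
  have h3 := mul_le_mul_of_nonneg_left h1 S.μ_pos.le
  have h4 := mul_le_mul_of_nonneg_left h2 S.β_nonneg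
  rw [norm_pt_sq]
  simp only [WithLp.sub_fst, WithLp.sub_snd]
  linarith

/-- The starting point of a subproblem is not far from its solution. -/
theorem start_dist_le (S : AccSetting g h X Y l μ ν β Q)
    (hzs : IsVISol (gradOp g) (feasible X Y) zs)
    (hzk : IsVISol (gradOp (proxGrad g β s.2.2)) (feasible X Y) zk) (hx : s.1 ∈ X) :
    ‖pt s.1 s.2.1 - zk‖ ^ 2 ≤ 21 * l ^ 2 / μ ^ 3 * outerPot h Y l μ Q zs s := by
  have hμ := S.μ_pos
  have hl := S.l_pos
  have hQ := S.Q_pos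
  have h1 := norm_sub_sq_le_two (pt s.1 s.2.1) zs zk
  have h2 := S.prox_dist_le hzs hzk hx
  have h3 := (S.dist_le_accPot hzs hx s.2.2).1
  have h4 := S.accPot_le_outerPot (zs := zs) s
  have h5 : dualWeight l μ Q * ‖s.2.1 - zs.snd‖ ^ 2 ≤ outerPot h Y l μ Q zs s := by
    have := S.accPot_nonneg hzs hx s.2.2
    unfold outerPot
    linarith
  set A := accPot h Y μ Q zs s.1 s.2.2
  set P := outerPot h Y l μ Q zs s
  have hA : 0 ≤ A := S.accPot_nonneg hzs hx s.2.2
  rw [norm_sub_rev zs zk, norm_pt_sq (pt s.1 s.2.1 - zs)] at h1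
  simp only [WithLp.sub_fst, WithLp.sub_snd, WithLp.toLp_fst, WithLp.toLp_snd] at h1
  have h6 : Q * μ ^ 2 * ‖s.2.1 - zs.snd‖ ^ 2 ≤ 8 * l * P := by
    unfold dualWeight at h5
    rw [div_mul_eq_mul_div, div_le_iff₀ (by positivity)] at h5
    linarith
  -- The factor `Q` of the dual weight is removed by `μ ≤ Q l`; this is where the third power of `μ`
  -- comes from.
  have h7 : μ ^ 3 * ‖s.2.1 - zs.snd‖ ^ 2 ≤ 8 * l ^ 2 * P := by
    have e1 : μ ^ 3 * ‖s.2.1 - zs.snd‖ ^ 2 ≤ l * (Q * μ ^ 2 * ‖s.2.1 - zs.snd‖ ^ 2) := by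
      have := mul_le_mul_of_nonneg_right S.μ_le_Q_mul
        (by positivity : 0 ≤ μ ^ 2 * ‖s.2.1 - zs.snd‖ ^ 2)
      linarith
    have e2 := mul_le_mul_of_nonneg_left h6 hl.le
    linarith
  have hP : 0 ≤ P := hA.trans h4
  have hμl : μ ^ 2 ≤ l ^ 2 := by
    have := S.μ_le_l
    gcongr
  have h8 : μ ^ 3 * ‖s.1 - zs.fst‖ ^ 2 ≤ 2 * l ^ 2 * P := by
    have e1 := mul_le_mul_of_nonneg_left h3 (sq_nonneg μ)
    have e2 : μ ^ 2 * A ≤ l ^ 2 * P := mul_le_mul hμl h4 hA (by positivity)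
    linarith
  have h9 : μ ^ 3 * ‖zk - zs‖ ^ 2 ≤ 1 / 2 * l ^ 2 * P := by
    have e1 := mul_le_mul_of_nonneg_left h2 hμ.le
    have e2 : μ * β ≤ l ^ 2 := by
      nlinarith [S.μ_le_l, S.β_le_l, S.β_nonneg]
    have e3 : μ * β * A ≤ l ^ 2 * P := mul_le_mul e2 h4 hA (by positivity)
    linarith
  rw [div_mul_eq_mul_div, le_div_iff₀ (by positivity)]
  have h10 := mul_le_mul_of_nonneg_left h1 (by positivity : 0 ≤ μ ^ 3)
  linarith

variable [CompleteSpace E] [CompleteSpace F]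

set_option maxHeartbeats 1000000 in
/-- The effect of one outer iteration, in terms of the accuracy to which the subproblem has been
solved. -/
theorem outerNext_spec (S : AccSetting g h X Y l μ ν β Q)
    (hzs : IsVISol (gradOp g) (feasible X Y) zs)
    (hzk : IsVISol (gradOp (proxGrad g β s.2.2)) (feasible X Y) zk) (hx : s.1 ∈ X)
    {zt : Pt E F} (hzt : zt ∈ feasible X Y) {τ : ℝ} (hτ : τ = 1 / (4 * √(n : ℝ) * (l + β)))
    {s' : E × F × E} (hs' : s' = outerNext (proxGrad g β s.2.2) X Y τ Q s.1 zt) :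
    (s'.1 ∈ X ∧ s'.2.1 ∈ Y) ∧
    outerPot h Y l μ Q zs s' ≤ (1 - 3 * Q / 8) * outerPot h Y l μ Q zs s
        + 1200 * n * l ^ 2 / μ * ‖zt - zk‖ ^ 2 ∧
    ∀ x ∈ X, ∀ y ∈ Y, h (pt s'.1 y) - h (pt x s'.2.1)
      ≤ 8 * (l / μ) ^ 3 * outerPot h Y l μ Q zs s + 600 * n * l ^ 2 / μ * ‖zt - zk‖ ^ 2 := by
  have hμ := S.μ_pos
  have hl := S.l_pos
  have hQ := S.Q_pos
  have hβ := S.β_nonneg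
  have hβl := S.β_le_l
  have hn : (1 : ℝ) ≤ n := by exact_mod_cast Nat.one_le_iff_ne_zero.2 (NeZero.ne n)
  have hsn : 1 ≤ √(n : ℝ) := Real.one_le_sqrt.2 hn
  have hlb : 0 < l + β := by linarith
  have hτ0 : 0 < τ := by rw [hτ]; positivity
  have hτinv : 1 / τ = 4 * √(n : ℝ) * (l + β) := by rw [hτ, one_div_one_div]
  have hτl : τ * (l + β) ≤ 1 / 4 := by
    rw [hτ, div_mul_eq_mul_div, div_le_div_iff₀ (by positivity) (by norm_num)]
    nlinarith
  obtain ⟨hz', hd, r, hr, hres⟩ := exists_residual (G := gradOp (proxGrad g β s.2.2))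
    (z' := pt s'.1 s'.2.1) S.convX S.convY S.closedX S.closedY hlb.le hτ0 hτl
    (fun z hz z' hz' => (S.smooth.prox hl.le hβ s.2.2).norm_gradOp_sub_le hlb.le hz hz')
    hzk hzt (by rw [hs']; rfl) (by
      rw [hs']
      simp [outerNext, gradOp, signOp])
  have hx' : s'.1 ∈ X := hz'.1
  have hy' : s'.2.1 ∈ Y := hz'.2
  set e := ‖zt - zk‖ ^ 2 with he
  have he0 : 0 ≤ e := by positivity
  -- `1 / τ + (l + β) ≤ 10 √n l`, times the `9 / 4` of the residual bound; `(45 / 2)² = 506.25`.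
  have hrsq : ‖r‖ ^ 2 ≤ 507 * n * l ^ 2 * e := by
    have h1 : ‖r‖ ≤ 45 / 2 * √(n : ℝ) * l * ‖zt - zk‖ := by
      refine hr.trans ?_
      rw [hτinv]
      have : (4 * √(n : ℝ) * (l + β) + (l + β)) ≤ 10 * √(n : ℝ) * l := by
        nlinarith [mul_nonneg (sub_nonneg.2 hsn) hl.le, mul_nonneg (sub_nonneg.2 hsn) hβ,
          mul_nonneg (by positivity : 0 ≤ √(n : ℝ)) (sub_nonneg.2 hβl)]
      calc _ ≤ 10 * √(n : ℝ) * l * (9 / 4 * ‖zt - zk‖) := by gcongr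
        _ = _ := by ring
    have h2 : ‖r‖ ^ 2 ≤ (45 / 2 * √(n : ℝ) * l * ‖zt - zk‖) ^ 2 := by gcongr
    have h3 : (45 / 2 * √(n : ℝ) * l * ‖zt - zk‖) ^ 2 = 2025 / 4 * n * l ^ 2 * e := by
      rw [mul_pow, mul_pow, mul_pow, Real.sq_sqrt (by positivity)]
      ring
    have h4 : 0 ≤ n * l ^ 2 * e := by positivity
    linarith
  have hdsq : ‖pt s'.1 s'.2.1 - zk‖ ^ 2 ≤ 25 / 16 * e := by
    have : ‖pt s'.1 s'.2.1 - zk‖ ^ 2 ≤ (5 / 4 * ‖zt - zk‖) ^ 2 := by gcongr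
    linarith
  set A := accPot h Y μ Q zs s.1 s.2.2 with hA
  have hA0 : 0 ≤ A := S.accPot_nonneg hzs hx s.2.2
  have hAP : A ≤ outerPot h Y l μ Q zs s := S.accPot_le_outerPot s
  have hprox := S.prox_dist_le hzs hzk hx
  rw [← hA] at hprox
  refine ⟨⟨hx', hy'⟩, ?_, fun x hxX y hyY => ?_⟩
  · have hacc := S.saddle.accPot_le S.convX hμ S.μ_le hzs hQ S.Q_le_one S.Q_sq (u := s.2.2) (r := r) hx
      hz' (fun z hz => by rw [← gradOp_proxGrad]; exact hres z hz)
    rw [← hA] at hacc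
    have hy2 : ‖s'.2.1 - zs.snd‖ ^ 2 ≤ 25 / 8 * e + 2 * ‖zk - zs‖ ^ 2 := by
      have h1 := norm_sub_sq_le_two (pt s'.1 s'.2.1) zk zs
      have h2 := norm_snd_sq_le (pt s'.1 s'.2.1 - zs)
      simp only [WithLp.sub_snd, WithLp.toLp_snd] at h2
      linarith
    have hc := S.dualWeight_pos
    -- The dual weight is tuned for this estimate: the displacement of the subproblem's solution
    -- takes only `Q / 8` from the decrease `Q / 2`, which leaves `3 Q / 8`.
    have hc1 : dualWeight l μ Q * (2 * ‖zk - zs‖ ^ 2) ≤ Q / 8 * A := by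
      have h1 : dualWeight l μ Q * (2 * ‖zk - zs‖ ^ 2)
          = Q / (4 * l) * (μ ^ 2 * ‖zk - zs‖ ^ 2) := by
        unfold dualWeight; field_simp; ring
      rw [h1]
      calc _ ≤ Q / (4 * l) * (l / 2 * A) := mul_le_mul_of_nonneg_left
            (hprox.trans (by gcongr)) (by positivity)
        _ = _ := by field_simp; ring
    have hc2 : dualWeight l μ Q * (25 / 8 * e) ≤ n * l ^ 2 / μ * e := by
      have h1 : dualWeight l μ Q * (25 / 8) ≤ n * l ^ 2 / μ := by
        rw [le_div_iff₀ hμ]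
        have h2 := S.dualWeight_le
        have h3 : μ ^ 2 ≤ l ^ 2 := by
          have := S.μ_le_l
          gcongr
        have h4 : l ^ 2 ≤ n * l ^ 2 := by nlinarith [sq_nonneg l]
        nlinarith
      have := mul_le_mul_of_nonneg_right h1 he0
      linarith
    have hr2 : 2 * ‖r‖ ^ 2 / μ ≤ 1014 * (n * l ^ 2 / μ * e) := by
      rw [div_le_iff₀ hμ]
      have : 1014 * (n * l ^ 2 / μ * e) * μ = 2 * (507 * n * l ^ 2 * e) := by
        field_simp; ring
      rw [this]
      linarith
    have hpot : outerPot h Y l μ Q zs s' = accPot h Y μ Q zs s'.1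
        (s'.1 + ((1 - Q) / (1 + Q)) • (s'.1 - s.1))
        + dualWeight l μ Q * ‖s'.2.1 - zs.snd‖ ^ 2 := by
      rw [hs']; rfl
    have hnl : 0 ≤ n * l ^ 2 / μ * e := by positivity
    have hc3 := mul_le_mul_of_nonneg_left hy2 hc.le
    simp only [WithLp.toLp_fst] at hacc
    rw [hpot]
    have hAP' : (1 - 3 * Q / 8) * A ≤ (1 - 3 * Q / 8) * outerPot h Y l μ Q zs s :=
      mul_le_mul_of_nonneg_left hAP (by linarith [S.Q_le_one])
    have e1 : 1200 * n * l ^ 2 / μ * e = 1200 * (n * l ^ 2 / μ * e) := by ring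
    rw [e1]
    linarith
  -- Subtracting the proximal gradient `d` from `r` gives a residual for the original problem, which
  -- bounds its gap. The term `d` is controlled by the old potential rather than by the inner
  -- accuracy.
  · set d : Pt E F := pt (β • (s'.1 - s.2.2)) 0 with hd_def
    have hgap := (S.saddle.mono le_rfl S.μ_le).gap_le hμ (r := r - d) hz' (fun z hz => by
      have h1 := hres z hz
      rw [gradOp_proxGrad, inner_add_left] at h1
      rw [inner_sub_left]
      exact sub_le_iff_le_add.2 h1) (z' := pt x y) ⟨hxX, hyY⟩
    simp only [WithLp.toLp_fst, WithLp.toLp_snd] at hgap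
    refine hgap.trans ?_
    have hdn : ‖d‖ ^ 2 = β ^ 2 * ‖s'.1 - s.2.2‖ ^ 2 := by
      rw [norm_pt_sq, hd_def]
      simp [norm_smul, mul_pow]
    have h1 : ‖r - d‖ ^ 2 ≤ 2 * ‖r‖ ^ 2 + 2 * ‖d‖ ^ 2 := by
      have := norm_sub_sq_le_two r 0 d
      simpa using this
    have hu := (S.dist_le_accPot hzs hx s.2.2).2
    rw [← hA] at hu
    have h2 : ‖s'.1 - s.2.2‖ ^ 2
        ≤ 4 * (25 / 16 * e) + 4 * ‖zk - zs‖ ^ 2 + 2 * ‖s.2.2 - zs.fst‖ ^ 2 := by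
      have a1 := norm_sub_sq_le_two s'.1 zs.fst s.2.2
      have a2 := norm_sub_sq_le_two s'.1 zk.fst zs.fst
      have a3 := norm_fst_sq_le (pt s'.1 s'.2.1 - zk)
      have a4 := norm_fst_sq_le (zk - zs)
      simp only [WithLp.sub_fst, WithLp.toLp_fst] at a3 a4
      rw [norm_sub_rev zs.fst] at a1
      linarith
    have h3 : β ^ 2 * ‖s'.1 - s.2.2‖ ^ 2
        ≤ 25 / 4 * (l ^ 2 * e) + 6 * (l ^ 3 / μ ^ 2 * A) := by
      have b1 : β ^ 2 * e ≤ l ^ 2 * e := by gcongr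
      have b2 : β ^ 2 * ‖zk - zs‖ ^ 2 ≤ 1 / 2 * (l ^ 3 / μ ^ 2 * A) := by
        have c1 : ‖zk - zs‖ ^ 2 ≤ l / 2 * A / μ ^ 2 := by
          rw [le_div_iff₀ (by positivity)]
          have : β / 2 * A ≤ l / 2 * A := by gcongr
          linarith
        calc _ ≤ l ^ 2 * (l / 2 * A / μ ^ 2) := by gcongr
          _ = _ := by ring
      have b3 : β ^ 2 * ‖s.2.2 - zs.fst‖ ^ 2 ≤ 2 * (l ^ 3 / μ ^ 2 * A) := by
        have c1 : ‖s.2.2 - zs.fst‖ ^ 2 ≤ 2 * A / μ := by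
          rw [le_div_iff₀ hμ]; linarith
        have c2 : 1 ≤ l / μ := by rw [one_le_div hμ]; exact S.μ_le_l
        calc _ ≤ l ^ 2 * (2 * A / μ) := by gcongr
          _ = l ^ 2 * (2 * A / μ) * 1 := by ring
          _ ≤ l ^ 2 * (2 * A / μ) * (l / μ) := by gcongr
          _ = _ := by ring
      have := mul_le_mul_of_nonneg_left h2 (sq_nonneg β)
      linarith
    have h4 : l ^ 2 * e ≤ n * l ^ 2 * e := by
      have : 0 ≤ l ^ 2 * e := by positivity
      nlinarith
    have h5 : l ^ 3 / μ ^ 2 * A ≤ l ^ 3 / μ ^ 2 * outerPot h Y l μ Q zs s := by gcongr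
    rw [div_le_iff₀ (by positivity)]
    have e1 : (8 * (l / μ) ^ 3 * outerPot h Y l μ Q zs s + 600 * n * l ^ 2 / μ * e) * (2 * μ)
        = 16 * (l ^ 3 / μ ^ 2 * outerPot h Y l μ Q zs s) + 1200 * (n * l ^ 2 * e) := by
      field_simp
      ring
    have h6 : 0 ≤ l ^ 3 / μ ^ 2 * A := by positivity
    rw [e1]
    rw [hdn] at h1
    have h7 : 0 ≤ n * l ^ 2 * e := by positivity
    linarith

end AccSetting

end

section

set_option linter.unusedSectionVars false

variable {E F : Type} [NormedAddCommGroup E] [InnerProductSpace ℝ E]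
  [NormedAddCommGroup F] [InnerProductSpace ℝ F] {n : ℕ}

/-! ### The duality gap -/

theorem dualityGap_le {h : Pt E F → ℝ} {X : Set E} {Y : Set F} {x : E} {y : F} {B : ℝ}
    (hB : ∀ x' ∈ X, ∀ y' ∈ Y, h (pt x y') - h (pt x' y) ≤ B) :
    dualityGap h X Y x y ≤ ENNReal.ofReal B := by
  have key : (⨆ v ∈ Y, (h (pt x v) : EReal)) - ⨅ u ∈ X, (h (pt u y) : EReal) ≤ (B : EReal) := by
    set S := ⨆ v ∈ Y, (h (pt x v) : EReal) with hS
    have h1 : ∀ u ∈ X, S ≤ ((B + h (pt u y) : ℝ) : EReal) := fun u hu =>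
      iSup₂_le fun v hv => EReal.coe_le_coe_iff.2 (by linarith [hB u hu v hv])
    -- Only the real number `B` is moved across inequalities, so infinite suprema or infima need no
    -- case distinction.
    have h2 : S - (B : EReal) ≤ ⨅ u ∈ X, (h (pt u y) : EReal) := by
      refine le_iInf₂ fun u hu => EReal.sub_le_of_le_add ?_
      rw [← EReal.coe_add, add_comm]
      exact h1 u hu
    refine EReal.sub_le_of_le_add ?_
    rw [add_comm]
    exact (EReal.sub_le_iff_le_add (.inl (EReal.coe_ne_bot B)) (.inl (EReal.coe_ne_top B))).1 h2
  unfold dualityGap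
  exact (EReal.toENNReal_le_toENNReal key).trans (EReal.real_coe_toENNReal B).le

theorem sub_le_of_dualityGap_le {h : Pt E F → ℝ} {X : Set E} {Y : Set F} {x : E} {y : F} {B : ℝ}
    (hB0 : 0 ≤ B) (hB : dualityGap h X Y x y ≤ ENNReal.ofReal B) {x' : E} (hx' : x' ∈ X) {y' : F}
    (hy' : y' ∈ Y) : h (pt x y') - h (pt x' y) ≤ B := by
  have h1 : ((h (pt x y') - h (pt x' y) : ℝ) : EReal)
      ≤ (⨆ v ∈ Y, (h (pt x v) : EReal)) - ⨅ u ∈ X, (h (pt u y) : EReal) := by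
    rw [EReal.coe_sub]
    exact EReal.sub_le_sub (le_iSup₂ (f := fun v (_ : v ∈ Y) => (h (pt x v) : EReal)) y' hy')
      (iInf₂_le (f := fun u (_ : u ∈ X) => (h (pt u y) : EReal)) x' hx')
  have h2 := (EReal.toENNReal_le_toENNReal h1).trans hB
  rwa [EReal.real_coe_toENNReal, ENNReal.ofReal_le_ofReal_iff hB0] at h2

/-- Reduces the comparison of two gaps to real bounds on differences. The two problems may live on
different spaces, so that exchanging the players (`δ = 0`) and regularizing (`δ = ε / 4`) are both
instances. -/
theorem dualityGap_le_add {E' F' : Type} [NormedAddCommGroup E'] [InnerProductSpace ℝ E']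
    [NormedAddCommGroup F'] [InnerProductSpace ℝ F'] {h : Pt E F → ℝ} {h' : Pt E' F' → ℝ} {X : Set E}
    {Y : Set F} {X' : Set E'} {Y' : Set F'} {x : E} {y : F} {x' : E'} {y' : F'} {δ : ℝ}
    (hδ : 0 ≤ δ)
    (hle : ∀ B, (∀ u ∈ X', ∀ v ∈ Y', h' (pt x' v) - h' (pt u y') ≤ B) →
      ∀ u ∈ X, ∀ v ∈ Y, h (pt x v) - h (pt u y) ≤ B + δ) :
    dualityGap h X Y x y ≤ dualityGap h' X' Y' x' y' + ENNReal.ofReal δ := by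
  by_cases htop : dualityGap h' X' Y' x' y' = ∞
  · simp [htop]
  · have h1 : dualityGap h' X' Y' x' y'
        = ENNReal.ofReal (dualityGap h' X' Y' x' y').toReal := (ENNReal.ofReal_toReal htop).symm
    rw [h1, ← ENNReal.ofReal_add ENNReal.toReal_nonneg hδ]
    exact dualityGap_le (hle _ fun u hu v hv =>
      sub_le_of_dualityGap_le ENNReal.toReal_nonneg h1.le hu hv)

/-! ### Convergence of AL-SVRE -/

variable [NeZero n]

/-- One outer iteration of AL-SVRE. -/
noncomputable def alsvreStep (O : Oracle n E F) (X : Set E) (Y : Set F) (β q : ℝ)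
    (p : unitInterval) (τ : ℝ) (T : ℕ) (s : E × F × E) : Prog (E × F × E) := do
  let Ok := O.addProx β s.2.2
  let zt ← lsvre Ok X Y (pt s.1 s.2.1) τ p T
  let G ← fullGrad Ok zt
  let xnew := proj X (zt.fst - τ • G.fst)
  let ynew := proj Y (zt.snd + τ • G.snd)
  let γ := (1 - √q) / (1 + √q)
  pure (xnew, ynew, xnew + γ • (xnew - s.1))

theorem alsvreState_succ (O : Oracle n E F) (X : Set E) (Y : Set F) (x₀ : E) (y₀ : F) (β q : ℝ)
    (p : unitInterval) (τ : ℝ) (T k : ℕ) :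
    alsvreState O X Y x₀ y₀ β q p (fun _ => τ) (fun _ => T) (k + 1)
      = alsvreState O X Y x₀ y₀ β q p (fun _ => τ) (fun _ => T) k
        >>= alsvreStep O X Y β q p τ T := rfl

theorem wp_alsvreStep (g : Fin n → Pt E F → Pt E F) (X : Set E) (Y : Set F) (β q : ℝ)
    (p : unitInterval) (τ : ℝ) (T : ℕ) (s : E × F × E) (c : ℕ) (φ : E × F × E → ℕ → ℝ≥0∞) :
    wp (alsvreStep (sfo g) X Y β q p τ T s) c φ
      = wp (lsvre (sfo (proxGrad g β s.2.2)) X Y (pt s.1 s.2.1) τ p T) c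
        (fun zt c' => φ (outerNext (proxGrad g β s.2.2) X Y τ (√q) s.1 zt) (c' + n)) := by
  unfold alsvreStep
  simp only [addProx_sfo, wp_bind, wp_fullGrad, wp_pure]
  rfl

theorem costLE_alsvreStep (g : Fin n → Pt E F → Pt E F) (X : Set E) (Y : Set F) (β q : ℝ)
    (p : unitInterval) (τ : ℝ) (T : ℕ) (s : E × F × E) :
    CostLE (alsvreStep (sfo g) X Y β q p τ T s)
      (n + T * (2 + ENNReal.ofReal p * n) + n) := fun c => by
  rw [wp_alsvreStep]
  push_cast
  rw [wp_add, wp_const, ← add_assoc]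
  gcongr
  exact costLE_lsvre _ X Y _ τ p T c

theorem costLE_alsvre (g : Fin n → Pt E F → Pt E F) (X : Set E) (Y : Set F) (x₀ : E) (y₀ : F)
    (β q : ℝ) (p : unitInterval) (τ : ℝ) (T K : ℕ) :
    CostLE (alsvre (sfo g) X Y x₀ y₀ β q K p (fun _ => τ) (fun _ => T))
      (K * (n + T * (2 + ENNReal.ofReal p * n) + n)) := by
  have hstate : CostLE (alsvreState (sfo g) X Y x₀ y₀ β q p (fun _ => τ) (fun _ => T) K)
      (K * (n + T * (2 + ENNReal.ofReal p * n) + n)) := by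
    induction K with
    | zero => exact (costLE_pure _).mono (by simp)
    | succ k ih =>
      rw [alsvreState_succ]
      refine (ih.bind fun s => costLE_alsvreStep g X Y β q p τ T s).mono (le_of_eq ?_)
      push_cast
      ring
  exact (hstate.bind fun _ => costLE_pure _).mono (by simp)

variable {g : Fin n → Pt E F → Pt E F} {h : Pt E F → ℝ} {X : Set E} {Y : Set F}
  {l μ ν β Q : ℝ}

/-- Zero on feasible pairs and infinite elsewhere. -/
noncomputable def infeasPenalty (X : Set E) (Y : Set F) (x : E) (y : F) : ℝ≥0∞ :=
  open Classical in if x ∈ X ∧ y ∈ Y then 0 else ∞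

/-- The potential of AL-SVRE, infinite on infeasible states. -/
noncomputable def alsvrePot (h : Pt E F → ℝ) (X : Set E) (Y : Set F) (l μ Q : ℝ) (zs : Pt E F)
    (s : E × F × E) : ℝ≥0∞ :=
  open Classical in
  if s.1 ∈ X ∧ s.2.1 ∈ Y then ENNReal.ofReal (outerPot h Y l μ Q zs s) else ∞

/-- One `Δ` pays for the primal gap and one for the distances to the saddle point: at `u = x₀` the
estimate is `x₀`, and the dual weight is below `ν / 2`. -/
theorem AccSetting.initial_pot_le (S : AccSetting g h X Y l μ ν β Q) {zs : Pt E F}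
    (hzs : IsVISol (gradOp g) (feasible X Y) zs) {x₀ : E} {y₀ : F} (hx₀ : x₀ ∈ X) (hy₀ : y₀ ∈ Y)
    {Δ : ℝ} (hΔ : ∀ x ∈ X, ∀ y ∈ Y, h (pt x₀ y) - h (pt x y₀) ≤ Δ) :
    outerPot h Y l μ Q zs (x₀, y₀, x₀) ≤ 2 * Δ := by
  have h1 : primal h Y x₀ ≤ Δ + h zs := by
    refine primal_le ⟨y₀, hy₀⟩ fun y hy => ?_
    have a1 := hΔ zs.fst hzs.1.1 y hy
    have a2 := S.saddle.saddle_max S.ν_pos hzs hy₀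
    linarith
  have h2 := S.saddle.saddle hzs hx₀ hy₀
  have h3 := hΔ zs.fst hzs.1.1 zs.snd hzs.1.2
  have h4 : dualWeight l μ Q * ‖y₀ - zs.snd‖ ^ 2 ≤ ν / 2 * ‖y₀ - zs.snd‖ ^ 2 := by
    have := S.dualWeight_le
    have := S.μ_le
    have := S.μ_pos
    gcongr
    linarith
  unfold outerPot accPot
  simp only [accPoint_self S.Q_pos]
  linarith

variable [CompleteSpace E] [CompleteSpace F]

theorem AccSetting.exists_solution (S : AccSetting g h X Y l μ ν β Q)
    (hne : (feasible X Y).Nonempty) : ∃ zs, IsVISol (gradOp g) (feasible X Y) zs :=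
  exists_isVISol (feasible_convex S.convX S.convY) (feasible_isClosed S.closedX S.closedY) hne
    S.μ_pos (fun _ hz _ hz' => S.smooth.norm_gradOp_sub_le S.l_pos.le hz hz')
    (fun _ hz _ hz' => S.saddle.strongly_monotone le_rfl S.μ_le hz hz')

/-- The parameters of a run of AL-SVRE: the stepsize `τ`, and a number `T` of inner iterations
that is large enough for the rate `ρ` of L-SVRE on the subproblems. -/
structure AccParams (n : ℕ) (l μ ν β Q τ : ℝ) (T : ℕ) : Prop where
  τ_eq : τ = 1 / (4 * √(n : ℝ) * (l + β))
  inner : ∃ ρ m : ℝ, 0 < m ∧ m ≤ μ + β ∧ m ≤ ν ∧ 0 ≤ ρ ∧ ρ ≤ 1 / (8 * n) ∧ ρ ≤ τ * m / 4 ∧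
    4 * (1 - ρ) ^ T ≤ μ ^ 5 / (300000 * n * l ^ 5)

/-- The accuracy is relative to the current potential, which also bounds the starting distance;
therefore the same `T` serves all outer iterations. -/
theorem AccSetting.exists_inner_accuracy (S : AccSetting g h X Y l μ ν β Q) {τ : ℝ} {T : ℕ}
    (A : AccParams n l μ ν β Q τ T) {zs : Pt E F}
    (hzs : IsVISol (gradOp g) (feasible X Y) zs) {s : E × F × E} (hx : s.1 ∈ X) (hy : s.2.1 ∈ Y) :
    ∃ zk, IsVISol (gradOp (proxGrad g β s.2.2)) (feasible X Y) zk ∧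
      ∀ c, wp (lsvre (sfo (proxGrad g β s.2.2)) X Y (pt s.1 s.2.1) τ (refreshProb n) T) c
          (fun z _ => feasDist X Y zk z)
        ≤ ENNReal.ofReal (μ ^ 2 / (12000 * n * l ^ 3) * outerPot h Y l μ Q zs s) := by
  obtain ⟨ρ, m, hm, hmμ, hmν, hρ0, hρp, hρm, hT⟩ := A.inner
  have hl := S.l_pos
  have hμ := S.μ_pos
  have hβ := S.β_nonneg
  have hlb : 0 < l + β := by linarith
  have hn : (1 : ℝ) ≤ n := by exact_mod_cast Nat.one_le_iff_ne_zero.2 (NeZero.ne n)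
  have hτ0 : 0 < τ := by
    have : 0 < √(n : ℝ) := by positivity
    rw [A.τ_eq]; positivity
  have hsm := S.smooth.prox hl.le hβ s.2.2
  have hmono : ∀ z ∈ feasible X Y, ∀ z' ∈ feasible X Y, m * ‖z - z'‖ ^ 2
      ≤ inner ℝ (gradOp (proxGrad g β s.2.2) z - gradOp (proxGrad g β s.2.2) z') (z - z') :=
    fun z hz z' hz' => (S.saddle.prox β s.2.2).strongly_monotone hmμ hmν hz hz'
  have hs : pt s.1 s.2.1 ∈ feasible X Y := ⟨hx, hy⟩
  obtain ⟨zk, hzk⟩ := exists_isVISol (feasible_convex S.convX S.convY)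
    (feasible_isClosed S.closedX S.closedY) ⟨_, hs⟩ hm
    (fun z hz z' hz' => hsm.norm_gradOp_sub_le hlb.le hz hz') hmono
  refine ⟨zk, hzk, fun c => ?_⟩
  have hp : ((refreshProb n : unitInterval) : ℝ) = 1 / (2 * n) := rfl
  refine (wp_lsvre_feasDist_le S.convX S.convY S.closedX S.closedY hsm hmono hzk hτ0.le
    (p := refreshProb n) ?_ ?_ hρ0 ?_ hρm hs T c).trans (ENNReal.ofReal_le_ofReal ?_)
  · rw [hp, div_le_div_iff₀ (by positivity) (by norm_num)]
    linarith
  -- The stepsize gives `τ² (l + β)² = 1 / (16 n)`, which equals `p / 8`.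
  · rw [hp, ← mul_pow, A.τ_eq]
    have : 1 / (4 * √(n : ℝ) * (l + β)) * (l + β) = 1 / (4 * √(n : ℝ)) := by field_simp
    rw [this, div_pow, mul_pow, Real.sq_sqrt (by positivity)]
    apply le_of_eq
    field_simp
    norm_num
  · rw [hp]
    refine hρp.trans (le_of_eq ?_)
    field_simp
    norm_num
  · have h1 := S.start_dist_le hzs hzk hx
    have hP := S.outerPot_nonneg hzs hx (s := s)
    calc _ ≤ μ ^ 5 / (300000 * n * l ^ 5)
          * (21 * l ^ 2 / μ ^ 3 * outerPot h Y l μ Q zs s) := by gcongr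
      _ = 21 / 25 * (μ ^ 2 / (12000 * n * l ^ 3) * outerPot h Y l μ Q zs s) := by
          field_simp
          ring
      _ ≤ _ := by
          have : 0 ≤ μ ^ 2 / (12000 * n * l ^ 3) * outerPot h Y l μ Q zs s := by positivity
          linarith

/-- `feasDist` is `∞` off the feasible set and `b > 0`, so the pointwise bound is needed only at
feasible points. -/
theorem wp_le_of_feasDist_le {m : Prog (Pt E F)} {c : ℕ} {zk : Pt E F} {ε : ℝ}
    (hm : wp m c (fun z _ => feasDist X Y zk z) ≤ ENNReal.ofReal ε) {φ : Pt E F → ℕ → ℝ≥0∞}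
    {a b : ℝ} (ha : 0 ≤ a) (hb : 0 < b) (hε : 0 ≤ ε)
    (hφ : ∀ z ∈ feasible X Y, ∀ c, φ z c ≤ ENNReal.ofReal (a + b * ‖z - zk‖ ^ 2)) :
    wp m c φ ≤ ENNReal.ofReal (a + b * ε) := by
  calc _ ≤ wp m c (fun z _ => ENNReal.ofReal a + ENNReal.ofReal b * feasDist X Y zk z) := by
        refine wp_mono _ _ fun z c' => ?_
        rw [feasDist]
        split_ifs with hz
        · rw [← ENNReal.ofReal_mul hb.le, ← ENNReal.ofReal_add ha (by positivity)]
          exact hφ z hz c'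
        · rw [ENNReal.mul_top (by simpa using hb), add_top]
          exact le_top
    _ ≤ ENNReal.ofReal a + ENNReal.ofReal b * ENNReal.ofReal ε := by
        rw [wp_add, wp_const, wp_const_mul]
        gcongr
    _ = _ := by rw [← ENNReal.ofReal_mul hb.le, ← ENNReal.ofReal_add ha (by positivity)]

/-- The inner error contributes `μ / (10 l) ≤ Q / 8` times the potential, so the contraction `1 - 3
Q / 8` becomes `1 - Q / 4`. -/
theorem AccSetting.wp_alsvreStep_pot_le (S : AccSetting g h X Y l μ ν β Q) {τ : ℝ} {T : ℕ}
    (A : AccParams n l μ ν β Q τ T) {q : ℝ} (hq : √q = Q) {zs : Pt E F}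
    (hzs : IsVISol (gradOp g) (feasible X Y) zs) (s : E × F × E) (c : ℕ) :
    wp (alsvreStep (sfo g) X Y β q (refreshProb n) τ T s) c
        (fun s' _ => alsvrePot h X Y l μ Q zs s')
      ≤ ENNReal.ofReal (1 - Q / 4) * alsvrePot h X Y l μ Q zs s := by
  have hQ := S.Q_pos
  have hQ1 := S.Q_le_one
  have hl := S.l_pos
  have hμ := S.μ_pos
  have hn : (0 : ℝ) < n := by exact_mod_cast Nat.pos_of_ne_zero (NeZero.ne n)
  by_cases hs : s.1 ∈ X ∧ s.2.1 ∈ Y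
  swap
  · rw [alsvrePot, if_neg hs, ENNReal.mul_top]
    · exact le_top
    · simp only [ne_eq, ENNReal.ofReal_eq_zero, not_le]
      linarith
  have hP := S.outerPot_nonneg hzs hs.1 (s := s)
  obtain ⟨zk, hzk, hacc⟩ := S.exists_inner_accuracy A hzs hs.1 hs.2
  rw [wp_alsvreStep, hq, alsvrePot, if_pos hs, ← ENNReal.ofReal_mul (by linarith)]
  refine (wp_le_of_feasDist_le (hacc c) (a := (1 - 3 * Q / 8) * outerPot h Y l μ Q zs s)
    (b := 1200 * n * l ^ 2 / μ) (mul_nonneg (by linarith) hP) (by positivity) (by positivity)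
    fun z hz c' => ?_).trans (ENNReal.ofReal_le_ofReal ?_)
  · obtain ⟨h1, h2, -⟩ := S.outerNext_spec hzs hzk hs.1 hz A.τ_eq rfl
    rw [alsvrePot, if_pos h1]
    exact ENNReal.ofReal_le_ofReal h2
  · have e : 1200 * n * l ^ 2 / μ * (μ ^ 2 / (12000 * n * l ^ 3) * outerPot h Y l μ Q zs s)
        = μ / l / 10 * outerPot h Y l μ Q zs s := by
      field_simp
      ring
    have h1 : μ / l ≤ Q := by
      rw [div_le_iff₀ hl]
      exact S.μ_le_Q_mul
    rw [e]
    have h2 : μ / l / 10 * outerPot h Y l μ Q zs s ≤ Q / 8 * outerPot h Y l μ Q zs s := by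
      gcongr ?_ * _
      linarith
    linarith

theorem AccSetting.wp_alsvreStep_gap_le (S : AccSetting g h X Y l μ ν β Q) {τ : ℝ} {T : ℕ}
    (A : AccParams n l μ ν β Q τ T) {q : ℝ} (hq : √q = Q) {zs : Pt E F}
    (hzs : IsVISol (gradOp g) (feasible X Y) zs) (s : E × F × E) (c : ℕ) :
    wp (alsvreStep (sfo g) X Y β q (refreshProb n) τ T s) c
        (fun s' _ => dualityGap h X Y s'.1 s'.2.1)
      ≤ ENNReal.ofReal (9 * (l / μ) ^ 3) * alsvrePot h X Y l μ Q zs s := by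
  have hl := S.l_pos
  have hμ := S.μ_pos
  have hn : (0 : ℝ) < n := by exact_mod_cast Nat.pos_of_ne_zero (NeZero.ne n)
  by_cases hs : s.1 ∈ X ∧ s.2.1 ∈ Y
  swap
  · rw [alsvrePot, if_neg hs, ENNReal.mul_top]
    · exact le_top
    · simp only [ne_eq, ENNReal.ofReal_eq_zero, not_le]
      positivity
  have hP := S.outerPot_nonneg hzs hs.1 (s := s)
  obtain ⟨zk, hzk, hacc⟩ := S.exists_inner_accuracy A hzs hs.1 hs.2
  rw [wp_alsvreStep, hq, alsvrePot, if_pos hs, ← ENNReal.ofReal_mul (by positivity)]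
  refine (wp_le_of_feasDist_le (hacc c) (a := 8 * (l / μ) ^ 3 * outerPot h Y l μ Q zs s)
    (b := 600 * n * l ^ 2 / μ) (by positivity) (by positivity) (by positivity)
    fun z hz c' => ?_).trans (ENNReal.ofReal_le_ofReal ?_)
  · obtain ⟨-, -, h3⟩ := S.outerNext_spec hzs hzk hs.1 hz A.τ_eq rfl
    exact dualityGap_le h3
  · have e : 600 * n * l ^ 2 / μ * (μ ^ 2 / (12000 * n * l ^ 3) * outerPot h Y l μ Q zs s)
        = μ / l / 20 * outerPot h Y l μ Q zs s := by
      field_simp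
      ring
    have h1 : μ / l ≤ 1 := by
      rw [div_le_one hl]
      exact S.μ_le_l
    have h2 : 1 ≤ (l / μ) ^ 3 := by
      refine one_le_pow₀ ?_
      rw [one_le_div hμ]
      exact S.μ_le_l
    rw [e]
    have h3 : μ / l / 20 * outerPot h Y l μ Q zs s ≤ (l / μ) ^ 3 * outerPot h Y l μ Q zs s := by
      gcongr ?_ * _
      linarith
    linarith

theorem AccSetting.wp_alsvreState_pot_le (S : AccSetting g h X Y l μ ν β Q) {τ : ℝ} {T : ℕ}
    (A : AccParams n l μ ν β Q τ T) {q : ℝ} (hq : √q = Q) {zs : Pt E F}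
    (hzs : IsVISol (gradOp g) (feasible X Y) zs) {x₀ : E} {y₀ : F} (hx₀ : x₀ ∈ X) (hy₀ : y₀ ∈ Y)
    {Δ : ℝ} (hΔ : ∀ x ∈ X, ∀ y ∈ Y, h (pt x₀ y) - h (pt x y₀) ≤ Δ) (K c : ℕ) :
    wp (alsvreState (sfo g) X Y x₀ y₀ β q (refreshProb n) (fun _ => τ) (fun _ => T) K) c
        (fun s _ => alsvrePot h X Y l μ Q zs s)
      ≤ ENNReal.ofReal ((1 - Q / 4) ^ K * (2 * Δ)) := by
  induction K with
  | zero =>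
    unfold alsvreState
    rw [wp_pure, alsvrePot, if_pos ⟨hx₀, hy₀⟩, pow_zero, one_mul]
    exact ENNReal.ofReal_le_ofReal (S.initial_pot_le hzs hx₀ hy₀ hΔ)
  | succ k ih =>
    rw [alsvreState_succ, wp_bind]
    refine (wp_mono _ _ fun s c' => S.wp_alsvreStep_pot_le A hq hzs s c').trans ?_
    rw [wp_const_mul, pow_succ', mul_assoc,
      ENNReal.ofReal_mul (p := 1 - Q / 4) (by linarith [S.Q_le_one])]
    gcongr

theorem AccSetting.wp_alsvre_penalty_ne_top (S : AccSetting g h X Y l μ ν β Q) {τ : ℝ} {T : ℕ}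
    (A : AccParams n l μ ν β Q τ T) {q : ℝ} (hq : √q = Q) {x₀ : E} {y₀ : F} (hx₀ : x₀ ∈ X)
    (hy₀ : y₀ ∈ Y) {Δ : ℝ} (hΔ : ∀ x ∈ X, ∀ y ∈ Y, h (pt x₀ y) - h (pt x y₀) ≤ Δ) (K c : ℕ) :
    wp (alsvre (sfo g) X Y x₀ y₀ β q K (refreshProb n) (fun _ => τ) (fun _ => T)) c
      (fun s _ => infeasPenalty X Y s.1 s.2) ≠ ∞ := by
  obtain ⟨zs, hzs⟩ := S.exists_solution ⟨pt x₀ y₀, hx₀, hy₀⟩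
  refine ne_top_of_le_ne_top (b := ENNReal.ofReal ((1 - Q / 4) ^ K * (2 * Δ)))
    ENNReal.ofReal_ne_top ?_
  unfold alsvre
  rw [wp_bind]
  simp only [wp_pure]
  refine (wp_mono _ _ fun s c' => ?_).trans (S.wp_alsvreState_pot_le A hq hzs hx₀ hy₀ hΔ K c)
  unfold alsvrePot infeasPenalty
  split_ifs <;> simp

/-- The expected duality gap of the output of AL-SVRE. -/
theorem AccSetting.wp_alsvre_gap_le (S : AccSetting g h X Y l μ ν β Q) {τ : ℝ} {T : ℕ}
    (A : AccParams n l μ ν β Q τ T) {q : ℝ} (hq : √q = Q) {x₀ : E} {y₀ : F} (hx₀ : x₀ ∈ X)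
    (hy₀ : y₀ ∈ Y) {Δ : ℝ} (hΔ : ∀ x ∈ X, ∀ y ∈ Y, h (pt x₀ y) - h (pt x y₀) ≤ Δ) (K c : ℕ) :
    wp (alsvre (sfo g) X Y x₀ y₀ β q (K + 1) (refreshProb n) (fun _ => τ) (fun _ => T)) c
        (fun s _ => dualityGap h X Y s.1 s.2)
      ≤ ENNReal.ofReal (18 * (l / μ) ^ 3 * (1 - Q / 4) ^ K * Δ) := by
  obtain ⟨zs, hzs⟩ := S.exists_solution ⟨pt x₀ y₀, hx₀, hy₀⟩
  have hl := S.l_pos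
  have hμ := S.μ_pos
  unfold alsvre
  rw [wp_bind]
  simp only [wp_pure]
  -- The last of the `K + 1` iterations is split off: it converts the potential left by the first
  -- `K` into the duality gap.
  rw [alsvreState_succ, wp_bind]
  refine (wp_mono _ _ fun s c' => S.wp_alsvreStep_gap_le A hq hzs s c').trans ?_
  rw [wp_const_mul]
  calc _ ≤ ENNReal.ofReal (9 * (l / μ) ^ 3) * ENNReal.ofReal ((1 - Q / 4) ^ K * (2 * Δ)) := by
        gcongr
        exact S.wp_alsvreState_pot_le A hq hzs hx₀ hy₀ hΔ K c
    _ = _ := by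
        rw [← ENNReal.ofReal_mul (by positivity)]
        congr 1
        ring

end

/-! ### The choice of the parameters -/

theorem rpow_three_quarters (x : ℝ) (hx : 0 < x) : x ^ (3 / 4 : ℝ) = √x * √√x := by
  rw [Real.sqrt_eq_rpow, Real.sqrt_eq_rpow, ← Real.rpow_mul hx.le, ← Real.rpow_add hx]
  norm_num

/-- The complexity of AL-SVRE without its logarithmic factors. -/
noncomputable def coreRate (n : ℕ) (l μ ν : ℝ) : ℝ :=
  n + √(n : ℝ) * l / √(μ * ν) + (n : ℝ) ^ (3 / 4 : ℝ) * √(l / μ)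

/-- Here `m` is the modulus of the subproblem: `ν`, `l / √n` or `μ` in the three cases. In the
first, `√n l / m` dominates `n`; in the second the two are equal, which creates `n^{3/4}`; in the
third `β = 0`, there is no acceleration and `n` dominates. -/
theorem proxParam_spec {n : ℕ} (hn : 1 ≤ n) {l μ ν : ℝ} (hμ : 0 < μ) (hμν : μ ≤ ν) (hμl : μ ≤ l) :
    0 ≤ proxParam n l μ ν ∧ μ + proxParam n l μ ν ≤ l ∧
    ∃ m, 0 < m ∧ m ≤ μ + proxParam n l μ ν ∧ m ≤ ν ∧
      (n + √(n : ℝ) * l / m) / √(μ / (μ + proxParam n l μ ν)) ≤ 2 * coreRate n l μ ν := by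
  have hn' : (1 : ℝ) ≤ n := by exact_mod_cast hn
  have hsn : 1 ≤ √(n : ℝ) := Real.one_le_sqrt.2 hn'
  have hsn0 : 0 < √(n : ℝ) := by linarith
  have hsq : √(n : ℝ) * √(n : ℝ) = n := Real.mul_self_sqrt (by linarith)
  have hν : 0 < ν := hμ.trans_le hμν
  have hl : 0 < l := hμ.trans_le hμl
  have t1 : 0 ≤ √(n : ℝ) * l / √(μ * ν) := by positivity
  have t2 : 0 ≤ (n : ℝ) ^ (3 / 4 : ℝ) * √(l / μ) := by positivity
  unfold proxParam coreRate
  split_ifs with h1 h2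
  · rw [le_div_iff₀ hν] at h1
    have e : μ + (ν - μ) = ν := by ring
    rw [e]
    refine ⟨by linarith, by nlinarith, ν, hν, le_rfl, le_rfl, ?_⟩
    have h3 : (n : ℝ) ≤ √(n : ℝ) * l / ν := by
      rw [le_div_iff₀ hν]
      calc (n : ℝ) * ν = √(n : ℝ) * (√(n : ℝ) * ν) := by rw [← mul_assoc, hsq]
        _ ≤ _ := by gcongr
    have h4 : √(n : ℝ) * l / ν / √(μ / ν) = √(n : ℝ) * l / √(μ * ν) := by
      have : ν * √(μ / ν) = √(μ * ν) := by
        rw [← Real.sqrt_sq hν.le, ← Real.sqrt_mul (by positivity), Real.sqrt_sq hν.le]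
        congr 1
        field_simp
      rw [div_div, this]
    have h5 : (n + √(n : ℝ) * l / ν) / √(μ / ν) ≤ 2 * (√(n : ℝ) * l / ν / √(μ / ν)) := by
      rw [← mul_div_assoc]
      gcongr
      linarith
    rw [h4] at h5
    linarith
  · rw [not_le, div_lt_iff₀ hν] at h1
    rw [lt_div_iff₀ hμ] at h2
    have e : μ + (l / √(n : ℝ) - μ) = l / √(n : ℝ) := by ring
    rw [e]
    refine ⟨?_, ?_, l / √(n : ℝ), by positivity, le_rfl, ?_, ?_⟩
    · rw [sub_nonneg, le_div_iff₀ hsn0]; linarith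
    · exact div_le_self hl.le hsn
    · rw [div_le_iff₀ hsn0]; linarith
    · have h3 : √(n : ℝ) * l / (l / √(n : ℝ)) = n := by
        rw [div_div_eq_mul_div, mul_right_comm, hsq, mul_div_assoc, div_self hl.ne', mul_one]
      have h4 : (n : ℝ) / √(μ / (l / √(n : ℝ))) = (n : ℝ) ^ (3 / 4 : ℝ) * √(l / μ) := by
        rw [rpow_three_quarters _ (by linarith), div_div_eq_mul_div, div_eq_iff (by positivity),
          mul_assoc, mul_assoc, ← Real.sqrt_mul (by positivity : 0 ≤ l / μ),
          ← Real.sqrt_mul hsn0.le]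
        have : √(n : ℝ) * (l / μ * (μ * √(n : ℝ) / l)) = n := by
          calc _ = √(n : ℝ) * √(n : ℝ) := by field_simp
            _ = _ := hsq
        rw [this, hsq]
      rw [h3, ← two_mul, mul_div_assoc, h4]
      linarith
  · rw [not_lt, div_le_iff₀ hμ] at h2
    rw [add_zero]
    refine ⟨le_rfl, hμl, μ, hμ, le_rfl, hμν, ?_⟩
    have h3 : √(n : ℝ) * l / μ ≤ n := by
      rw [div_le_iff₀ hμ]
      calc _ ≤ √(n : ℝ) * (√(n : ℝ) * μ) := by gcongr
        _ = _ := by rw [← mul_assoc, hsq]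
    rw [div_self hμ.ne', Real.sqrt_one, div_one]
    linarith

theorem one_sub_pow_le_of_log_le {ρ x : ℝ} {k : ℕ} (hρ0 : 0 < ρ) (hρ1 : ρ ≤ 1) (hx : 0 < x)
    (hk : 1 / ρ * Real.log x ≤ k) : (1 - ρ) ^ k ≤ x⁻¹ := by
  have h1 : (1 - ρ) ^ k ≤ Real.exp (-(ρ * k)) := by
    rw [show -(ρ * (k : ℝ)) = k * (-ρ) by ring, Real.exp_nat_mul]
    have h2 : 1 - ρ ≤ Real.exp (-ρ) := by linarith [Real.add_one_le_exp (-ρ)]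
    exact pow_le_pow_left₀ (by linarith) h2 k
  refine h1.trans ?_
  rw [← Real.exp_log (inv_pos.2 hx), Real.exp_le_exp, Real.log_inv]
  have h3 := mul_le_mul_of_nonneg_left hk hρ0.le
  rw [← mul_assoc, mul_one_div_cancel hρ0.ne', one_mul] at h3
  linarith

theorem one_le_log_of_three_le {x : ℝ} (hx : 3 ≤ x) : 1 ≤ Real.log x := by
  rw [Real.le_log_iff_exp_le (by linarith)]
  linarith [Real.exp_one_lt_d9]

theorem exists_inner_iterations {n : ℕ} (hn : 1 ≤ n) {l μ ν : ℝ} (hμ : 0 < μ) (hμν : μ ≤ ν)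
    (hμl : μ ≤ l) {m : ℝ} (hm : 0 < m) (hmμ : m ≤ μ + proxParam n l μ ν) (hmν : m ≤ ν) :
    ∃ T : ℕ, AccParams n l μ ν (proxParam n l μ ν) (√(μ / (μ + proxParam n l μ ν)))
        (1 / (4 * √(n : ℝ) * (l + proxParam n l μ ν))) T ∧
      (T : ℝ) ≤ 609 * (n + √(n : ℝ) * l / m) * Real.log (1 + n + l / μ) := by
  obtain ⟨hβ, hβl, -⟩ := proxParam_spec hn hμ hμν hμl
  set β := proxParam n l μ ν
  have hn' : (1 : ℝ) ≤ n := by exact_mod_cast hn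
  have hsn : 0 < √(n : ℝ) := Real.sqrt_pos.2 (by linarith)
  have hl : 0 < l := hμ.trans_le hμl
  set τ := 1 / (4 * √(n : ℝ) * (l + β)) with hτ
  have hτ0 : 0 < τ := by positivity
  set ρ := min (1 / (8 * (n : ℝ))) (τ * m / 4) with hρ
  have hρ0 : 0 < ρ := lt_min (by positivity) (by positivity)
  have hρ1 : ρ ≤ 1 := (min_le_left _ _).trans (by
    rw [div_le_one (by positivity)]; linarith)
  -- `4 / x` is the contraction required of the inner loop. Since `1200000 ≤ 3 ^ 13`, `x ≤ W ^ (13 +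
  -- 1 + 5)`; with `1 / ρ ≤ 32 Θ` and one unit for rounding up, `32 · 19 + 1 = 609`.
  set x := 1200000 * n * (l / μ) ^ 5 with hx
  have hx0 : 0 < x := by positivity
  set W := 1 + n + l / μ with hW
  have hB : 1 ≤ l / μ := by rwa [one_le_div hμ]
  have hW3 : 3 ≤ W := by linarith
  have hlogW := one_le_log_of_three_le hW3
  set Θ := n + √(n : ℝ) * l / m with hΘ
  have hΘ1 : 1 ≤ Θ := by
    have : 0 ≤ √(n : ℝ) * l / m := by positivity
    linarith
  have hρinv : 1 / ρ ≤ 32 * Θ := by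
    have h1 : 0 ≤ √(n : ℝ) * l / m := by positivity
    rcases min_choice (1 / (8 * (n : ℝ))) (τ * m / 4) with h | h
    · rw [hρ, h, one_div_one_div]
      linarith
    · rw [hρ, h, hτ]
      have : 1 / (1 / (4 * √(n : ℝ) * (l + β)) * m / 4) = 16 * (√(n : ℝ) * (l + β) / m) := by
        field_simp
        norm_num
      rw [this]
      have h2 : √(n : ℝ) * (l + β) / m ≤ √(n : ℝ) * (2 * l) / m := by
        gcongr
        linarith
      have h3 : √(n : ℝ) * (2 * l) / m = 2 * (√(n : ℝ) * l / m) := by ring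
      linarith
  have hlogx : Real.log x ≤ 19 * Real.log W := by
    have h0 : x ≤ W ^ 19 := by
      calc x ≤ W ^ 13 * W * W ^ 5 := by
            have h1 : (1200000 : ℝ) ≤ W ^ 13 := by
              calc (1200000 : ℝ) ≤ 3 ^ 13 := by norm_num
                _ ≤ W ^ 13 := by gcongr
            rw [hx]
            gcongr <;> linarith
        _ = W ^ 19 := by ring
    calc _ ≤ Real.log (W ^ 19) := Real.log_le_log hx0 h0
      _ = _ := by rw [Real.log_pow]; norm_num
  refine ⟨⌈1 / ρ * Real.log x⌉₊, ⟨rfl, ρ, m, hm, hmμ, hmν, hρ0.le, min_le_left _ _,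
    min_le_right _ _, ?_⟩, ?_⟩
  · have h1 := one_sub_pow_le_of_log_le hρ0 hρ1 hx0 (Nat.le_ceil (1 / ρ * Real.log x))
    calc _ ≤ 4 * x⁻¹ := by gcongr
      _ = _ := by
        rw [hx]
        field_simp
        norm_num
  · have hx1 : 1 ≤ x := by
      have : 1 ≤ (l / μ) ^ 5 := one_le_pow₀ hB
      rw [hx]
      nlinarith
    have h2 : 0 ≤ Real.log x := Real.log_nonneg hx1
    have h1 := (Nat.ceil_lt_add_one (a := 1 / ρ * Real.log x) (by positivity)).le
    have h3 : 1 / ρ * Real.log x ≤ 32 * Θ * (19 * Real.log W) := by gcongr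
    nlinarith [mul_le_mul hΘ1 hlogW zero_le_one (by linarith)]

theorem exists_outer_iterations {n : ℕ} (hn : 1 ≤ n) {B Q Δ ε : ℝ} (hB : 1 ≤ B) (hQ : 0 < Q)
    (hQ1 : Q ≤ 1) (hΔ : 0 ≤ Δ) (hε : 0 < ε) :
    ∃ K : ℕ, 18 * B ^ 3 * (1 - Q / 4) ^ K * Δ ≤ ε / 2 ∧
      (K : ℝ) + 1 ≤ 38 / Q * Real.log (1 + n + B + Δ / ε) := by
  have hn' : (1 : ℝ) ≤ n := by exact_mod_cast hn
  have hd : 0 ≤ Δ / ε := by positivity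
  set W := 1 + n + B + Δ / ε with hW
  have hW3 : 3 ≤ W := by linarith
  have hlogW := one_le_log_of_three_le hW3
  -- The summand `1` keeps the logarithm nonnegative even for `Δ = 0`. The final `38` is `4 · 9`,
  -- plus one for rounding up and one for the iteration that converts the potential to the gap.
  set x := 1 + 36 * B ^ 3 * (Δ / ε) with hx
  have hx1 : 1 ≤ x := by
    have : 0 ≤ 36 * B ^ 3 * (Δ / ε) := by positivity
    linarith
  have hx0 : 0 < x := by linarith
  have hlogx : Real.log x ≤ 9 * Real.log W := by
    have h1 : 36 * B ^ 3 * (Δ / ε) ≤ W ^ 8 := by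
      calc _ ≤ W ^ 4 * W ^ 3 * W := by
            have h1 : (36 : ℝ) ≤ W ^ 4 := by
              calc (36 : ℝ) ≤ 3 ^ 4 := by norm_num
                _ ≤ W ^ 4 := by gcongr
            gcongr <;> linarith
        _ = W ^ 8 := by ring
    have h2 : 1 ≤ W ^ 8 := one_le_pow₀ (by linarith)
    have h0 : x ≤ W ^ 9 := by
      calc x ≤ 2 * W ^ 8 := by linarith
        _ ≤ W * W ^ 8 := by gcongr; linarith
        _ = W ^ 9 := (pow_succ' W 8).symm
    calc _ ≤ Real.log (W ^ 9) := Real.log_le_log hx0 h0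
      _ = _ := by rw [Real.log_pow]; norm_num
  have hlog0 : 0 ≤ Real.log x := Real.log_nonneg hx1
  refine ⟨⌈1 / (Q / 4) * Real.log x⌉₊, ?_, ?_⟩
  · have h1 := one_sub_pow_le_of_log_le (by positivity : 0 < Q / 4) (by linarith) hx0
      (Nat.le_ceil (1 / (Q / 4) * Real.log x))
    have h2 : 18 * B ^ 3 * Δ ≤ x * (ε / 2) := by
      have e : x * (ε / 2) = ε / 2 + 18 * B ^ 3 * (Δ / ε * ε) := by rw [hx]; ring
      rw [e, div_mul_cancel₀ _ hε.ne']
      linarith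
    calc _ = 18 * B ^ 3 * Δ * (1 - Q / 4) ^ ⌈1 / (Q / 4) * Real.log x⌉₊ := by ring
      _ ≤ 18 * B ^ 3 * Δ * x⁻¹ := mul_le_mul_of_nonneg_left h1 (by positivity)
      _ ≤ x * (ε / 2) * x⁻¹ := mul_le_mul_of_nonneg_right h2 (inv_nonneg.2 hx0.le)
      _ = _ := by rw [mul_right_comm, mul_inv_cancel₀ hx0.ne', one_mul]
  · have h1 := (Nat.ceil_lt_add_one (a := 1 / (Q / 4) * Real.log x) (by positivity)).le
    have h2 : 1 / (Q / 4) * Real.log x ≤ 1 / (Q / 4) * (9 * Real.log W) := by gcongr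
    have h3 : 1 / (Q / 4) * (9 * Real.log W) = 36 * (1 / Q * Real.log W) := by
      field_simp; norm_num
    have h4 : 1 ≤ 1 / Q * Real.log W := by
      have : 1 ≤ 1 / Q := by rwa [one_le_div hQ]
      nlinarith
    have h5 : 38 / Q * Real.log W = 38 * (1 / Q * Real.log W) := by ring
    linarith

/-- `K` outer and `T` inner iterations suffice for AL-SVRE to bring a duality gap of `Δ` down to
`ε / 2`. -/
structure TunedIterations (n : ℕ) (l μ ν Δ ε : ℝ) (K T : ℕ) : Prop where
  params : AccParams n l μ ν (proxParam n l μ ν) (√(μ / (μ + proxParam n l μ ν)))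
    (1 / (4 * √(n : ℝ) * (l + proxParam n l μ ν))) T
  outer : ∃ k, K = k + 1 ∧
    18 * (l / μ) ^ 3 * (1 - √(μ / (μ + proxParam n l μ ν)) / 4) ^ k * Δ ≤ ε / 2

theorem exists_tunedIterations {n : ℕ} (hn : 1 ≤ n) {l μ ν Δ ε : ℝ} (hμ : 0 < μ) (hμν : μ ≤ ν)
    (hμl : μ ≤ l) (hΔ : 0 ≤ Δ) (hε : 0 < ε) :
    ∃ K T : ℕ, TunedIterations n l μ ν Δ ε K T ∧
      (K : ℝ) * (2 * n + 5 / 2 * T) ≤ 115900 * coreRate n l μ ν * Real.log (1 + n + l / μ)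
        * Real.log (1 + n + l / μ + Δ / ε) := by
  obtain ⟨hβ, hβl, m, hm, hmμ, hmν, hrate⟩ := proxParam_spec hn hμ hμν hμl
  have hn' : (1 : ℝ) ≤ n := by exact_mod_cast hn
  have hl : 0 < l := hμ.trans_le hμl
  have hB : 1 ≤ l / μ := by rwa [one_le_div hμ]
  have hd : 0 ≤ Δ / ε := by positivity
  obtain ⟨T, hT, hTle⟩ := exists_inner_iterations hn hμ hμν hμl hm hmμ hmν
  have hQ : 0 < √(μ / (μ + proxParam n l μ ν)) := by
    apply Real.sqrt_pos.2
    positivity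
  have hQ1 : √(μ / (μ + proxParam n l μ ν)) ≤ 1 := by
    refine Real.sqrt_le_one.2 ?_
    rw [div_le_one (by positivity)]
    linarith
  obtain ⟨k, hk, hkle⟩ := exists_outer_iterations hn hB hQ hQ1 hΔ hε
  refine ⟨k + 1, T, ⟨hT, k, rfl, hk⟩, ?_⟩
  set Q := √(μ / (μ + proxParam n l μ ν))
  set W₁ := Real.log (1 + n + l / μ)
  set W₂ := Real.log (1 + n + l / μ + Δ / ε)
  have hW₁ : 1 ≤ W₁ := one_le_log_of_three_le (by linarith)
  have hW₂ : 1 ≤ W₂ := one_le_log_of_three_le (by linarith)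
  set Θ := n + √(n : ℝ) * l / m with hΘ
  have hΘn : (n : ℝ) ≤ Θ := by
    have : 0 ≤ √(n : ℝ) * l / m := by positivity
    linarith
  -- Per outer iteration: two full gradients outside the inner steps, and `2 + p n = 5 / 2` expected
  -- calls per inner step.
  have h1 : 2 * (n : ℝ) + 5 / 2 * T ≤ 1525 * Θ * W₁ := by
    nlinarith
  push_cast
  calc _ ≤ 38 / Q * W₂ * (1525 * Θ * W₁) := by gcongr
    _ = 57950 * (Θ / Q) * W₁ * W₂ := by ring
    _ ≤ 57950 * (2 * coreRate n l μ ν) * W₁ * W₂ := by gcongr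
    _ = _ := by ring

section

set_option linter.unusedSectionVars false

/-! ### First-order characterization of convex-concave functions -/

/-- The convexity inequality divided by `t`, as `t → 0+`. The derivative exists only within `Z`, so
the path is restricted to the open segment. -/
theorem first_order_le {H : Type} [NormedAddCommGroup H] [InnerProductSpace ℝ H] [CompleteSpace H]
    {f : H → ℝ} {v z z' : H} {Z : Set H} {c : ℝ} (hf : HasGradientWithinAt f v Z z)
    (hseg : ∀ t ∈ Set.Ioo (0 : ℝ) 1, z + t • (z' - z) ∈ Z)
    (hconv : ∀ t ∈ Set.Ioo (0 : ℝ) 1,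
      f (z + t • (z' - z)) ≤ (1 - t) * f z + t * f z' - (1 - t) * t * c) :
    inner ℝ v (z' - z) + c ≤ f z' - f z := by
  have hline : HasDerivWithinAt (fun t : ℝ => z + t • (z' - z)) (z' - z) (Set.Ioo 0 1) 0 := by
    simpa using ((hasDerivWithinAt_id (0 : ℝ) (Set.Ioo 0 1)).smul_const (z' - z)).const_add z
  have hf' := hf.hasFDerivWithinAt
  have hderiv : HasDerivWithinAt (fun t : ℝ => f (z + t • (z' - z))) (inner ℝ v (z' - z))
      (Set.Ioo 0 1) 0 := by
    have hz : z + (0 : ℝ) • (z' - z) = z := by simp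
    rw [← hz] at hf'
    exact HasFDerivWithinAt.comp_hasDerivWithinAt (0 : ℝ) hf' hline hseg
  rw [hasDerivWithinAt_iff_tendsto_slope' (by simp)] at hderiv
  have hne : (nhdsWithin (0 : ℝ) (Set.Ioo 0 1)).NeBot := left_nhdsWithin_Ioo_neBot one_pos
  have hid : Filter.Tendsto (fun t : ℝ => (1 - t) * c) (nhdsWithin 0 (Set.Ioo 0 1))
      (nhds ((1 - 0) * c)) :=
    (Continuous.tendsto (by fun_prop : Continuous fun t : ℝ => (1 - t) * c) 0).mono_left
      nhdsWithin_le_nhds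
  have hlim := hderiv.add hid
  rw [sub_zero, one_mul] at hlim
  refine le_of_tendsto hlim ?_
  filter_upwards [self_mem_nhdsWithin] with t ht
  have h1 := hconv t ht
  rw [slope_def_field, zero_smul, add_zero, sub_zero, ← le_sub_iff_add_le, div_le_iff₀ ht.1]
  linarith

section Gradient

variable {E F : Type} [NormedAddCommGroup E] [InnerProductSpace ℝ E] [CompleteSpace E]
  [NormedAddCommGroup F] [InnerProductSpace ℝ F] [CompleteSpace F] {n : ℕ}

theorem hasGradientWithinAt_average {f : Fin n → Pt E F → ℝ} {g : Fin n → Pt E F → Pt E F}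
    {Z : Set (Pt E F)} {z : Pt E F} (hf : ∀ i, HasGradientWithinAt (f i) (g i z) Z z) :
    HasGradientWithinAt (average f) (meanGrad g z) Z z := by
  have h1 := (HasFDerivWithinAt.fun_sum (u := Finset.univ)
    fun i (_ : i ∈ Finset.univ) => (hf i).hasFDerivWithinAt).const_mul (1 / (n : ℝ))
  rw [hasGradientWithinAt_iff_hasFDerivWithinAt]
  have e : InnerProductSpace.toDual ℝ (Pt E F) (meanGrad g z)
      = (1 / (n : ℝ)) • ∑ i, InnerProductSpace.toDual ℝ (Pt E F) (g i z) := by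
    simp [meanGrad]
  rw [e]
  exact h1

/-- The first-order inequalities in `x` and in `y`, both taken at `z`, are added; the value at `z`
cancels. -/
theorem ConvexConcave.saddleIneq {f : Fin n → Pt E F → ℝ} {g : Fin n → Pt E F → Pt E F}
    {X : Set E} {Y : Set F} {a b : ℝ} (hX : Convex ℝ X) (hY : Convex ℝ Y)
    (hf : ∀ i, ∀ z ∈ feasible X Y, HasGradientWithinAt (f i) (g i z) (feasible X Y) z)
    (hcc : ConvexConcave (average f) X Y a b) :
    SaddleIneq (average f) (gradOp g) X Y a b := by
  intro z hz z' hz'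
  have hZ := feasible_convex hX hY
  have hgrad := hasGradientWithinAt_average fun i => hf i z hz
  have hseg : ∀ w ∈ feasible X Y, ∀ t ∈ Set.Ioo (0 : ℝ) 1, z + t • (w - z) ∈ feasible X Y :=
    fun w hw t ht => hZ.add_smul_sub_mem hz hw ⟨ht.1.le, ht.2.le⟩
  have hx : inner ℝ (meanGrad g z) (pt z'.fst z.snd - z) + a / 2 * ‖z'.fst - z.fst‖ ^ 2
      ≤ average f (pt z'.fst z.snd) - average f z := by
    refine first_order_le hgrad (hseg _ ⟨hz'.1, hz.2⟩) fun t ht => ?_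
    have h1 := (hcc.1 z.snd hz.2).2 hz.1 hz'.1 (show 0 ≤ 1 - t by linarith [ht.2]) ht.1.le
      (sub_add_cancel 1 t)
    have e : z + t • (pt z'.fst z.snd - z) = pt ((1 - t) • z.fst + t • z'.fst) z.snd := by
      apply pt_ext
      · simp only [WithLp.add_fst, WithLp.smul_fst, WithLp.sub_fst, WithLp.toLp_fst]
        module
      · simp only [WithLp.add_snd, WithLp.smul_snd, WithLp.sub_snd, WithLp.toLp_snd]
        module
    rw [e]
    rw [norm_sub_rev] at h1
    exact h1
  have hy : inner ℝ (-meanGrad g z) (pt z.fst z'.snd - z) + b / 2 * ‖z'.snd - z.snd‖ ^ 2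
      ≤ -average f (pt z.fst z'.snd) - -average f z := by
    have hneg : HasGradientWithinAt (fun w => -average f w) (-meanGrad g z) (feasible X Y) z := by
      have := hgrad.hasFDerivWithinAt.neg
      rw [← map_neg] at this
      exact hasGradientWithinAt_iff_hasFDerivWithinAt.2 this
    refine first_order_le hneg (hseg _ ⟨hz.1, hz'.2⟩) fun t ht => ?_
    have h1 := (hcc.2 z.fst hz.1).2 hz.2 hz'.2 (show 0 ≤ 1 - t by linarith [ht.2]) ht.1.le
      (sub_add_cancel 1 t)
    have e : z + t • (pt z.fst z'.snd - z) = pt z.fst ((1 - t) • z.snd + t • z'.snd) := by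
      apply pt_ext
      · simp only [WithLp.add_fst, WithLp.smul_fst, WithLp.sub_fst, WithLp.toLp_fst]
        module
      · simp only [WithLp.add_snd, WithLp.smul_snd, WithLp.sub_snd, WithLp.toLp_snd]
        module
    rw [e]
    rw [norm_sub_rev] at h1
    simp only [smul_eq_mul] at h1
    have e2 : average f (pt z.fst z.snd) = average f z := rfl
    rw [e2] at h1
    linarith
  rw [inner_pt] at hx hy
  simp only [gradOp, inner_pt, signOp, WithLp.sub_fst, WithLp.sub_snd, WithLp.toLp_fst,
    WithLp.toLp_snd, WithLp.neg_fst, WithLp.neg_snd, sub_self, inner_zero_right,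
    inner_neg_left] at hx hy ⊢
  linarith

/-! ### The tuned algorithm -/

variable [NeZero n]

theorem alsvreTuned_spec {g : Fin n → Pt E F → Pt E F} {h : Pt E F → ℝ} {X : Set E} {Y : Set F}
    {l μ ν Δ ε : ℝ} {K T : ℕ} (hX : Convex ℝ X) (hY : Convex ℝ Y) (hXc : IsClosed X)
    (hYc : IsClosed Y) (hg : AverageSmooth g (feasible X Y) l)
    (hs : SaddleIneq h (gradOp g) X Y μ ν) (hμ : 0 < μ) (hμν : μ ≤ ν) (hμl : μ ≤ l)
    (hKT : TunedIterations n l μ ν Δ ε K T) {x₀ : E} {y₀ : F} (hx₀ : x₀ ∈ X) (hy₀ : y₀ ∈ Y)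
    (hΔ : ∀ x ∈ X, ∀ y ∈ Y, h (pt x₀ y) - h (pt x y₀) ≤ Δ) :
    wp (alsvreTuned (sfo g) X Y x₀ y₀ l μ ν K T) 0 (fun s _ => infeasPenalty X Y s.1 s.2) ≠ ∞ ∧
    wp (alsvreTuned (sfo g) X Y x₀ y₀ l μ ν K T) 0 (fun s _ => dualityGap h X Y s.1 s.2)
      ≤ ENNReal.ofReal (ε / 2) ∧
    CostLE (alsvreTuned (sfo g) X Y x₀ y₀ l μ ν K T)
      (ENNReal.ofReal (K * (2 * n + 5 / 2 * T))) := by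
  have hn : 1 ≤ n := Nat.one_le_iff_ne_zero.2 (NeZero.ne n)
  have hn' : (1 : ℝ) ≤ n := by exact_mod_cast hn
  obtain ⟨hβ, hβl, -⟩ := proxParam_spec hn hμ hμν hμl
  have hQ : 0 < √(μ / (μ + proxParam n l μ ν)) := by
    apply Real.sqrt_pos.2
    positivity
  have S : AccSetting g h X Y l μ ν (proxParam n l μ ν) (√(μ / (μ + proxParam n l μ ν))) :=
    ⟨hX, hY, hXc, hYc, hg, hs, hμ, hμν, hβ, hβl, hQ, by
      rw [Real.sq_sqrt (by positivity), div_mul_cancel₀ _ (by positivity)]⟩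
  obtain ⟨k, rfl, hk⟩ := hKT.outer
  refine ⟨S.wp_alsvre_penalty_ne_top hKT.params rfl hx₀ hy₀ hΔ _ _,
    (S.wp_alsvre_gap_le hKT.params rfl hx₀ hy₀ hΔ k 0).trans (ENNReal.ofReal_le_ofReal hk), ?_⟩
  refine (costLE_alsvre g X Y x₀ y₀ _ _ (refreshProb n) _ T (k + 1)).mono (le_of_eq ?_)
  have hp : ENNReal.ofReal (refreshProb n) * n = ENNReal.ofReal (1 / 2) := by
    rw [← ENNReal.ofReal_natCast, ← ENNReal.ofReal_mul (refreshProb n).2.1]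
    congr 1
    change 1 / (2 * (n : ℝ)) * n = 1 / 2
    field_simp
  have h2 : (2 : ℝ≥0∞) = ENNReal.ofReal 2 := by simp
  rw [hp, h2, ← ENNReal.ofReal_add (by norm_num) (by norm_num), ← ENNReal.ofReal_natCast,
    ← ENNReal.ofReal_natCast, ← ENNReal.ofReal_natCast, ← ENNReal.ofReal_mul (by positivity),
    ← ENNReal.ofReal_add (by positivity) (by positivity),
    ← ENNReal.ofReal_add (by positivity) (by positivity), ← ENNReal.ofReal_mul (by positivity)]
  congr 1
  ring

theorem wp_bind_pure {α γ : Type} (m : Prog α) (k : α → γ) (c : ℕ) (φ : γ → ℕ → ℝ≥0∞) :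
    wp (m >>= fun a => pure (k a)) c φ = wp m c fun a c' => φ (k a) c' := by
  rw [wp_bind]
  simp only [wp_pure]

theorem alsvreMain_spec {g : Fin n → Pt E F → Pt E F} {h : Pt E F → ℝ} {X : Set E} {Y : Set F}
    {l μx μy Δ ε : ℝ} {K T : ℕ} (hX : Convex ℝ X) (hY : Convex ℝ Y) (hXc : IsClosed X)
    (hYc : IsClosed Y) (hg : AverageSmooth g (feasible X Y) l)
    (hs : SaddleIneq h (gradOp g) X Y μx μy) (hμx : 0 < μx) (hμy : 0 < μy)
    (hμl : min μx μy ≤ l)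
    (hKT : TunedIterations n l (min μx μy) (max μx μy) Δ ε K T) {x₀ : E} {y₀ : F} (hx₀ : x₀ ∈ X)
    (hy₀ : y₀ ∈ Y) (hΔ : ∀ x ∈ X, ∀ y ∈ Y, h (pt x₀ y) - h (pt x y₀) ≤ Δ) :
    (∀ s, IsOutput (alsvreMain (sfo g) X Y x₀ y₀ l μx μy K T) s → s.1 ∈ X ∧ s.2 ∈ Y) ∧
    expect (alsvreMain (sfo g) X Y x₀ y₀ l μx μy K T) (fun s _ => dualityGap h X Y s.1 s.2)
      ≤ ENNReal.ofReal (ε / 2) ∧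
    expect (alsvreMain (sfo g) X Y x₀ y₀ l μx μy K T) (fun _ c => (c : ℝ≥0∞))
      ≤ ENNReal.ofReal (K * (2 * n + 5 / 2 * T)) := by
  suffices hmain : wp (alsvreMain (sfo g) X Y x₀ y₀ l μx μy K T) 0
        (fun s _ => infeasPenalty X Y s.1 s.2) ≠ ∞ ∧
      wp (alsvreMain (sfo g) X Y x₀ y₀ l μx μy K T) 0 (fun s _ => dualityGap h X Y s.1 s.2)
        ≤ ENNReal.ofReal (ε / 2) ∧
      CostLE (alsvreMain (sfo g) X Y x₀ y₀ l μx μy K T)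
        (ENNReal.ofReal (K * (2 * n + 5 / 2 * T))) by
    obtain ⟨h1, h2, h3⟩ := hmain
    refine ⟨fun s hsout => ?_, h2, ?_⟩
    -- An infeasible output of positive probability would make the expected penalty infinite.
    · obtain ⟨c, hc⟩ := ne_top_of_isOutput h1 hsout
      by_contra hcon
      exact hc (if_neg hcon)
    · have h4 := h3 0
      rwa [Nat.cast_zero, zero_add] at h4
  unfold alsvreMain
  by_cases hle : μx ≤ μy
  · rw [if_pos hle]
    rw [min_eq_left hle] at hKT hμl
    rw [max_eq_right hle] at hKT
    exact alsvreTuned_spec hX hY hXc hYc hg hs hμx hle hμl hKT hx₀ hy₀ hΔ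
  · rw [if_neg hle]
    have hle' : μy ≤ μx := (not_le.1 hle).le
    rw [min_eq_right hle'] at hKT hμl
    rw [max_eq_left hle'] at hKT
    rw [swap_sfo]
    -- Negating `h` and exchanging its arguments preserves all assumptions and the gap, with the
    -- moduli interchanged.
    obtain ⟨h1, h2, h3⟩ := alsvreTuned_spec hY hX hYc hXc hg.swap hs.swap hμy hle' hμl hKT hy₀ hx₀
      (fun y hy x hx => by
        have := hΔ x hx y hy
        simp only [WithLp.toLp_fst, WithLp.toLp_snd]
        linarith)
    refine ⟨?_, ?_, ?_⟩
    · rw [wp_bind_pure]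
      refine ne_top_of_le_ne_top h1 (wp_mono _ _ fun s c => le_of_eq ?_)
      unfold infeasPenalty
      by_cases ha : s.2 ∈ X <;> by_cases hb : s.1 ∈ Y <;> simp [ha, hb]
    · rw [wp_bind_pure]
      refine le_trans (wp_mono _ _ fun s c => ?_) h2
      have := dualityGap_le_add (h := h) (h' := fun z : Pt F E => -h (pt z.snd z.fst)) (X := X)
        (Y := Y) (X' := Y) (Y' := X) (x := s.2) (y := s.1) (x' := s.1) (y' := s.2) le_rfl
        (fun B hB u hu v hv => by
          have := hB v hv u hu
          simp only [WithLp.toLp_fst, WithLp.toLp_snd] at this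
          linarith)
      simpa using this
    · exact (h3.bind fun s => costLE_pure _).mono (by simp)

/-! ### The regularized problem -/

/-- The regularizer in fact contributes the modulus `ε / (2 D²)`; the algorithm is tuned with half
of it. -/
theorem SaddleIneq.regularize {h : Pt E F → ℝ} {g : Fin n → Pt E F → Pt E F} {X : Set E}
    {Y : Set F} {b : ℝ} (hs : SaddleIneq h (gradOp g) X Y 0 b) {ε D : ℝ} (hε : 0 ≤ ε) (x₀ : E) :
    SaddleIneq (Minimax.regularize h ε D x₀) (gradOp (proxGrad g (ε / (2 * D ^ 2)) x₀)) X Y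
      (ε / (4 * D ^ 2)) b := by
  have e : Minimax.regularize h ε D x₀
      = fun z => h z + ε / (2 * D ^ 2) / 2 * ‖z.fst - x₀‖ ^ 2 := by
    funext z
    rw [Minimax.regularize, div_div]
    ring_nf
  rw [e]
  refine (hs.prox (ε / (2 * D ^ 2)) x₀).mono ?_ le_rfl
  rw [zero_add]
  rcases eq_or_ne D 0 with rfl | hD
  · simp
  · gcongr
    norm_num

/-- Only the regularizer at the minimizing player's comparison point can increase the difference,
and on `X` it is at most `ε / 4`. -/
theorem dualityGap_le_regularize_add {h : Pt E F → ℝ} {X : Set E} {Y : Set F} {ε D : ℝ} {x₀ : E}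
    (hε : 0 ≤ ε) (hD : 0 < D) (hdiam : ∀ x ∈ X, ‖x - x₀‖ ≤ D) (x : E) (y : F) :
    dualityGap h X Y x y
      ≤ dualityGap (Minimax.regularize h ε D x₀) X Y x y + ENNReal.ofReal (ε / 4) := by
  refine dualityGap_le_add (by positivity) fun B hB u hu v hv => ?_
  have h1 := hB u hu v hv
  simp only [Minimax.regularize, WithLp.toLp_fst] at h1
  have h2 : 0 ≤ ε / (4 * D ^ 2) * ‖x - x₀‖ ^ 2 := by positivity
  have h3 : ε / (4 * D ^ 2) * ‖u - x₀‖ ^ 2 ≤ ε / 4 := by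
    calc _ ≤ ε / (4 * D ^ 2) * D ^ 2 := by
          have := hdiam u hu
          gcongr
      _ = _ := by field_simp
  linarith

theorem dualityGap_le_of_regularize {h : Pt E F → ℝ} {X : Set E} {Y : Set F} {ε D : ℝ} {x₀ : E}
    (hε : 0 ≤ ε) (hD : 0 < D) (hdiam : ∀ x ∈ X, ‖x - x₀‖ ≤ D) {x : E} {y : F}
    (hxy : dualityGap (Minimax.regularize h ε D x₀) X Y x y ≤ ENNReal.ofReal (ε / 2)) :
    dualityGap h X Y x y ≤ ENNReal.ofReal ε := by
  refine (dualityGap_le_regularize_add hε hD hdiam x y).trans ((add_le_add_left hxy _).trans ?_)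
  rw [← ENNReal.ofReal_add (by positivity) (by positivity)]
  exact ENNReal.ofReal_le_ofReal (by linarith)

theorem expect_dualityGap_le_of_regularize {h : Pt E F → ℝ} {X : Set E} {Y : Set F} {ε D : ℝ}
    {x₀ : E} (hε : 0 ≤ ε) (hD : 0 < D) (hdiam : ∀ x ∈ X, ‖x - x₀‖ ≤ D) {m : Prog (E × F)}
    (hm : expect m (fun s _ => dualityGap (Minimax.regularize h ε D x₀) X Y s.1 s.2)
      ≤ ENNReal.ofReal (ε / 2)) :
    expect m (fun s _ => dualityGap h X Y s.1 s.2) ≤ ENNReal.ofReal ε := by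
  refine (wp_mono m 0 fun s _ => dualityGap_le_regularize_add hε hD hdiam s.1 s.2).trans ?_
  rw [wp_add, wp_const]
  refine (add_le_add_left hm _).trans ?_
  rw [← ENNReal.ofReal_add (by positivity) (by positivity)]
  exact ENNReal.ofReal_le_ofReal (by linarith)

end Gradient

/-- The complexity in terms of the parameters of the unregularized problem. -/
theorem coreRate_le_rate {n : ℕ} (hn : 1 ≤ n) {L μy D ε : ℝ} (hL : 0 < L) (hμy : 0 < μy)
    (hD : 0 < D) (hε : 0 < ε) :
    coreRate n (3 * L) (min (ε / (4 * D ^ 2)) μy) (max (ε / (4 * D ^ 2)) μy)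
      ≤ 6 * rate n L μy D ε := by
  have hn' : (0 : ℝ) < n := by exact_mod_cast hn
  have hμx : 0 < ε / (4 * D ^ 2) := by positivity
  have h1 : √(n : ℝ) * (3 * L) / √(ε / (4 * D ^ 2) * μy) = 6 * (D * √(n * L * (L / μy) / ε)) := by
    rw [div_eq_iff (by positivity), mul_assoc, mul_assoc, ← Real.sqrt_mul (by positivity)]
    have e : n * L * (L / μy) / ε * (ε / (4 * D ^ 2) * μy) = n * (L / (2 * D)) ^ 2 := by
      field_simp
      norm_num
    rw [e, Real.sqrt_mul hn'.le, Real.sqrt_sq (by positivity)]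
    field_simp
    norm_num
  have h2 : √(3 * L / min (ε / (4 * D ^ 2)) μy) ≤ 4 * (√(L / μy) + D * √(L / ε)) := by
    have p1 : 0 ≤ √(L / μy) := Real.sqrt_nonneg _
    have p2 : 0 ≤ D * √(L / ε) := by positivity
    rcases min_choice (ε / (4 * D ^ 2)) μy with h | h
    · rw [h]
      calc _ ≤ √((4 * (D * √(L / ε))) ^ 2) := by
            apply Real.sqrt_le_sqrt
            rw [mul_pow, mul_pow, Real.sq_sqrt (by positivity)]
            have e : 3 * L / (ε / (4 * D ^ 2)) = 12 * (D ^ 2 * (L / ε)) := by field_simp; norm_num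
            rw [e]
            have : 0 ≤ D ^ 2 * (L / ε) := by positivity
            linarith
        _ = 4 * (D * √(L / ε)) := Real.sqrt_sq (by positivity)
        _ ≤ _ := by linarith
    · rw [h]
      calc _ ≤ √((4 * √(L / μy)) ^ 2) := by
            apply Real.sqrt_le_sqrt
            rw [mul_pow, Real.sq_sqrt (by positivity), mul_div_assoc]
            have : 0 ≤ L / μy := by positivity
            linarith
        _ = 4 * √(L / μy) := Real.sqrt_sq (by positivity)
        _ ≤ _ := by linarith
  have h3 : (n : ℝ) ^ (3 / 4 : ℝ) * √(3 * L / min (ε / (4 * D ^ 2)) μy)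
      ≤ (n : ℝ) ^ (3 / 4 : ℝ) * (4 * (√(L / μy) + D * √(L / ε))) := by gcongr
  have h4 : 0 ≤ (n : ℝ) ^ (3 / 4 : ℝ) * √(L / μy) := by positivity
  have h5 : 0 ≤ (n : ℝ) ^ (3 / 4 : ℝ) * D * √(L / ε) := by positivity
  unfold coreRate rate
  -- The middle term depends only on the product of the two moduli, so the order of the players does
  -- not matter there.
  rw [min_mul_max, h1]
  linarith

theorem log_twelve_mul_le {x S : ℝ} (hS : 9 / 4 ≤ S) (hx : 1 ≤ x) (hxS : x ≤ 12 * S) :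
    Real.log x ≤ 5 * Real.log S := by
  have h : x ≤ S ^ 5 := by
    calc x ≤ 12 * S := hxS
      _ ≤ S ^ 4 * S := by
          have : (12 : ℝ) ≤ S ^ 4 := by
            calc (12 : ℝ) ≤ (9 / 4) ^ 4 := by norm_num
              _ ≤ S ^ 4 := by gcongr
          gcongr
      _ = S ^ 5 := by ring
  calc _ ≤ Real.log (S ^ 5) := Real.log_le_log (by linarith) h
    _ = _ := by rw [Real.log_pow]; norm_num

theorem iteration_bound_le {n : ℕ} (hn : 1 ≤ n) {L μy D ε Δ : ℝ} (hL : 0 < L) (hμy : 0 < μy)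
    (hD : 0 < D) (hε : 0 < ε) (hεL : ε ≤ 4 * L * D ^ 2) (hΔ : 0 ≤ Δ) :
    115900 * coreRate n (3 * L) (min (ε / (4 * D ^ 2)) μy) (max (ε / (4 * D ^ 2)) μy)
        * Real.log (1 + n + 3 * L / min (ε / (4 * D ^ 2)) μy)
        * Real.log (1 + n + 3 * L / min (ε / (4 * D ^ 2)) μy + Δ / ε)
      ≤ 17385000 * rate n L μy D ε * Real.log (1 + n + L * D ^ 2 / ε + L / μy)
        * Real.log (1 + n + L * D ^ 2 / ε + L / μy + Δ / ε) := by
  have hn' : (1 : ℝ) ≤ n := by exact_mod_cast hn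
  have hμx : 0 < ε / (4 * D ^ 2) := by positivity
  have hmin : 0 < min (ε / (4 * D ^ 2)) μy := lt_min hμx hμy
  have hmax : 0 < max (ε / (4 * D ^ 2)) μy := hμx.trans_le (le_max_left _ _)
  have hκ : 0 ≤ L / μy := by positivity
  have hd : 0 ≤ Δ / ε := by positivity
  -- With `n ≥ 1` this makes the arguments of the logarithms at least `9 / 4`, so that a constant
  -- factor `12` is absorbed by a power.
  have hcond : 1 / 4 ≤ L * D ^ 2 / ε := by
    rw [div_le_div_iff₀ (by norm_num) hε]
    linarith
  have hB : 3 * L / min (ε / (4 * D ^ 2)) μy ≤ 12 * (L * D ^ 2 / ε) + 12 * (L / μy) := by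
    rcases min_choice (ε / (4 * D ^ 2)) μy with h | h
    · rw [h]
      have e : 3 * L / (ε / (4 * D ^ 2)) = 12 * (L * D ^ 2 / ε) := by field_simp; norm_num
      linarith
    · rw [h, mul_div_assoc]
      linarith
  have hB0 : 0 ≤ 3 * L / min (ε / (4 * D ^ 2)) μy := by positivity
  have h1 := log_twelve_mul_le (x := 1 + n + 3 * L / min (ε / (4 * D ^ 2)) μy)
    (S := 1 + n + L * D ^ 2 / ε + L / μy) (by linarith) (by linarith) (by linarith)
  have h2 := log_twelve_mul_le (x := 1 + n + 3 * L / min (ε / (4 * D ^ 2)) μy + Δ / ε)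
    (S := 1 + n + L * D ^ 2 / ε + L / μy + Δ / ε) (by linarith) (by linarith) (by linarith)
  have h0 := coreRate_le_rate hn hL hμy hD hε
  have hl1 : 0 ≤ Real.log (1 + n + 3 * L / min (ε / (4 * D ^ 2)) μy) :=
    Real.log_nonneg (by linarith)
  have hl2 : 0 ≤ Real.log (1 + n + 3 * L / min (ε / (4 * D ^ 2)) μy + Δ / ε) :=
    Real.log_nonneg (by linarith)
  have hr : 0 ≤ rate n L μy D ε := by
    unfold rate
    positivity
  have hl3 : 0 ≤ Real.log (1 + n + L * D ^ 2 / ε + L / μy) := Real.log_nonneg (by linarith)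
  calc _ ≤ 115900 * (6 * rate n L μy D ε) * (5 * Real.log (1 + n + L * D ^ 2 / ε + L / μy))
        * (5 * Real.log (1 + n + L * D ^ 2 / ε + L / μy + Δ / ε)) := by gcongr
    _ = _ := by ring

end

end Minimax

/-! ### Assembly for the regularized problem. -/

theorem corollary2 :
    ∃ C : ℝ, 0 < C ∧
      ∀ (n : ℕ) [NeZero n] (L μy D ε Δ : ℝ),
        0 < L → 0 < μy → 0 < ε → ε ≤ 4 * L * D ^ 2 → 0 ≤ Δ →
        ∃ K T : ℕ,
          ∀ (dx dy : ℕ) (X : Set (EuclideanSpace ℝ (Fin dx))) (Y : Set (EuclideanSpace ℝ (Fin dy)))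
            (f : Fin n → Pt (EuclideanSpace ℝ (Fin dx)) (EuclideanSpace ℝ (Fin dy)) → ℝ)
            (g : Fin n → Pt (EuclideanSpace ℝ (Fin dx)) (EuclideanSpace ℝ (Fin dy)) →
              Pt (EuclideanSpace ℝ (Fin dx)) (EuclideanSpace ℝ (Fin dy)))
            (x₀ : EuclideanSpace ℝ (Fin dx)) (y₀ : EuclideanSpace ℝ (Fin dy)),
            Convex ℝ X → IsClosed X → Bornology.IsBounded X → Metric.diam X = D →
            Convex ℝ Y → IsClosed Y →
            x₀ ∈ X → y₀ ∈ Y →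
            (∀ i, ∀ z ∈ feasible X Y, HasGradientWithinAt (f i) (g i z) (feasible X Y) z) →
            AverageSmooth g (feasible X Y) L →
            ConvexConcave (average f) X Y 0 μy →
            dualityGap (average f) X Y x₀ y₀ ≤ ENNReal.ofReal Δ →
            -- the output is feasible
            (∀ s, IsOutput (alsvreRegularized g X Y x₀ y₀ L μy D ε K T) s → s.1 ∈ X ∧ s.2 ∈ Y) ∧
            -- it is an `ε/2`-saddle point of the regularized function, in expectation
            expect (alsvreRegularized g X Y x₀ y₀ L μy D ε K T)
                (fun s _ => dualityGap (regularize (average f) ε D x₀) X Y s.1 s.2)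
              ≤ ENNReal.ofReal (ε / 2) ∧
            -- it is an `ε`-saddle point of `f`, in expectation
            expect (alsvreRegularized g X Y x₀ y₀ L μy D ε K T)
                (fun s _ => dualityGap (average f) X Y s.1 s.2)
              ≤ ENNReal.ofReal ε ∧
            -- every `ε/2`-saddle point of the regularized function is an `ε`-saddle point of `f`
            (∀ x y, IsApproxSaddle (regularize (average f) ε D x₀) X Y (ε / 2) x y →
              IsApproxSaddle (average f) X Y ε x y) ∧
            -- the expected number of oracle calls
            expect (alsvreRegularized g X Y x₀ y₀ L μy D ε K T) (fun _ c => (c : ℝ≥0∞))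
              ≤ ENNReal.ofReal (C * rate n L μy D ε
                  * Real.log (1 + n + L * D ^ 2 / ε + L / μy)
                  * Real.log (1 + n + L * D ^ 2 / ε + L / μy + Δ / ε)) := by
  refine ⟨17385000, by norm_num, fun n _ L μy D ε Δ hL hμy hε hεL hΔ => ?_⟩
  have hn : 1 ≤ n := Nat.one_le_iff_ne_zero.2 (NeZero.ne n)
  have hD2 : D ≠ 0 := by
    rintro rfl
    norm_num at hεL
    linarith
  have hD2' : 0 < D ^ 2 := by positivity
  have hμx : 0 < ε / (4 * D ^ 2) := by positivity
  have hμxL : ε / (4 * D ^ 2) ≤ L := by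
    rw [div_le_iff₀ (by positivity)]
    linarith
  have hμl : min (ε / (4 * D ^ 2)) μy ≤ 3 * L := (min_le_left _ _).trans (by linarith)
  -- The iteration numbers are fixed here, before dimensions, sets and functions are introduced.
  obtain ⟨K, T, hKT, hcost⟩ := exists_tunedIterations hn (lt_min hμx hμy)
    (min_le_max (a := ε / (4 * D ^ 2)) (b := μy)) hμl hΔ hε
  refine ⟨K, T, fun dx dy X Y f g x₀ y₀ hX hXc hXb hdiam hY hYc hx₀ hy₀ hf hg hcc hgap => ?_⟩
  have hD : 0 < D := lt_of_le_of_ne (hdiam ▸ Metric.diam_nonneg) hD2.symm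
  have hdist : ∀ x ∈ X, ‖x - x₀‖ ≤ D := fun x hx => by
    rw [← dist_eq_norm, ← hdiam]
    exact Metric.dist_le_diam_of_mem hXb hx hx₀
  have hs := ConvexConcave.saddleIneq hX hY hf hcc
  -- The regularizer's gradient is `ε / (2 D²)`-Lipschitz, and `ε ≤ 4 L D²` makes this at most `2
  -- L`.
  have hsm : AverageSmooth (proxGrad g (ε / (2 * D ^ 2)) x₀) (feasible X Y) (3 * L) := by
    intro z hz z' hz'
    refine (hg.prox hL.le (by positivity : 0 ≤ ε / (2 * D ^ 2)) x₀ z hz z' hz').trans ?_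
    have : ε / (2 * D ^ 2) ≤ 2 * L := by
      rw [div_le_iff₀ (by positivity)]
      linarith
    gcongr
    linarith
  -- The regularizer vanishes at `x₀` and is nonnegative elsewhere, so the initial gap bound `Δ`
  -- carries over.
  have hΔ' : ∀ x ∈ X, ∀ y ∈ Y, regularize (average f) ε D x₀ (pt x₀ y)
      - regularize (average f) ε D x₀ (pt x y₀) ≤ Δ := fun x hx y hy => by
    have h1 := sub_le_of_dualityGap_le hΔ hgap hx hy
    have h2 : 0 ≤ ε / (4 * D ^ 2) * ‖x - x₀‖ ^ 2 := by positivity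
    simp only [regularize, WithLp.toLp_fst, sub_self, norm_zero]
    linarith
  obtain ⟨hout, hexp, hnum⟩ := alsvreMain_spec hX hY hXc hYc hsm (hs.regularize hε.le x₀) hμx hμy
    hμl hKT hx₀ hy₀ hΔ'
  rw [alsvreRegularized, addProx_sfo]
  refine ⟨hout, hexp, ?_, fun x y ⟨hx, hy, hxy⟩ => ⟨hx, hy, ?_⟩, ?_⟩
  · exact expect_dualityGap_le_of_regularize hε.le hD hdist hexp
  · exact dualityGap_le_of_regularize hε.le hD hdist hxy
  · exact hnum.trans (ENNReal.ofReal_le_ofReal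
      (hcost.trans (iteration_bound_le hn hL hμy hD hε hεL hΔ)))
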